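/- \textbf{Conventions.} Graphs are finite and simple. A coloured graph $(G,\chi)$ is a graph $G$ with vertex set $V=\{0,\dots,n-1\}$ and a map $\chi\colon V\to\mathbb N$; isomorphisms of coloured graphs preserve colours. A class $\mathcal C$ of graphs is closed under isomorphism, and the coloured graphs in $\mathcal C$ are all $(G,\chi)$ with $G\in\mathcal C$ and $\chi$ an arbitrary colouring. For $k\ge 2$ the $k$-dimensional Weisfeiler--Leman algorithm starts with the colouring $\chi_0$ of $V^k$ by atomic types (vertex colours of the entries, equalities and adjacencies between them) and sets $$\chi_{i+1}(\bar v)=\bigl(\chi_i(\bar v);\ \{\!\!\{(\chi_i(\bar v[w/1]),\dots,\chi_i(\bar v[w/k])) \mid w\in V\}\!\!\}\bigr),$$ where $\bar v[w/j]$ is $\bar v$ with its $j$-th entry replaced by $w$. For $k=1$ it starts with $\chi_0=\chi$ and the multiset ranges only over the neighbours $w$ of the vertex. The stable colouring is $\chi_{(\infty)}=\chi_i$ for the least $i$ such that $\chi_{i+1}$ induces the same partition of $V^k$ as $\chi_i$. The algorithm identifies a coloured graph $G$ if for every coloured graph $H$ not isomorphic to $G$ some colour occurs a different number of times in the stable colourings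 of $G$ and of $H$. A graph canonisation for $\mathcal C$ is a map $\kappa$ from the coloured graphs in $\mathcal C$ to the coloured graphs in $\mathcal C$ such that $\kappa(G)\cong G$ for all $G$, and $\kappa(G)=\kappa(H)$ whenever $G\cong H$. Running time is the number of steps of a unit-cost word RAM (assignments, $+$, truncated $-$, $\cdot$, integer division and remainder, comparisons, random access to arrays, branching and loops) that receives $n$, the vertex colours and the adjacency matrix, and whose words hold the natural numbers smaller than $M+c(n+1)^c$, where $M$ is the largest colour of the input and $c$ is a constant. \textbf{Theorem.} Let $k\ge 1$, let $\mathcal C$ be a class of graphs, and suppose that the $k$-dimensional Weisfeiler--Leman algorithm identifies all coloured graphs in $\mathcal C$. Then there is a graph canonisation for $\mathcal C$ that can be computed in time $O(n^{k+3}\log n)$, where $n$ is the number of vertices of the input graph. -/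

import Mathlib

/-- A finite vertex-coloured graph. The vertex set is `{0, …, order - 1}`, which is how a graph is
presented to an algorithm; the colours are natural numbers. An uncoloured graph is a graph all of
whose vertices have the same colour. -/
structure ColouredGraph where
  order : ℕ
  graph : SimpleGraph (Fin order)
  colour : Fin order → ℕ

namespace ColouredGraph

/-- Isomorphism of coloured graphs: a graph isomorphism that respects the colours. -/
def Iso (G H : ColouredGraph) : Prop :=
  ∃ e : G.graph ≃g H.graph, ∀ v, H.colour (e v) = G.colour v

/-- The colours that occur in round `i` of the `k`-dimensional Weisfeiler-Leman algorithm. A colour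
of round `0` is an atomic type: the colours of the vertices of a `k`-tuple, the equalities between
its entries and the adjacencies between its entries. A colour of round `i + 1` is a pair consisting
of a colour of round `i` and a multiset of `k`-tuples of such colours. -/
def WLColour (k : ℕ) : ℕ → Type
  | 0 => (Fin k → ℕ) × (Fin k → Fin k → Prop) × (Fin k → Fin k → Prop)
  | i + 1 => WLColour k i × Multiset (Fin k → WLColour k i)

open Classical in
/-- The colouring of the `k`-tuples of vertices after `i` rounds of the `k`-dimensional
Weisfeiler-Leman algorithm, for `k ≥ 1`. For `k ≥ 2` the multiset ranges over all vertices `w`; for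
`k = 1` it ranges over the neighbours `w` of the single entry of the tuple. (For `k = 1` the
equality and adjacency parts of the initial colour are constant, so that the initial colour carries
exactly the colour of the vertex.) -/
noncomputable def wl (G : ColouredGraph) (k : ℕ) :
    (i : ℕ) → (Fin k → Fin G.order) → WLColour k i
  | 0, v => (fun a => G.colour (v a), fun a b => v a = v b, fun a b => G.graph.Adj (v a) (v b))
  | i + 1, v => (G.wl k i v,
      (Finset.univ.filter (fun w => k = 1 → ∀ a, G.graph.Adj (v a) w)).val.map
        (fun w a => G.wl k i (Function.update v a w)))

/-- The colouring of round `i + 1` induces the same partition of the tuples as that of round `i`. -/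
def WLStableAt (G : ColouredGraph) (k i : ℕ) : Prop :=
  ∀ v v' : Fin k → Fin G.order, G.wl k i v = G.wl k i v' → G.wl k (i + 1) v = G.wl k (i + 1) v'

theorem exists_wlStableAt (G : ColouredGraph) (k : ℕ) : ∃ i, G.WLStableAt k i := by
  have hfin : Finite (Setoid (Fin k → Fin G.order)) :=
    Finite.of_injective (fun s : Setoid (Fin k → Fin G.order) => (s.r : _ → _ → Prop))
      (fun s t h => Setoid.ext fun a b => by
        have := congrFun (congrFun h a) b
        exact iff_of_eq this)
  have hfin' : Finite (Setoid (Fin k → Fin G.order))ᵒᵈ := hfin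
  have hmono : Monotone (fun i => OrderDual.toDual (Setoid.ker (G.wl k i))) := by
    refine monotone_nat_of_le_succ fun i => ?_
    intro v v' h
    exact congrArg Prod.fst h
  obtain ⟨i, hi⟩ := WellFoundedGT.monotone_chain_condition
    (⟨_, hmono⟩ : ℕ →o (Setoid (Fin k → Fin G.order))ᵒᵈ)
  refine ⟨i, fun v v' h => ?_⟩
  have hs : Setoid.ker (G.wl k i) = Setoid.ker (G.wl k (i + 1)) := hi (i + 1) (Nat.le_succ i)
  have h' : Setoid.ker (G.wl k i) v v' := h
  rw [hs] at h'
  exact h'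

open Classical in
/-- The first round whose colouring is stable. -/
noncomputable def wlStableRound (G : ColouredGraph) (k : ℕ) : ℕ :=
  Nat.find (G.exists_wlStableAt k)

/-- The stable colouring of the `k`-tuples of vertices. -/
noncomputable def wlStable (G : ColouredGraph) (k : ℕ) (v : Fin k → Fin G.order) :
    Σ i, WLColour k i :=
  ⟨G.wlStableRound k, G.wl k (G.wlStableRound k) v⟩

/-- The `k`-dimensional Weisfeiler-Leman algorithm distinguishes `G` and `H`: some colour is
taken by different numbers of `k`-tuples in the two stable colourings. -/
def WLDistinguishes (k : ℕ) (G H : ColouredGraph) : Prop :=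
  ∃ c : Σ i, WLColour k i, {v | G.wlStable k v = c}.ncard ≠ {v | H.wlStable k v = c}.ncard

/-- The `k`-dimensional Weisfeiler-Leman algorithm identifies `G`: it distinguishes `G` from every
coloured graph that is not isomorphic to `G`. -/
def WLIdentifies (k : ℕ) (G : ColouredGraph) : Prop :=
  ∀ H : ColouredGraph, ¬ G.Iso H → WLDistinguishes k G H

/-- The largest colour of a vertex (`0` for the empty graph). -/
def maxColour (G : ColouredGraph) : ℕ := Finset.univ.sup G.colour

end ColouredGraph

/-- A class of finite graphs: a family of graphs that is closed under isomorphism. -/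
structure GraphClass where
  mem : ∀ n : ℕ, Set (SimpleGraph (Fin n))
  iso_closed : ∀ (n : ℕ) (G H : SimpleGraph (Fin n)), G ∈ mem n → Nonempty (G ≃g H) → H ∈ mem n

/-- The coloured graphs in a class of graphs: all graphs of the class with all colourings. -/
def GraphClass.coloured (C : GraphClass) : Set ColouredGraph :=
  {G | G.graph ∈ C.mem G.order}

/-- A graph canonisation for a family `S` of coloured graphs. -/
def IsCanonisation {S : Set ColouredGraph} (κ : S → S) : Prop :=
  (∀ G : S, (κ G).1.Iso G.1) ∧ ∀ G H : S, G.1.Iso H.1 → κ G = κ H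

/-! Programs of a word random access machine with unit cost. A program works on variables and on
random access arrays of natural numbers; it mentions only finitely many of either. -/

namespace RAM

/-- The contents of the memory: `var x` is the value of variable `x`, and `arr a j` is the entry
of array `a` at address `j`. -/
structure Store where
  var : ℕ → ℕ
  arr : ℕ → ℕ → ℕ

/-- The right-hand sides of elementary assignments. Apart from a constant, every operand is the
name of a variable; `get a x` reads array `a` at the address stored in variable `x`. -/
inductive Op where
  | const (c : ℕ)
  | copy (x : ℕ)
  | add (x y : ℕ)
  | sub (x y : ℕ)
  | mul (x y : ℕ)
  | div (x y : ℕ)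
  | mod (x y : ℕ)
  | get (a x : ℕ)

def Op.eval (s : Store) : Op → ℕ
  | const c => c
  | copy x => s.var x
  | add x y => s.var x + s.var y
  | sub x y => s.var x - s.var y
  | mul x y => s.var x * s.var y
  | div x y => s.var x / s.var y
  | mod x y => s.var x % s.var y
  | get a x => s.arr a (s.var x)

/-- Elementary tests on variables. -/
inductive Test where
  | eq (x y : ℕ)
  | lt (x y : ℕ)

def Test.Holds (s : Store) : Test → Prop
  | eq x y => s.var x = s.var y
  | lt x y => s.var x < s.var y

/-- Programs. `put a x y` writes the value of variable `y` to array `a` at the address stored in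
variable `x`. -/
inductive Prog where
  | set (x : ℕ) (o : Op)
  | put (a x y : ℕ)
  | seq (p q : Prog)
  | cond (b : Test) (p q : Prog)
  | loop (b : Test) (p : Prog)

/-- Assign the value `m` to the variable `x`. -/
def Store.setVar (s : Store) (x m : ℕ) : Store :=
  { s with var := Function.update s.var x m }

/-- Write `m` to array `a` at address `j`. -/
def Store.setArr (s : Store) (a j m : ℕ) : Store :=
  { s with arr := Function.update s.arr a (Function.update (s.arr a) j m) }

/-- `Exec W p s t s'`: on a machine whose words hold the numbers below `W`, program `p` started on
the store `s` halts after exactly `t` steps with the store `s'`, and no value that it assigns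
overflows a word. Each elementary assignment, array access and test costs one step. -/
inductive Exec (W : ℕ) : Prog → Store → ℕ → Store → Prop where
  | set (x : ℕ) (o : Op) (s : Store) : o.eval s < W →
      Exec W (.set x o) s 1 (s.setVar x (o.eval s))
  | put (a x y : ℕ) (s : Store) :
      Exec W (.put a x y) s 1 (s.setArr a (s.var x) (s.var y))
  | seq (p q : Prog) (s s' s'' : Store) (t t' : ℕ) : Exec W p s t s' → Exec W q s' t' s'' →
      Exec W (.seq p q) s (t + t') s''
  | cond_true (b : Test) (p q : Prog) (s s' : Store) (t : ℕ) : b.Holds s → Exec W p s t s' →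
      Exec W (.cond b p q) s (t + 1) s'
  | cond_false (b : Test) (p q : Prog) (s s' : Store) (t : ℕ) : ¬ b.Holds s → Exec W q s t s' →
      Exec W (.cond b p q) s (t + 1) s'
  | loop_true (b : Test) (p : Prog) (s s' s'' : Store) (t t' : ℕ) : b.Holds s →
      Exec W p s t s' → Exec W (.loop b p) s' t' s'' → Exec W (.loop b p) s (t + t' + 1) s''
  | loop_false (b : Test) (p : Prog) (s : Store) : ¬ b.Holds s →
      Exec W (.loop b p) s 1 s

open Classical in
/-- The initial store for the coloured graph `G` with `n` vertices: variable `0` holds `n`, array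
`0` holds the colours of the vertices, array `1` holds the adjacency matrix row by row, and
everything else is `0`. -/
noncomputable def input (G : ColouredGraph) : Store where
  var x := if x = 0 then G.order else 0
  arr a j :=
    if a = 0 then (if h : j < G.order then G.colour ⟨j, h⟩ else 0)
    else if a = 1 then
      (if ∃ u v : Fin G.order, G.graph.Adj u v ∧ j = G.order * u + v then 1 else 0)
    else 0

open Classical in
/-- The store `s` presents `G` as its output, in the format of the input; the other cells of the
store are irrelevant. -/
def Outputs (s : Store) (G : ColouredGraph) : Prop :=
  s.var 0 = G.order ∧ (∀ v : Fin G.order, s.arr 0 v = G.colour v) ∧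
    ∀ u v : Fin G.order, s.arr 1 (G.order * u + v) = if G.graph.Adj u v then 1 else 0

/-- `κ` is computable in time `O(f n)`, where `n` is the number of vertices: some program computes
`κ G` from every `G` in at most `T n` steps, where `T n = O(f n)`. The words of the machine have
logarithmic length: they hold the numbers below `maxColour G + c (n + 1) ^ c`, for a constant `c`. -/
def ComputableInTime {S : Set ColouredGraph} (κ : S → S) (f : ℕ → ℝ) : Prop :=
  ∃ (p : Prog) (c : ℕ) (T : ℕ → ℕ),
    (fun n => (T n : ℝ)) =O[Filter.atTop] f ∧
    ∀ G : S, ∃ t s', t ≤ T G.1.order ∧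
      Exec (G.1.maxColour + c * (G.1.order + 1) ^ c) p (input G.1) t s' ∧ Outputs s' (κ G).1

end RAM

namespace RAM

/-! ### A small imperative language with expressions, compiled to `Prog` -/

inductive BinOp where
  | add | sub | mul | div | mod

def BinOp.eval : BinOp → ℕ → ℕ → ℕ
  | add, a, b => a + b
  | sub, a, b => a - b
  | mul, a, b => a * b
  | div, a, b => a / b
  | mod, a, b => a % b

def BinOp.toOp : BinOp → ℕ → ℕ → Op
  | add => Op.add
  | sub => Op.sub
  | mul => Op.mul
  | div => Op.div
  | mod => Op.mod

theorem BinOp.eval_toOp (o : BinOp) (x y : ℕ) (s : Store) :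
    (o.toOp x y).eval s = o.eval (s.var x) (s.var y) := by
  cases o <;> rfl

/-- `true` if the result of the operation can exceed both operands. -/
def BinOp.grows : BinOp → Bool
  | add => true
  | mul => true
  | _ => false

theorem BinOp.eval_le (o : BinOp) (h : o.grows = false) (a b : ℕ) : o.eval a b ≤ a := by
  cases o
  · cases h
  · exact Nat.sub_le _ _
  · cases h
  · exact Nat.div_le_self _ _
  · exact Nat.mod_le _ _

/-- Expressions. Variables in expressions should have names below `1000`; the variables from `1000`
on are used for intermediate results. -/
inductive Ex where
  | lit (c : ℕ)
  | v (x : ℕ)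
  | bin (o : BinOp) (a b : Ex)
  | get (a : ℕ) (e : Ex)

namespace Ex

instance : Add Ex := ⟨bin .add⟩
instance : Sub Ex := ⟨bin .sub⟩
instance : Mul Ex := ⟨bin .mul⟩
instance : Div Ex := ⟨bin .div⟩
instance : Mod Ex := ⟨bin .mod⟩

def eval (s : Store) : Ex → ℕ
  | lit c => c
  | v x => s.var x
  | bin o a b => o.eval (a.eval s) (b.eval s)
  | get a e => s.arr a (e.eval s)

/-- No intermediate result overflows, provided that the values in the store are below `W`. -/
def Ok (W : ℕ) (s : Store) : Ex → Prop
  | lit c => c < W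
  | v _ => True
  | bin o a b => a.Ok W s ∧ b.Ok W s ∧ (o.grows = true → o.eval (a.eval s) (b.eval s) < W)
  | get _ e => e.Ok W s

def Fits : Ex → Prop
  | lit _ => True
  | v x => x < 1000
  | bin _ a b => a.Fits ∧ b.Fits
  | get _ e => e.Fits

def cost : Ex → ℕ
  | lit _ => 1
  | v _ => 1
  | bin _ a b => a.cost + (b.cost + 1)
  | get _ e => e.cost + 1

def depth : Ex → ℕ
  | lit _ => 1
  | v _ => 1
  | bin _ a b => max a.depth (b.depth + 1)
  | get _ e => e.depth

def compile : Ex → ℕ → Prog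
  | lit c, t => .set t (.const c)
  | v x, t => .set t (.copy x)
  | bin o a b, t => .seq (a.compile t) (.seq (b.compile (t + 1)) (.set t (o.toOp t (t + 1))))
  | get a e, t => .seq (e.compile t) (.set t (.get a t))

section
variable {s : Store} {W : ℕ} (a b : Ex)
@[simp] theorem eval_lit (c : ℕ) : (lit c).eval s = c := rfl
@[simp] theorem eval_v (x : ℕ) : (v x).eval s = s.var x := rfl
@[simp] theorem eval_get (x : ℕ) : (get x a).eval s = s.arr x (a.eval s) := rfl
@[simp] theorem eval_add : (a + b).eval s = a.eval s + b.eval s := rfl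
@[simp] theorem eval_sub : (a - b).eval s = a.eval s - b.eval s := rfl
@[simp] theorem eval_mul : (a * b).eval s = a.eval s * b.eval s := rfl
@[simp] theorem eval_div : (a / b).eval s = a.eval s / b.eval s := rfl
@[simp] theorem eval_mod : (a % b).eval s = a.eval s % b.eval s := rfl
@[simp] theorem ok_lit (c : ℕ) : (lit c).Ok W s ↔ c < W := Iff.rfl
@[simp] theorem ok_v (x : ℕ) : (v x).Ok W s := trivial
@[simp] theorem ok_get (x : ℕ) : (get x a).Ok W s ↔ a.Ok W s := Iff.rfl
@[simp] theorem ok_add : (a + b).Ok W s ↔ a.Ok W s ∧ b.Ok W s ∧ a.eval s + b.eval s < W :=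
  ⟨fun h => ⟨h.1, h.2.1, h.2.2 rfl⟩, fun h => ⟨h.1, h.2.1, fun _ => h.2.2⟩⟩
@[simp] theorem ok_mul : (a * b).Ok W s ↔ a.Ok W s ∧ b.Ok W s ∧ a.eval s * b.eval s < W :=
  ⟨fun h => ⟨h.1, h.2.1, h.2.2 rfl⟩, fun h => ⟨h.1, h.2.1, fun _ => h.2.2⟩⟩
@[simp] theorem ok_sub : (a - b).Ok W s ↔ a.Ok W s ∧ b.Ok W s :=
  ⟨fun h => ⟨h.1, h.2.1⟩, fun h => ⟨h.1, h.2, fun h' => by cases h'⟩⟩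
@[simp] theorem ok_div : (a / b).Ok W s ↔ a.Ok W s ∧ b.Ok W s :=
  ⟨fun h => ⟨h.1, h.2.1⟩, fun h => ⟨h.1, h.2, fun h' => by cases h'⟩⟩
@[simp] theorem ok_mod : (a % b).Ok W s ↔ a.Ok W s ∧ b.Ok W s :=
  ⟨fun h => ⟨h.1, h.2.1⟩, fun h => ⟨h.1, h.2, fun h' => by cases h'⟩⟩
@[simp] theorem fits_lit (c : ℕ) : (lit c).Fits := trivial
@[simp] theorem fits_v (x : ℕ) : (v x).Fits ↔ x < 1000 := Iff.rfl
@[simp] theorem fits_get (x : ℕ) : (get x a).Fits ↔ a.Fits := Iff.rfl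
@[simp] theorem fits_add : (a + b).Fits ↔ a.Fits ∧ b.Fits := Iff.rfl
@[simp] theorem fits_sub : (a - b).Fits ↔ a.Fits ∧ b.Fits := Iff.rfl
@[simp] theorem fits_mul : (a * b).Fits ↔ a.Fits ∧ b.Fits := Iff.rfl
@[simp] theorem fits_div : (a / b).Fits ↔ a.Fits ∧ b.Fits := Iff.rfl
@[simp] theorem fits_mod : (a % b).Fits ↔ a.Fits ∧ b.Fits := Iff.rfl
@[simp] theorem cost_lit (c : ℕ) : (lit c).cost = 1 := rfl
@[simp] theorem cost_v (x : ℕ) : (v x).cost = 1 := rfl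
@[simp] theorem cost_get (x : ℕ) : (get x a).cost = a.cost + 1 := rfl
@[simp] theorem cost_add : (a + b).cost = a.cost + (b.cost + 1) := rfl
@[simp] theorem cost_sub : (a - b).cost = a.cost + (b.cost + 1) := rfl
@[simp] theorem cost_mul : (a * b).cost = a.cost + (b.cost + 1) := rfl
@[simp] theorem cost_div : (a / b).cost = a.cost + (b.cost + 1) := rfl
@[simp] theorem cost_mod : (a % b).cost = a.cost + (b.cost + 1) := rfl
@[simp] theorem depth_lit (c : ℕ) : (lit c).depth = 1 := rfl
@[simp] theorem depth_v (x : ℕ) : (v x).depth = 1 := rfl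
@[simp] theorem depth_get (x : ℕ) : (get x a).depth = a.depth := rfl
@[simp] theorem depth_add : (a + b).depth = max a.depth (b.depth + 1) := rfl
@[simp] theorem depth_sub : (a - b).depth = max a.depth (b.depth + 1) := rfl
@[simp] theorem depth_mul : (a * b).depth = max a.depth (b.depth + 1) := rfl
@[simp] theorem depth_div : (a / b).depth = max a.depth (b.depth + 1) := rfl
@[simp] theorem depth_mod : (a % b).depth = max a.depth (b.depth + 1) := rfl
end

theorem depth_pos (e : Ex) : 1 ≤ e.depth := by
  induction e with
  | lit | v => exact le_rfl
  | bin o a b iha _ => exact le_trans iha (le_max_left _ _)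
  | get a e ih => exact ih

end Ex

/-- All values in the store are below `W`. -/
def Bdd (W : ℕ) (s : Store) : Prop :=
  (∀ x, s.var x < W) ∧ ∀ a j, s.arr a j < W

/-- All values in the store are below `W`, and the variables for intermediate results are `0`. -/
def Good (W : ℕ) (s : Store) : Prop :=
  Bdd W s ∧ ∀ x, 1000 ≤ x → s.var x = 0

@[simp] theorem Store.var_setVar (s : Store) (x m y : ℕ) :
    (s.setVar x m).var y = if y = x then m else s.var y := by
  simp [Store.setVar, Function.update_apply]

@[simp] theorem Store.arr_setVar (s : Store) (x m : ℕ) : (s.setVar x m).arr = s.arr := rfl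

@[simp] theorem Store.var_setArr (s : Store) (a j m : ℕ) : (s.setArr a j m).var = s.var := rfl

@[simp] theorem Store.arr_setArr_self (s : Store) (a j m i : ℕ) :
    (s.setArr a j m).arr a i = if i = j then m else s.arr a i := by
  simp [Store.setArr, Function.update_apply]

@[simp] theorem Store.arr_setArr_of_ne (s : Store) {a b : ℕ} (j m : ℕ) (h : b ≠ a) :
    (s.setArr a j m).arr b = s.arr b := by
  simp [Store.setArr, Function.update_of_ne h]

theorem Store.ext' {s s' : Store} (h : ∀ x, s.var x = s'.var x) (h' : s.arr = s'.arr) : s = s' := by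
  cases s; cases s'
  congr 1
  exact funext h

theorem Bdd.setVar {W : ℕ} {s : Store} (h : Bdd W s) {x m : ℕ} (hm : m < W) :
    Bdd W (s.setVar x m) := by
  refine ⟨fun y => ?_, h.2⟩
  rw [Store.var_setVar]
  split
  · exact hm
  · exact h.1 y

theorem Bdd.setArr {W : ℕ} {s : Store} (h : Bdd W s) {a j m : ℕ} (hm : m < W) :
    Bdd W (s.setArr a j m) := by
  refine ⟨h.1, fun b i => ?_⟩
  by_cases hb : b = a
  · subst hb
    rw [Store.arr_setArr_self]
    split
    · exact hm
    · exact h.2 _ i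
  · rw [Store.arr_setArr_of_ne _ _ _ hb]
    exact h.2 b i

namespace Ex

theorem eval_lt {W : ℕ} {s : Store} (hs : Bdd W s) (e : Ex) (h : e.Ok W s) : e.eval s < W := by
  induction e with
  | lit c => exact h
  | v x => exact hs.1 x
  | bin o a b iha ihb =>
    cases hg : o.grows
    · exact (o.eval_le hg _ _).trans_lt (iha h.1)
    · exact h.2.2 hg
  | get a e ih => exact hs.2 _ _

theorem eval_congr {s s' : Store} (ha : s'.arr = s.arr) (hv : ∀ x < 1000, s'.var x = s.var x)
    (e : Ex) (he : e.Fits) : e.eval s' = e.eval s := by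
  induction e with
  | lit c => rfl
  | v x => exact hv x he
  | bin o a b iha ihb => simp only [eval, iha he.1, ihb he.2]
  | get a e ih => simp only [eval, ih he, ha]

theorem ok_congr {s s' : Store} {W : ℕ} (ha : s'.arr = s.arr) (hv : ∀ x < 1000, s'.var x = s.var x)
    (e : Ex) (he : e.Fits) (h : e.Ok W s) : e.Ok W s' := by
  induction e with
  | lit c => exact h
  | v x => trivial
  | bin o a b iha ihb =>
    refine ⟨iha he.1 h.1, ihb he.2 h.2.1, ?_⟩
    rw [eval_congr ha hv a he.1, eval_congr ha hv b he.2]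
    exact h.2.2
  | get a e ih => exact ih he h

theorem exec_compile {W : ℕ} (e : Ex) (he : e.Fits) (t : ℕ) (ht : 1000 ≤ t) (s : Store)
    (hs : Bdd W s) (hok : e.Ok W s) :
    ∃ s', Exec W (e.compile t) s e.cost s' ∧ Bdd W s' ∧ s'.arr = s.arr ∧
      (∀ x < t, s'.var x = s.var x) ∧ (∀ x, t + e.depth ≤ x → s'.var x = s.var x) ∧
      s'.var t = e.eval s := by
  induction e generalizing t s with
  | lit c =>
    refine ⟨_, Exec.set _ _ _ hok, hs.setVar hok, rfl, ?_, ?_, ?_⟩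
    · intro x hx; simp [hx.ne]
    · intro x hx
      have : x ≠ t := by simp at hx; omega
      simp [this]
    · simp [Op.eval]
  | v y =>
    have hy : (Op.copy y).eval s < W := hs.1 y
    refine ⟨_, Exec.set _ _ _ hy, hs.setVar hy, rfl, ?_, ?_, ?_⟩
    · intro x hx; simp [hx.ne]
    · intro x hx
      have : x ≠ t := by simp at hx; omega
      simp [this]
    · simp [Op.eval]
  | bin o a b iha ihb =>
    obtain ⟨s1, e1, b1, a1, l1, u1, v1⟩ := iha he.1 t ht s hs hok.1
    have hv1 : ∀ x < 1000, s1.var x = s.var x := fun x hx => l1 x (by omega)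
    obtain ⟨s2, e2, b2, a2, l2, u2, v2⟩ := ihb he.2 (t + 1) (by omega) s1 b1
      (ok_congr a1 hv1 b he.2 hok.2.1)
    have hval : (o.toOp t (t + 1)).eval s2 = (bin o a b).eval s := by
      rw [BinOp.eval_toOp, l2 t (by omega), v1, v2, eval_congr a1 hv1 b he.2]
      rfl
    have hlt : (o.toOp t (t + 1)).eval s2 < W := by
      rw [hval]
      exact eval_lt hs _ hok
    refine ⟨_, Exec.seq _ _ _ _ _ _ _ e1 (Exec.seq _ _ _ _ _ _ _ e2 (Exec.set _ _ _ hlt)),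
      b2.setVar hlt, ?_, ?_, ?_, ?_⟩
    · simp [a1, a2]
    · intro x hx
      rw [Store.var_setVar, if_neg hx.ne, l2 x (by omega), l1 x hx]
    · intro x hx
      have h1 : t + a.depth ≤ x := le_trans (by simp [depth]) hx
      have h2 : t + 1 + b.depth ≤ x := le_trans (by simp [depth]; omega) hx
      rw [Store.var_setVar, if_neg (by have := a.depth_pos; omega), u2 x h2, u1 x h1]
    · simp [hval]
  | get a e ih =>
    obtain ⟨s1, e1, b1, a1, l1, u1, v1⟩ := ih he t ht s hs hok
    have hlt : (Op.get a t).eval s1 < W := b1.2 _ _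
    refine ⟨_, Exec.seq _ _ _ _ _ _ _ e1 (Exec.set _ _ _ hlt), b1.setVar hlt, ?_, ?_, ?_, ?_⟩
    · simp [a1]
    · intro x hx
      rw [Store.var_setVar, if_neg hx.ne, l1 x hx]
    · intro x hx
      have h1 : t + e.depth ≤ x := hx
      rw [Store.var_setVar, if_neg (by have := e.depth_pos; omega), u1 x h1]
    · simp [Op.eval, v1, a1, eval]

end Ex

/-- Set the variables `1000, …, 1000 + m` to `0`. -/
def clear : ℕ → Prog
  | 0 => .set 1000 (.const 0)
  | m + 1 => .seq (.set (1000 + (m + 1)) (.const 0)) (clear m)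

theorem exec_clear {W : ℕ} (m : ℕ) (s s' : Store) (hs : Bdd W s) (hs' : Good W s')
    (ha : s.arr = s'.arr) (hl : ∀ x < 1000, s.var x = s'.var x)
    (hu : ∀ x, 1000 + m < x → s.var x = 0) : Exec W (clear m) s (m + 1) s' := by
  have hW : 0 < W := (Nat.zero_le _).trans_lt (hs.1 0)
  induction m generalizing s with
  | zero =>
    have : s' = s.setVar 1000 ((Op.const 0).eval s) := by
      refine Store.ext' (fun x => ?_) ha.symm
      rw [Store.var_setVar]
      split
      · subst x; exact hs'.2 _ le_rfl
      · rcases lt_or_ge x 1000 with h | h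
        · exact (hl x h).symm
        · rw [hu x (by omega), hs'.2 x h]
    rw [this]
    exact Exec.set _ _ _ hW
  | succ m ih =>
    have h0 : (Op.const 0).eval s < W := hW
    have h1 := ih (s.setVar (1000 + (m + 1)) 0) (hs.setVar h0) ha
      (fun x hx => by rw [Store.var_setVar, if_neg (by omega), hl x hx])
      (fun x hx => by
        rw [Store.var_setVar]
        split
        · rfl
        · exact hu x (by omega))
    have := Exec.seq _ _ _ _ _ _ _ (Exec.set (1000 + (m + 1)) (Op.const 0) s h0) h1
    rwa [show 1 + (m + 1) = m + 1 + 1 by omega] at this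

/-- Tests on expressions. -/
inductive Tst where
  | lt (a b : Ex)
  | eq (a b : Ex)

namespace Tst

def lhs : Tst → Ex
  | lt a _ => a
  | eq a _ => a

def rhs : Tst → Ex
  | lt _ b => b
  | eq _ b => b

def test : Tst → Test
  | lt _ _ => .lt 1000 1001
  | eq _ _ => .eq 1000 1001

def Holds (s : Store) : Tst → Prop
  | lt a b => a.eval s < b.eval s
  | eq a b => a.eval s = b.eval s

@[simp] theorem holds_lt (s : Store) (a b : Ex) : (lt a b).Holds s ↔ a.eval s < b.eval s := Iff.rfl
@[simp] theorem holds_eq (s : Store) (a b : Ex) : (eq a b).Holds s ↔ a.eval s = b.eval s := Iff.rfl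

def pre (b : Tst) : Prog := .seq (b.lhs.compile 1000) (b.rhs.compile 1001)

def depth (b : Tst) : ℕ := max b.lhs.depth (b.rhs.depth + 1)

def cost (b : Tst) : ℕ := b.lhs.cost + b.rhs.cost + b.depth + 2

def Fits (b : Tst) : Prop := b.lhs.Fits ∧ b.rhs.Fits

def Ok (W : ℕ) (s : Store) (b : Tst) : Prop := b.lhs.Ok W s ∧ b.rhs.Ok W s

@[simp] theorem fits_lt (a b : Ex) : (lt a b).Fits ↔ a.Fits ∧ b.Fits := Iff.rfl
@[simp] theorem fits_eq (a b : Ex) : (eq a b).Fits ↔ a.Fits ∧ b.Fits := Iff.rfl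
@[simp] theorem ok_lt (W : ℕ) (s : Store) (a b : Ex) :
    (lt a b).Ok W s ↔ a.Ok W s ∧ b.Ok W s := Iff.rfl
@[simp] theorem ok_eq (W : ℕ) (s : Store) (a b : Ex) :
    (eq a b).Ok W s ↔ a.Ok W s ∧ b.Ok W s := Iff.rfl
@[simp] theorem cost_lt (a b : Ex) :
    (lt a b).cost = a.cost + b.cost + max a.depth (b.depth + 1) + 2 := rfl
@[simp] theorem cost_eq (a b : Ex) :
    (eq a b).cost = a.cost + b.cost + max a.depth (b.depth + 1) + 2 := rfl

theorem exec_pre {W : ℕ} (b : Tst) (hb : b.Fits) (s : Store) (hs : Good W s) (hok : b.Ok W s) :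
    ∃ s', Exec W b.pre s (b.lhs.cost + b.rhs.cost) s' ∧ (b.test.Holds s' ↔ b.Holds s) ∧
      s'.var 1000 = b.lhs.eval s ∧ s'.var 1001 = b.rhs.eval s ∧ Bdd W s' ∧ s'.arr = s.arr ∧
      (∀ x < 1000, s'.var x = s.var x) ∧ (∀ x, 1000 + b.depth < x → s'.var x = 0) ∧
      Exec W (clear b.depth) s' (b.depth + 1) s := by
  obtain ⟨s1, e1, b1, a1, l1, u1, v1⟩ := b.lhs.exec_compile hb.1 1000 le_rfl s hs.1 hok.1
  obtain ⟨s2, e2, b2, a2, l2, u2, v2⟩ := b.rhs.exec_compile hb.2 1001 (by omega) s1 b1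
    (Ex.ok_congr a1 l1 _ hb.2 hok.2)
  have h0 : s2.var 1000 = b.lhs.eval s := by rw [l2 1000 (by omega), v1]
  have h1 : s2.var 1001 = b.rhs.eval s := by rw [v2, Ex.eval_congr a1 l1 _ hb.2]
  have hl : ∀ x < 1000, s2.var x = s.var x := fun x hx => by rw [l2 x (by omega), l1 x hx]
  have hu : ∀ x, 1000 + b.depth < x → s2.var x = 0 := by
    intro x hx
    have h3 : 1000 + b.lhs.depth ≤ x :=
      le_trans (Nat.add_le_add_left (le_max_left _ (b.rhs.depth + 1)) _) hx.le
    have h4 : 1001 + b.rhs.depth ≤ x := by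
      have : b.rhs.depth + 1 ≤ b.depth := le_max_right _ _
      omega
    rw [u2 x h4, u1 x h3, hs.2 x (by omega)]
  refine ⟨s2, Exec.seq _ _ _ _ _ _ _ e1 e2, ?_, h0, h1, b2, a2.trans a1, hl, hu,
    exec_clear _ _ _ b2 hs (a2.trans a1) hl hu⟩
  cases b <;> simp only [test, Test.Holds, Holds, h0, h1] <;> rfl

end Tst

/-- Commands. -/
inductive Cmd where
  | skip
  | asg (x : ℕ) (e : Ex)
  | wr (a : ℕ) (i e : Ex)
  | seq (c c' : Cmd)
  | ite (b : Tst) (c c' : Cmd)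
  | whl (b : Tst) (c : Cmd)

namespace Cmd

def compile : Cmd → Prog
  | skip => .set 1000 (.const 0)
  | asg x e => .seq (e.compile 1000) (.seq (.set x (.copy 1000)) (clear e.depth))
  | wr a i e => .seq (Tst.lt i e).pre (.seq (.put a 1000 1001) (clear (Tst.lt i e).depth))
  | seq c c' => .seq c.compile c'.compile
  | ite b c c' => .seq b.pre (.cond b.test (.seq (clear b.depth) c.compile)
      (.seq (clear b.depth) c'.compile))
  | whl b c => .seq b.pre (.seq (.loop b.test (.seq (clear b.depth) (.seq c.compile b.pre)))
      (clear b.depth))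

/-- `c.wp W Q T s`: started on the store `s` with time `T`, the command halts with time `r` left and
a store `s'` such that `Q r s'`. -/
def wp (W : ℕ) : Cmd → (ℕ → Store → Prop) → ℕ → Store → Prop
  | skip, Q, T, s => 1 ≤ T ∧ Q (T - 1) s
  | asg x e, Q, T, s => x < 1000 ∧ e.Fits ∧ e.Ok W s ∧ e.cost + e.depth + 2 ≤ T ∧
      Q (T - (e.cost + e.depth + 2)) (s.setVar x (e.eval s))
  | wr a i e, Q, T, s => (Tst.lt i e).Fits ∧ (Tst.lt i e).Ok W s ∧ (Tst.lt i e).cost ≤ T ∧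
      Q (T - (Tst.lt i e).cost) (s.setArr a (i.eval s) (e.eval s))
  | seq c c', Q, T, s => c.wp W (c'.wp W Q) T s
  | ite b c c', Q, T, s => b.Fits ∧ b.Ok W s ∧ b.cost ≤ T ∧
      (b.Holds s → c.wp W Q (T - b.cost) s) ∧ (¬ b.Holds s → c'.wp W Q (T - b.cost) s)
  | whl b c, Q, T, s => b.Fits ∧ ∃ I : ℕ → Store → Prop, I T s ∧
      ∀ r s, I r s → b.Ok W s ∧ b.cost ≤ r ∧ (b.Holds s → c.wp W I (r - b.cost) s) ∧
        (¬ b.Holds s → Q (r - b.cost) s)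

variable {W : ℕ}

theorem wp_sound (c : Cmd) {Q : ℕ → Store → Prop} {T : ℕ} {s : Store} (hs : Good W s)
    (h : c.wp W Q T s) : ∃ t r s', t + r = T ∧ Exec W c.compile s t s' ∧ Good W s' ∧ Q r s' := by
  have hW : 0 < W := (Nat.zero_le _).trans_lt (hs.1.1 0)
  induction c generalizing Q T s with
  | skip =>
    obtain ⟨h1, h2⟩ := h
    refine ⟨1, T - 1, s, by omega, ?_, hs, h2⟩
    have := Exec.set (W := W) 1000 (.const 0) s hW
    have he : s.setVar 1000 ((Op.const 0).eval s) = s := by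
      refine Store.ext' (fun x => ?_) rfl
      rw [Store.var_setVar]
      split
      · subst x; exact (hs.2 _ le_rfl).symm
      · rfl
    rwa [he] at this
  | asg x e =>
    obtain ⟨hx, he, hok, hT, hQ⟩ := h
    obtain ⟨s1, e1, b1, a1, l1, u1, v1⟩ := e.exec_compile he 1000 le_rfl s hs.1 hok
    have hlt : (Op.copy 1000).eval s1 < W := b1.1 _
    have hlt' := e.eval_lt hs.1 hok
    have hg : Good W (s.setVar x (e.eval s)) := ⟨hs.1.setVar hlt', fun y hy => by
      rw [Store.var_setVar, if_neg (by omega), hs.2 y hy]⟩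
    refine ⟨e.cost + (1 + (e.depth + 1)), _, _, ?_, Exec.seq _ _ _ _ _ _ _ e1
      (Exec.seq _ _ _ _ _ _ _ (Exec.set _ _ _ hlt) (exec_clear _ _ _ (b1.setVar hlt) hg ?_ ?_ ?_)),
      hg, hQ⟩
    · omega
    · exact a1
    · intro y hy
      rw [Store.var_setVar, Store.var_setVar, l1 y hy]
      simp [Op.eval, v1]
    · intro y hy
      rw [Store.var_setVar, if_neg (by omega), u1 y (by omega), hs.2 y (by omega)]
  | wr a i e =>
    obtain ⟨hf, hok, hT, hQ⟩ := h
    obtain ⟨s1, e1, -, v0, v1, b1, a1, l1, u1, -⟩ := (Tst.lt i e).exec_pre hf s hs hok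
    have hlt' := e.eval_lt hs.1 hok.2
    have hg : Good W (s.setArr a (i.eval s) (e.eval s)) := ⟨hs.1.setArr hlt', hs.2⟩
    refine ⟨_, _, _, ?_, Exec.seq _ _ _ _ _ _ _ e1 (Exec.seq _ _ _ _ _ _ _ (Exec.put _ _ _ _)
      (exec_clear _ _ _ (b1.setArr (b1.1 _)) hg ?_ l1 u1)), hg, hQ⟩
    · have : (Tst.lt i e).cost =
        (Tst.lt i e).lhs.cost + (Tst.lt i e).rhs.cost + (Tst.lt i e).depth + 2 := rfl
      omega
    · simp only [Store.setArr, a1, v0, v1]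
      rfl
  | seq c c' ih ih' =>
    obtain ⟨t, r, s1, h1, e1, g1, q1⟩ := ih hs h
    obtain ⟨t', r', s2, h2, e2, g2, q2⟩ := ih' g1 q1
    exact ⟨t + t', r', s2, by omega, Exec.seq _ _ _ _ _ _ _ e1 e2, g2, q2⟩
  | ite b c c' ih ih' =>
    obtain ⟨hf, hok, hT, h1, h2⟩ := h
    obtain ⟨s1, e1, hb, -, -, b1, a1, l1, -, k1⟩ := b.exec_pre hf s hs hok
    by_cases hh : b.Holds s
    · obtain ⟨t, r, s2, h3, e3, g3, q3⟩ := ih hs (h1 hh)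
      refine ⟨_, r, s2, ?_, Exec.seq _ _ _ _ _ _ _ e1 (Exec.cond_true _ _ _ _ _ _ (hb.2 hh)
        (Exec.seq _ _ _ _ _ _ _ k1 e3)), g3, q3⟩
      simp only [Tst.cost] at *
      omega
    · obtain ⟨t, r, s2, h3, e3, g3, q3⟩ := ih' hs (h2 hh)
      refine ⟨_, r, s2, ?_, Exec.seq _ _ _ _ _ _ _ e1 (Exec.cond_false _ _ _ _ _ _
        (fun h => hh (hb.1 h)) (Exec.seq _ _ _ _ _ _ _ k1 e3)), g3, q3⟩
      simp only [Tst.cost] at *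
      omega
  | whl b c ih =>
    obtain ⟨hf, I, h0, hI⟩ := h
    have key : ∀ T s, Good W s → I T s → ∃ s1 t s2 s3 r,
        Exec W b.pre s (b.lhs.cost + b.rhs.cost) s1 ∧
        Exec W (.loop b.test (.seq (clear b.depth) (.seq c.compile b.pre))) s1 t s2 ∧
        Exec W (clear b.depth) s2 (b.depth + 1) s3 ∧
        (b.lhs.cost + b.rhs.cost) + (t + (b.depth + 1)) + r = T ∧ Good W s3 ∧ Q r s3 := by
      intro T
      induction T using Nat.strong_induction_on with
      | _ T ihT =>
        intro s hs hT
        obtain ⟨hok, hc, h1, h2⟩ := hI T s hT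
        obtain ⟨s1, e1, hb, -, -, b1, a1, l1, -, k1⟩ := b.exec_pre hf s hs hok
        have hcost : b.cost = b.lhs.cost + b.rhs.cost + b.depth + 2 := rfl
        by_cases hh : b.Holds s
        · obtain ⟨t, r, s2, h3, e3, g3, q3⟩ := ih hs (h1 hh)
          obtain ⟨s4, t', s5, s6, r', e4, e5, e6, h4, g4, q4⟩ := ihT r (by omega) s2 g3 q3
          refine ⟨s1, _, s5, s6, r', e1, Exec.loop_true _ _ _ _ _ _ _ (hb.2 hh)
            (Exec.seq _ _ _ _ _ _ _ k1 (Exec.seq _ _ _ _ _ _ _ e3 e4)) e5, e6, ?_, g4, q4⟩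
          omega
        · exact ⟨s1, _, s1, s, _, e1, Exec.loop_false _ _ _ (fun h => hh (hb.1 h)), k1,
            by omega, hs, h2 hh⟩
    obtain ⟨s1, t, s2, s3, r, e1, e2, e3, h1, g, q⟩ := key T s hs h0
    exact ⟨_, r, s3, h1, Exec.seq _ _ _ _ _ _ _ e1 (Exec.seq _ _ _ _ _ _ _ e2 e3), g, q⟩

theorem wp_mono (c : Cmd) {Q Q' : ℕ → Store → Prop} (hQ : ∀ r s, Q r s → Q' r s) {T : ℕ}
    {s : Store} (h : c.wp W Q T s) : c.wp W Q' T s := by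
  induction c generalizing Q Q' T s with
  | skip => exact ⟨h.1, hQ _ _ h.2⟩
  | asg x e => exact ⟨h.1, h.2.1, h.2.2.1, h.2.2.2.1, hQ _ _ h.2.2.2.2⟩
  | wr a i e => exact ⟨h.1, h.2.1, h.2.2.1, hQ _ _ h.2.2.2⟩
  | seq c c' ih ih' => exact ih (fun r s => ih' hQ) h
  | ite b c c' ih ih' =>
    exact ⟨h.1, h.2.1, h.2.2.1, fun hh => ih hQ (h.2.2.2.1 hh), fun hh => ih' hQ (h.2.2.2.2 hh)⟩
  | whl b c ih =>
    obtain ⟨hf, I, h0, hI⟩ := h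
    refine ⟨hf, I, h0, fun r s hr => ?_⟩
    obtain ⟨hok, hc, h1, h2⟩ := hI r s hr
    exact ⟨hok, hc, h1, fun hh => hQ _ _ (h2 hh)⟩

/-- Additional time is left over. -/
theorem wp_frame (c : Cmd) {Q : ℕ → Store → Prop} (E : ℕ) {T : ℕ} {s : Store}
    (h : c.wp W Q T s) : c.wp W (fun r s' => E ≤ r ∧ Q (r - E) s') (T + E) s := by
  induction c generalizing Q T s with
  | skip =>
    obtain ⟨h1, h2⟩ := h
    refine ⟨by omega, by omega, ?_⟩
    rwa [show T + E - 1 - E = T - 1 by omega]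
  | asg x e =>
    obtain ⟨h1, h2, h3, h4, h5⟩ := h
    refine ⟨h1, h2, h3, by omega, by omega, ?_⟩
    rwa [show T + E - (e.cost + e.depth + 2) - E = T - (e.cost + e.depth + 2) by omega]
  | wr a i e =>
    obtain ⟨h1, h2, h3, h4⟩ := h
    refine ⟨h1, h2, by omega, by omega, ?_⟩
    rwa [show T + E - (Tst.lt i e).cost - E = T - (Tst.lt i e).cost by omega]
  | seq c c' ih ih' =>
    refine wp_mono c (fun r s hr => ?_) (ih h)
    have := ih' hr.2
    rwa [Nat.sub_add_cancel hr.1] at this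
  | ite b c c' ih ih' =>
    obtain ⟨h1, h2, h3, h4, h5⟩ := h
    have : T + E - b.cost = T - b.cost + E := by omega
    refine ⟨h1, h2, by omega, fun hh => ?_, fun hh => ?_⟩
    · rw [this]; exact ih (h4 hh)
    · rw [this]; exact ih' (h5 hh)
  | whl b c ih =>
    obtain ⟨hf, I, h0, hI⟩ := h
    refine ⟨hf, fun r s => E ≤ r ∧ I (r - E) s, ⟨by omega, by simpa using h0⟩, fun r s hr => ?_⟩
    obtain ⟨hok, hc, h1, h2⟩ := hI _ s hr.2
    refine ⟨hok, by omega, fun hh => ?_, fun hh => ⟨by omega, ?_⟩⟩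
    · have := ih (h1 hh)
      rwa [show r - E - b.cost + E = r - b.cost by omega] at this
    · have := h2 hh
      rwa [show r - E - b.cost = r - b.cost - E by omega] at this

/-- Use of a specification with a time bound and a postcondition. -/
theorem wp_call (c : Cmd) {Q Q' : ℕ → Store → Prop} {T T' : ℕ} {s : Store}
    (h : c.wp W Q T s) (hT : T ≤ T') (hQ : ∀ r r' s', T' - T + r = r' → Q r s' → Q' r' s') :
    c.wp W Q' T' s := by
  have := wp_frame c (T' - T) h
  rw [Nat.add_sub_cancel' hT] at this
  exact wp_mono c (fun r s' hr => hQ _ _ _ (by omega) hr.2) this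

end Cmd
end RAM

namespace RAM
namespace Cmd
variable {W : ℕ}

/-- `for i = 0, …, e - 1 do c` -/
def for' (i : ℕ) (e : Ex) (c : Cmd) : Cmd :=
  seq (asg i (.lit 0)) (whl (.lt (.v i) e) (seq c (asg i (.v i + .lit 1))))

/-- The overhead of one iteration of a `for` loop. -/
def forCost (e : Ex) : ℕ := e.cost + e.depth + 15

/-- The rule for `for` loops, with an invariant `I` and a potential `Φ` for amortised costs. -/
theorem wp_for' {i : ℕ} {e : Ex} {c : Cmd} {Q : ℕ → Store → Prop} {T : ℕ} {s : Store} (N B : ℕ)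
    (I : ℕ → Store → Prop) (Φ : ℕ → Store → ℕ) (hi : i < 1000) (he : e.Fits) (hW : N + 1 < W)
    (h0 : I 0 (s.setVar i 0))
    (hN : ∀ j s, I j s → s.var i = j → e.Ok W s ∧ e.eval s = N)
    (hT : N * (B + forCost e) + forCost e + Φ 0 (s.setVar i 0) ≤ T)
    (hstep : ∀ j s, j < N → I j s → s.var i = j → c.wp W (fun r s' => s'.var i = j ∧
      Φ (j + 1) (s'.setVar i (j + 1)) ≤ r ∧ I (j + 1) (s'.setVar i (j + 1))) (B + Φ j s) s)
    (hQ : ∀ r s', I N s' → s'.var i = N →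
      T - (N * (B + forCost e) + forCost e + Φ 0 (s.setVar i 0)) + Φ N s' ≤ r → Q r s') :
    (for' i e c).wp W Q T s := by
  have hcost : (Tst.lt (.v i) e).cost ≤ e.cost + e.depth + 4 := by
    simp only [Tst.cost_lt, Ex.cost_v, Ex.depth_v]
    omega
  have hk : e.cost + e.depth + 15 = forCost e := rfl
  set E := T - (N * (B + forCost e) + forCost e + Φ 0 (s.setVar i 0)) with hE
  refine ⟨hi, trivial, show 0 < W by omega, show 1 + 1 + 2 ≤ T by omega, ⟨hi, he⟩,
    fun r s => ∃ j ≤ N, I j s ∧ s.var i = j ∧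
      (N - j) * (B + forCost e) + (e.cost + e.depth + 4) + Φ j s + E ≤ r,
    ⟨0, Nat.zero_le _, h0, by simp, ?_⟩, ?_⟩
  · simp only [Ex.eval_lit, Nat.sub_zero, Ex.cost_lit, Ex.depth_lit]
    omega
  · rintro r s' ⟨j, hj, hI, hs, hr⟩
    obtain ⟨ho, hv⟩ := hN j s' hI hs
    refine ⟨⟨trivial, ho⟩, by omega, fun hh => ?_, fun hh => hQ _ _ ?_ ?_ ?_⟩
    · have hjN : j < N := by
        have : s'.var i < e.eval s' := hh
        omega
      have hsub : (N - j) * (B + forCost e) = (N - (j + 1)) * (B + forCost e) + (B + forCost e) := by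
        rw [← Nat.succ_mul]
        congr 1
        omega
      refine wp_call c (hstep j s' hjN hI hs) (by omega) fun r1 r2 s2 hr2 hq => ?_
      obtain ⟨hq1, hq2, hq3⟩ := hq
      refine ⟨hi, ⟨hi, trivial⟩, ⟨trivial, show 1 < W by omega, fun _ => ?_⟩, ?_, j + 1, hjN, ?_, ?_, ?_⟩
      · change s2.var i + 1 < W
        omega
      · change 1 + (1 + 1) + 2 + 2 ≤ r2
        omega
      · change I (j + 1) (s2.setVar i (s2.var i + 1))
        rw [hq1]; exact hq3
      · change (s2.setVar i (s2.var i + 1)).var i = j + 1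
        simp [hq1]
      · change _ + _ + Φ (j + 1) (s2.setVar i (s2.var i + 1)) + E ≤ r2 - (1 + (1 + 1) + 2 + 2)
        rw [hq1]
        omega
    · have : j = N := by
        have : ¬ s'.var i < e.eval s' := hh
        omega
      subst this; exact hI
    · have : ¬ s'.var i < e.eval s' := hh
      omega
    · have : j = N := by
        have : ¬ s'.var i < e.eval s' := hh
        omega
      subst this
      omega

/-- The rule for `for` loops with a uniform bound `B` on the costs of the iterations. -/
theorem wp_for {i : ℕ} {e : Ex} {c : Cmd} {Q : ℕ → Store → Prop} {T : ℕ} {s : Store} (N B : ℕ)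
    (I : ℕ → Store → Prop) (hi : i < 1000) (he : e.Fits) (hW : N + 1 < W)
    (h0 : I 0 (s.setVar i 0))
    (hN : ∀ j s, I j s → s.var i = j → e.Ok W s ∧ e.eval s = N)
    (hT : N * (B + forCost e) + forCost e ≤ T)
    (hstep : ∀ j s, j < N → I j s → s.var i = j → c.wp W (fun _ s' => s'.var i = j ∧
      I (j + 1) (s'.setVar i (j + 1))) B s)
    (hQ : ∀ r s', I N s' → s'.var i = N → T - (N * (B + forCost e) + forCost e) ≤ r → Q r s') :
    (for' i e c).wp W Q T s :=
  wp_for' N B I (fun _ _ => 0) hi he hW h0 hN hT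
    (fun j s hj hI hs => wp_mono c (fun _ _ h => ⟨h.1, Nat.zero_le _, h.2⟩) (hstep j s hj hI hs))
    fun r s' hI hs hr => hQ r s' hI hs hr

section
variable {Q : ℕ → Store → Prop} {T : ℕ} {s : Store}
@[simp] theorem wp_skip : skip.wp W Q T s ↔ 1 ≤ T ∧ Q (T - 1) s := Iff.rfl
@[simp] theorem wp_asg (x : ℕ) (e : Ex) : (asg x e).wp W Q T s ↔ x < 1000 ∧ e.Fits ∧ e.Ok W s ∧
    e.cost + e.depth + 2 ≤ T ∧ Q (T - (e.cost + e.depth + 2)) (s.setVar x (e.eval s)) := Iff.rfl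
@[simp] theorem wp_wr (a : ℕ) (i e : Ex) : (wr a i e).wp W Q T s ↔ (Tst.lt i e).Fits ∧
    (Tst.lt i e).Ok W s ∧ (Tst.lt i e).cost ≤ T ∧
      Q (T - (Tst.lt i e).cost) (s.setArr a (i.eval s) (e.eval s)) := Iff.rfl
@[simp] theorem wp_seq (c c' : Cmd) : (seq c c').wp W Q T s ↔ c.wp W (c'.wp W Q) T s := Iff.rfl
@[simp] theorem wp_ite (b : Tst) (c c' : Cmd) : (ite b c c').wp W Q T s ↔
    b.Fits ∧ b.Ok W s ∧ b.cost ≤ T ∧ (b.Holds s → c.wp W Q (T - b.cost) s) ∧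
      (¬ b.Holds s → c'.wp W Q (T - b.cost) s) := Iff.rfl
end

end Cmd

/-- The stores `s` and `s'` agree on the variables below `X` and on the arrays not in `L`. -/
def Frame (X : ℕ) (L : List ℕ) (s s' : Store) : Prop :=
  (∀ x < X, s'.var x = s.var x) ∧ ∀ a ∉ L, s'.arr a = s.arr a

namespace Frame
variable {X : ℕ} {L : List ℕ} {s s' s'' : Store}

theorem refl : Frame X L s s := ⟨fun _ _ => rfl, fun _ _ => rfl⟩

theorem trans (h : Frame X L s s') (h' : Frame X L s' s'') : Frame X L s s'' :=
  ⟨fun x hx => (h'.1 x hx).trans (h.1 x hx), fun a ha => (h'.2 a ha).trans (h.2 a ha)⟩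

theorem mono {Y : ℕ} {L' : List ℕ} (h : Frame X L s s') (hY : Y ≤ X) (hL : L ⊆ L') :
    Frame Y L' s s' :=
  ⟨fun x hx => h.1 x (hx.trans_le hY), fun a ha => h.2 a fun h' => ha (hL h')⟩

theorem setVar (h : Frame X L s s') {x : ℕ} (m : ℕ) (hx : X ≤ x) : Frame X L s (s'.setVar x m) :=
  ⟨fun y hy => by rw [Store.var_setVar, if_neg (by omega), h.1 y hy], h.2⟩

theorem setArr (h : Frame X L s s') {a : ℕ} (j m : ℕ) (ha : a ∈ L) : Frame X L s (s'.setArr a j m) :=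
  ⟨h.1, fun b hb => by
    rw [Store.arr_setArr_of_ne _ _ _ (by rintro rfl; exact hb ha), h.2 b hb]⟩

end Frame
end RAM

/-! ### Partition refinement -/

namespace Refinement

open Finset Classical

/-- An ordered partition of `T`: a class is named by the number of elements in smaller classes. Some
of the classes are pending. -/
@[ext] structure St (T : Type*) where
  c : T → ℕ
  p : T → Prop

section
variable {T : Type*} [Fintype T]

noncomputable def size (c : T → ℕ) (x : ℕ) : ℕ := #{u | c u = x}
noncomputable def hit (c : T → ℕ) (A : Set T) (x : ℕ) : ℕ := #{u | c u = x ∧ u ∈ A}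
noncomputable def rest (c : T → ℕ) (A : Set T) (x : ℕ) : ℕ := #{u | c u = x ∧ u ∉ A}

def Ranked (c : T → ℕ) : Prop := ∀ u, c u = #{w | c w < c u}

theorem hit_add_rest (c : T → ℕ) (A : Set T) (x : ℕ) : hit c A x + rest c A x = size c x := by
  rw [hit, rest, size, ← card_filter_add_card_filter_not (s := {u | c u = x}) (· ∈ A),
    filter_filter, filter_filter]

theorem size_pos (c : T → ℕ) (u : T) : 0 < size c (c u) :=
  card_pos.2 ⟨u, by simp⟩

theorem hit_pos {c : T → ℕ} {A : Set T} {u : T} (h : u ∈ A) : 0 < hit c A (c u) :=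
  card_pos.2 ⟨u, by simp [h]⟩

theorem rest_pos {c : T → ℕ} {A : Set T} {u : T} (h : u ∉ A) : 0 < rest c A (c u) :=
  card_pos.2 ⟨u, by simp [h]⟩

theorem exists_of_hit_pos {c : T → ℕ} {A : Set T} {x : ℕ} (h : 0 < hit c A x) :
    ∃ u, c u = x ∧ u ∈ A := by
  obtain ⟨u, hu⟩ := card_pos.1 h
  exact ⟨u, by simpa using hu⟩

theorem exists_of_rest_pos {c : T → ℕ} {A : Set T} {x : ℕ} (h : 0 < rest c A x) :
    ∃ u, c u = x ∧ u ∉ A := by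
  obtain ⟨u, hu⟩ := card_pos.1 h
  exact ⟨u, by simpa using hu⟩

namespace Ranked
variable {c : T → ℕ}

theorem add_size_le (h : Ranked c) {u w : T} (huw : c u < c w) : c u + size c (c u) ≤ c w := by
  have key : #{x | c x < c u} + size c (c u) ≤ #{x | c x < c w} := by
    rw [size, ← card_union_of_disjoint]
    · refine card_le_card fun x hx => ?_
      simp only [mem_union, mem_filter, mem_univ, true_and] at hx ⊢
      omega
    · rw [disjoint_filter]
      intro x _ h1 h2
      omega
  rwa [← h u, ← h w] at key

theorem add_size_le_card (h : Ranked c) (u : T) : c u + size c (c u) ≤ Fintype.card T := by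
  have key : #{x | c x < c u} + size c (c u) ≤ Fintype.card T := by
    rw [size, ← card_union_of_disjoint, ← Finset.card_univ]
    · exact card_le_card (subset_univ _)
    · rw [disjoint_filter]
      intro x _ h1 h2
      omega
  rwa [← h u] at key

/-- The intervals occupied by different classes are disjoint. -/
theorem eq_of_mem (h : Ranked c) {u w : T} {q : ℕ} (h1 : c u ≤ q) (h2 : q < c u + size c (c u))
    (h3 : c w ≤ q) (h4 : q < c w + size c (c w)) : c u = c w := by
  rcases lt_trichotomy (c u) (c w) with hl | he | hl
  · have := h.add_size_le hl
    omega
  · exact he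
  · have := h.add_size_le hl
    omega

theorem lt_card (h : Ranked c) (u : T) : c u < Fintype.card T := by
  have := h.add_size_le_card u
  have := size_pos c u
  omega

end Ranked

/-- Split all classes by the set `A`. The larger half of a class that is not pending does not become
pending. -/
noncomputable def split (A : Set T) (σ : St T) : St T where
  c u := if u ∈ A ∧ 0 < rest σ.c A (σ.c u) then σ.c u + rest σ.c A (σ.c u) else σ.c u
  p u := σ.p u ∨ 0 < hit σ.c A (σ.c u) ∧ 0 < rest σ.c A (σ.c u) ∧
    (hit σ.c A (σ.c u) ≤ rest σ.c A (σ.c u) ↔ u ∈ A)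

structure Inv (σ : St T) : Prop where
  ranked : Ranked σ.c
  pend : ∀ u w, σ.c u = σ.c w → σ.p u → σ.p w

section
variable {σ : St T} {A : Set T}

theorem le_split_c (u : T) : σ.c u ≤ (split A σ).c u := by
  simp only [split]
  split_ifs <;> omega

theorem split_c_lt (u : T) : (split A σ).c u < σ.c u + size σ.c (σ.c u) := by
  have h1 := hit_add_rest σ.c A (σ.c u)
  simp only [split]
  split_ifs with h
  · have := hit_pos (c := σ.c) h.1
    omega
  · have := size_pos σ.c u
    omega

theorem split_c_of_mem {u : T} (h : u ∈ A) :
    (split A σ).c u = σ.c u + rest σ.c A (σ.c u) := by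
  simp only [split, h, true_and]
  split_ifs <;> omega

theorem split_c_of_notMem {u : T} (h : u ∉ A) : (split A σ).c u = σ.c u := by
  simp [split, h]

theorem Inv.split_c_eq_iff (hσ : Inv σ) (u w : T) :
    (split A σ).c u = (split A σ).c w ↔ σ.c u = σ.c w ∧ (u ∈ A ↔ w ∈ A) := by
  constructor
  · intro h
    have hc : σ.c u = σ.c w := hσ.ranked.eq_of_mem (q := (split A σ).c u) (le_split_c u)
      (split_c_lt u) (h ▸ le_split_c w) (h ▸ split_c_lt w)
    refine ⟨hc, ?_⟩
    by_cases hu : u ∈ A <;> by_cases hw : w ∈ A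
    · simp [hu, hw]
    · rw [split_c_of_mem hu, split_c_of_notMem hw] at h
      have := rest_pos (c := σ.c) hw
      rw [hc] at h
      omega
    · rw [split_c_of_mem hw, split_c_of_notMem hu] at h
      have := rest_pos (c := σ.c) hu
      rw [hc] at h this
      omega
    · simp [hu, hw]
  · rintro ⟨h1, h2⟩
    simp only [split, h1, h2]

theorem Inv.split_c_lt_iff (hσ : Inv σ) (u w : T) :
    (split A σ).c u < (split A σ).c w ↔ σ.c u < σ.c w ∨ σ.c u = σ.c w ∧ u ∉ A ∧ w ∈ A := by
  rcases lt_trichotomy (σ.c u) (σ.c w) with hl | he | hl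
  · have h1 := hσ.ranked.add_size_le hl
    have h2 := split_c_lt (σ := σ) (A := A) u
    have h3 := le_split_c (σ := σ) (A := A) w
    exact ⟨fun _ => Or.inl hl, fun _ => by omega⟩
  · simp only [he, lt_irrefl, true_and, false_or]
    by_cases hu : u ∈ A <;> by_cases hw : w ∈ A
    · simp [split_c_of_mem hu, split_c_of_mem hw, hu, he]
    · rw [split_c_of_mem hu, split_c_of_notMem hw]
      simp [hu, hw, he]
    · rw [split_c_of_notMem hu, split_c_of_mem hw]
      have := rest_pos (c := σ.c) hu
      rw [he] at this ⊢
      simp only [hu, hw]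
      simpa using this
    · simp [split_c_of_notMem hu, split_c_of_notMem hw, he, hu, hw]
  · have h1 := hσ.ranked.add_size_le hl
    have h2 := split_c_lt (σ := σ) (A := A) w
    have h3 := le_split_c (σ := σ) (A := A) u
    exact ⟨fun _ => by omega, fun h => by omega⟩

theorem Inv.size_split_of_mem (hσ : Inv σ) {u : T} (hu : u ∈ A) :
    size (split A σ).c ((split A σ).c u) = hit σ.c A (σ.c u) := by
  simp only [size, hit, hσ.split_c_eq_iff, hu, iff_true]

theorem Inv.size_split_of_notMem (hσ : Inv σ) {u : T} (hu : u ∉ A) :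
    size (split A σ).c ((split A σ).c u) = rest σ.c A (σ.c u) := by
  simp only [size, rest, hσ.split_c_eq_iff, hu, iff_false]

theorem Inv.split (hσ : Inv σ) (A : Set T) : Inv (split A σ) where
  ranked u := by
    simp only [hσ.split_c_lt_iff]
    by_cases hu : u ∈ A
    · rw [split_c_of_mem hu]
      conv_lhs => lhs; rw [hσ.ranked u]
      rw [rest, ← card_union_of_disjoint]
      · congr 1
        ext w
        simp [hu]
      · rw [disjoint_filter]
        intro x _ h1 h2
        omega
    · rw [split_c_of_notMem hu, hσ.ranked u]
      simp [hu, ← hσ.ranked u]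
  pend u w h hp := by
    obtain ⟨h1, h2⟩ := (hσ.split_c_eq_iff u w).1 h
    rcases hp with hp | hp
    · exact Or.inl (hσ.pend u w h1 hp)
    · right
      rwa [h1, h2] at hp

/-- The number of times that `u` can still be in a class that is processed. -/
noncomputable def phi (σ : St T) (u : T) : ℕ :=
  Nat.log 2 (size σ.c (σ.c u)) + if σ.p u then 1 else 0

noncomputable def pot (σ : St T) : ℕ := ∑ u, phi σ u

theorem Inv.phi_split_le (hσ : Inv σ) (A : Set T) (u : T) :
    phi (Refinement.split A σ) u ≤ phi σ u := by
  have hsz : size (Refinement.split A σ).c ((Refinement.split A σ).c u) ≤ size σ.c (σ.c u) := by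
    have := hit_add_rest σ.c A (σ.c u)
    by_cases hu : u ∈ A
    · rw [hσ.size_split_of_mem hu]; omega
    · rw [hσ.size_split_of_notMem hu]; omega
  by_cases hp : σ.p u
  · have : (Refinement.split A σ).p u := Or.inl hp
    simp only [phi, hp, this, if_true]
    exact Nat.add_le_add_right (Nat.log_mono_right hsz) 1
  by_cases hp' : (Refinement.split A σ).p u
  · simp only [phi, hp, hp', if_true, if_false, add_zero]
    rcases hp' with hp' | ⟨h1, h2, h3⟩
    · exact absurd hp' hp
    · have h4 := hit_add_rest σ.c A (σ.c u)
      have h5 : 2 * size (Refinement.split A σ).c ((Refinement.split A σ).c u) ≤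
          size σ.c (σ.c u) := by
        by_cases hu : u ∈ A
        · rw [hσ.size_split_of_mem hu]
          have := h3.2 hu
          omega
        · rw [hσ.size_split_of_notMem hu]
          have : ¬ (_ ≤ _) := fun h => hu (h3.1 h)
          omega
      rw [← Nat.log_mul_base one_lt_two (size_pos _ _).ne', mul_comm]
      exact Nat.log_mono_right h5
  · simp only [phi, hp, hp', if_false, add_zero]
    exact Nat.log_mono_right hsz

end

noncomputable def splits (l : List (Set T)) (σ : St T) : St T := l.foldl (fun σ A => split A σ) σ

theorem splits_append (l l' : List (Set T)) (σ : St T) :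
    splits (l ++ l') σ = splits l' (splits l σ) := List.foldl_append ..

theorem Inv.splits {σ : St T} (hσ : Inv σ) (l : List (Set T)) : Inv (splits l σ) := by
  induction l generalizing σ with
  | nil => exact hσ
  | cons A l ih => exact ih (hσ.split A)

theorem Inv.splits_c_eq {σ : St T} (hσ : Inv σ) (l : List (Set T)) {u w : T}
    (h : (Refinement.splits l σ).c u = (Refinement.splits l σ).c w) :
    σ.c u = σ.c w ∧ ∀ A ∈ l, (u ∈ A ↔ w ∈ A) := by
  induction l generalizing σ with
  | nil => exact ⟨h, by simp⟩
  | cons A l ih =>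
    obtain ⟨h1, h2⟩ := ih (hσ.split A) h
    obtain ⟨h3, h4⟩ := (hσ.split_c_eq_iff u w).1 h1
    exact ⟨h3, by simpa [h4] using h2⟩

theorem Inv.phi_splits_le {σ : St T} (hσ : Inv σ) (l : List (Set T)) (u : T) :
    phi (Refinement.splits l σ) u ≤ phi σ u := by
  induction l generalizing σ with
  | nil => exact le_rfl
  | cons A l ih => exact (ih (hσ.split A)).trans (hσ.phi_split_le A u)

/-- Mark the class `s` as not pending. -/
def unflag (s : ℕ) (σ : St T) : St T := ⟨σ.c, fun u => σ.p u ∧ σ.c u ≠ s⟩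

theorem Inv.unflag {σ : St T} (hσ : Inv σ) (s : ℕ) : Inv (unflag s σ) :=
  ⟨hσ.ranked, fun u w h hp => ⟨hσ.pend u w h hp.1, fun h' => hp.2 (h.trans h')⟩⟩

theorem phi_unflag_le (σ : St T) (s : ℕ) (u : T) :
    phi (unflag s σ) u + (if σ.p u ∧ σ.c u = s then 1 else 0) ≤ phi σ u := by
  simp only [phi, unflag]
  by_cases h1 : σ.p u <;> by_cases h2 : σ.c u = s <;> simp [h1, h2]

/-! #### Lines and stability -/

variable {J X : Type*} [Fintype X]

/-- The functions whose sums along lines are constant on classes. -/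
def Equit (sub : J → T → X → T) (c : T → ℕ) (f : T → ℤ) : Prop :=
  ∀ j u u', c u = c u' → ∑ x, f (sub j u x) = ∑ x, f (sub j u' x)

noncomputable def ind (c : T → ℕ) (u : T) : T → ℤ := fun w => if c w = c u then 1 else 0

/-- The functions obtained from equitable ones, pending classes and `F`. -/
def span (sub : J → T → X → T) (σ : St T) (F : T → ℤ) : AddSubgroup (T → ℤ) :=
  AddSubgroup.closure ({f | Equit sub σ.c f} ∪ {f | ∃ u, σ.p u ∧ f = ind σ.c u} ∪ {F})

def Spans (sub : J → T → X → T) (σ : St T) (F : T → ℤ) : Prop :=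
  ∀ u, ind σ.c u ∈ span sub σ F

variable {sub : J → T → X → T} {σ : St T} {F : T → ℤ}

theorem Inv.ind_split (hσ : Inv σ) (A : Set T) {u w : T} (h : σ.c w = σ.c u)
    (hA : w ∈ A ↔ u ∉ A) :
    ind σ.c u = ind (Refinement.split A σ).c u + ind (Refinement.split A σ).c w := by
  funext v
  simp only [ind, Pi.add_apply, hσ.split_c_eq_iff, h, hA]
  by_cases h1 : σ.c v = σ.c u <;> by_cases h2 : v ∈ A <;> by_cases h3 : u ∈ A <;>
    simp [h1, h2, h3]

theorem Inv.ind_split' (hσ : Inv σ) (A : Set T) {u : T}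
    (h : ¬ ∃ w, σ.c w = σ.c u ∧ (w ∈ A ↔ u ∉ A)) :
    ind σ.c u = ind (Refinement.split A σ).c u := by
  funext v
  simp only [ind, hσ.split_c_eq_iff]
  congr 1
  simp only [eq_iff_iff, iff_self_and]
  intro hv
  by_contra hA
  exact h ⟨v, hv, by tauto⟩

theorem Inv.span_le_split (hσ : Inv σ) (A : Set T) :
    span sub σ F ≤ span sub (Refinement.split A σ) F := by
  refine (AddSubgroup.closure_le _).2 ?_
  rintro f ((hf | ⟨u, hu, rfl⟩) | hf)
  · exact AddSubgroup.subset_closure (Or.inl (Or.inl fun j u u' h =>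
      hf j u u' ((hσ.split_c_eq_iff u u').1 h).1))
  · have hmem : ∀ w, σ.p w → ind (Refinement.split A σ).c w ∈
        span sub (Refinement.split A σ) F := fun w hw =>
      AddSubgroup.subset_closure (Or.inl (Or.inr ⟨w, Or.inl hw, rfl⟩))
    by_cases h : ∃ w, σ.c w = σ.c u ∧ (w ∈ A ↔ u ∉ A)
    · obtain ⟨w, hw, hA⟩ := h
      rw [hσ.ind_split A hw hA]
      exact add_mem (hmem u hu) (hmem w (hσ.pend u w hw.symm hu))
    · rw [hσ.ind_split' A h]
      exact hmem u hu
  · exact AddSubgroup.subset_closure (Or.inr hf)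

theorem Spans.split (hσ : Inv σ) (h : Spans sub σ F) (A : Set T) :
    Spans sub (split A σ) F := by
  intro u
  have hle := hσ.span_le_split (sub := sub) (F := F) A
  by_cases hw : ∃ w, σ.c w = σ.c u ∧ (w ∈ A ↔ u ∉ A)
  · obtain ⟨w, hw, hA⟩ := hw
    have hu := hle (h u)
    rw [hσ.ind_split A hw hA] at hu
    have hpos : 0 < hit σ.c A (σ.c u) ∧ 0 < rest σ.c A (σ.c u) := by
      by_cases hA' : u ∈ A
      · exact ⟨hit_pos hA', hw ▸ rest_pos (by tauto)⟩
      · exact ⟨hw ▸ hit_pos (by tauto), rest_pos hA'⟩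
    by_cases hp : (Refinement.split A σ).p u
    · exact AddSubgroup.subset_closure (Or.inl (Or.inr ⟨u, hp, rfl⟩))
    · have hp' : (Refinement.split A σ).p w := by
        simp only [Refinement.split, hw] at hp ⊢
        tauto
      have h2 : ind (Refinement.split A σ).c w ∈ span sub (Refinement.split A σ) F :=
        AddSubgroup.subset_closure (Or.inl (Or.inr ⟨w, hp', rfl⟩))
      simpa using sub_mem hu h2
  · rw [← hσ.ind_split' A hw]
    exact hle (h u)

theorem Spans.splits (hσ : Inv σ) (h : Spans sub σ F) (l : List (Set T)) :
    Spans sub (splits l σ) F := by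
  induction l generalizing σ with
  | nil => exact h
  | cons A l ih => exact ih (hσ.split A) (h.split hσ A)

/-- The set of the `u` such that exactly `t` elements of the line through `u` in direction `j` are in
`S`. -/
def lineSet (sub : J → T → X → T) (S : Set T) (j : J) (t : ℕ) : Set T :=
  {u | #{x | sub j u x ∈ S} = t}

noncomputable def lineSets (sub : J → T → X → T) (S : Set T) (j : J) : List (Set T) :=
  (List.range (Fintype.card X)).map fun t => lineSet sub S j (t + 1)

/-- Remove `s` from the pending classes and refine the partition by it. -/
noncomputable def process (sub : J → T → X → T) (js : List J) (s : ℕ) (σ : St T) : St T :=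
  splits (js.flatMap (lineSets sub {u | σ.c u = s})) (unflag s σ)

theorem Inv.process (hσ : Inv σ) (js : List J) (s : ℕ) : Inv (process sub js s σ) :=
  (hσ.unflag s).splits _

omit [Fintype T] in
theorem equit_of_lineSets {c : T → ℕ} {S : Set T} {js : List J} (hjs : ∀ j, j ∈ js)
    (h : ∀ u w, c u = c w → ∀ A ∈ js.flatMap (lineSets sub S), (u ∈ A ↔ w ∈ A)) :
    Equit sub c (S.indicator 1) := by
  have key : ∀ j u w, c u = c w → #{x | sub j u x ∈ S} ≤ #{x | sub j w x ∈ S} := by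
    intro j u w huw
    rcases Nat.eq_zero_or_pos #{x | sub j u x ∈ S} with h0 | h0
    · omega
    · have hA : lineSet sub S j #{x | sub j u x ∈ S} ∈ js.flatMap (lineSets sub S) := by
        refine List.mem_flatMap.2 ⟨j, hjs j, List.mem_map.2 ⟨#{x | sub j u x ∈ S} - 1, ?_, ?_⟩⟩
        · rw [List.mem_range]
          have : #{x | sub j u x ∈ S} ≤ Fintype.card X := card_le_univ _
          omega
        · congr 1
          omega
      have : w ∈ lineSet sub S j #{x | sub j u x ∈ S} := (h u w huw _ hA).1 rfl
      exact this.ge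
  intro j u w huw
  have e : ∀ u, ∑ x, S.indicator (1 : T → ℤ) (sub j u x) = #{x | sub j u x ∈ S} := by
    intro u
    simp only [Set.indicator_apply, Pi.one_apply, card_filter, Nat.cast_sum, Nat.cast_ite,
      Nat.cast_one, Nat.cast_zero]
  rw [e, e, le_antisymm (key j u w huw) (key j w u huw.symm)]

theorem Spans.process (hσ : Inv σ) (h : Spans sub σ 0) {js : List J} (hjs : ∀ j, j ∈ js) (s : ℕ) :
    Spans sub (process sub js s σ) 0 := by
  set F : T → ℤ := Set.indicator {u | σ.c u = s} 1 with hF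
  have h1 : Spans sub (unflag s σ) F := by
    intro u
    have hle : span sub σ 0 ≤ span sub (unflag s σ) F := by
      refine (AddSubgroup.closure_le _).2 ?_
      rintro f ((hf | ⟨w, hw, rfl⟩) | hf)
      · exact AddSubgroup.subset_closure (Or.inl (Or.inl hf))
      · by_cases hs : σ.c w = s
        · refine AddSubgroup.subset_closure (Or.inr ?_)
          funext v
          simp [ind, hF, Set.indicator_apply, hs]
        · exact AddSubgroup.subset_closure (Or.inl (Or.inr ⟨w, ⟨hw, hs⟩, rfl⟩))
      · rw [Set.mem_singleton_iff.1 hf]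
        exact zero_mem _
    exact hle (h u)
  have h2 : Spans sub (Refinement.process sub js s σ) F := h1.splits (hσ.unflag s) _
  have h3 : Equit sub (Refinement.process sub js s σ).c F :=
    equit_of_lineSets hjs fun u w huw => ((hσ.unflag s).splits_c_eq _ huw).2
  intro u
  refine (AddSubgroup.closure_le _).2 ?_ (h2 u)
  rintro f (hf | hf)
  · exact AddSubgroup.subset_closure (Or.inl hf)
  · rw [Set.mem_singleton_iff.1 hf]
    exact AddSubgroup.subset_closure (Or.inl (Or.inl h3))

omit [Fintype T] in
theorem Spans.equit (h : Spans sub σ 0) (hp : ¬ ∃ u, σ.p u) (u : T) : Equit sub σ.c (ind σ.c u) := by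
  have := h u
  refine AddSubgroup.closure_induction (p := fun f _ => Equit sub σ.c f) ?_ ?_ ?_ ?_ this
  · rintro f ((hf | ⟨w, hw, rfl⟩) | hf)
    · exact hf
    · exact absurd ⟨w, hw⟩ hp
    · rw [Set.mem_singleton_iff.1 hf]
      intro j u u' _
      simp
  · intro j u u' _
    simp
  · intro f g _ _ hf hg j u u' huu
    simp only [Pi.add_apply, sum_add_distrib, hf j u u' huu, hg j u u' huu]
  · intro f _ hf j u u' huu
    simp only [Pi.neg_apply, sum_neg_distrib, hf j u u' huu]

def Stable (sub : J → T → X → T) (c : T → ℕ) : Prop :=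
  ∀ j u u' s, c u = c u' → #{x | c (sub j u x) = s} = #{x | c (sub j u' x) = s}

theorem Spans.stable (h : Spans sub σ 0) (hp : ¬ ∃ u, σ.p u) : Stable sub σ.c := by
  intro j u u' s huu
  by_cases hs : ∃ w, σ.c w = s
  · obtain ⟨w, rfl⟩ := hs
    have := h.equit hp w j u u' huu
    simp only [ind] at this
    simpa only [card_filter, ← Nat.cast_inj (R := ℤ), Nat.cast_sum, Nat.cast_ite, Nat.cast_one,
      Nat.cast_zero] using this
  · rw [filter_false_of_mem fun x _ hx => hs ⟨_, hx⟩,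
      filter_false_of_mem fun x _ hx => hs ⟨_, hx⟩]

/-! #### Refinement until no class is pending -/

/-- The least pending class. -/
noncomputable def minId (σ : St T) : ℕ := sInf {x | ∃ u, σ.p u ∧ σ.c u = x}

omit [Fintype T] in
theorem exists_minId (hp : ∃ u, σ.p u) : ∃ u, σ.p u ∧ σ.c u = minId σ := by
  obtain ⟨u, hu⟩ := hp
  exact Nat.sInf_mem (s := {x | ∃ u, σ.p u ∧ σ.c u = x}) ⟨σ.c u, u, hu, rfl⟩

noncomputable def step (sub : J → T → X → T) (js : List J) (σ : St T) : St T :=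
  if ∃ u, σ.p u then process sub js (minId σ) σ else σ

theorem Inv.step (hσ : Inv σ) (js : List J) : Inv (step sub js σ) := by
  unfold Refinement.step
  split_ifs
  · exact hσ.process js _
  · exact hσ

theorem Inv.pot_process (hσ : Inv σ) (js : List J) (hp : ∃ u, σ.p u) :
    pot (Refinement.process sub js (minId σ) σ) + size σ.c (minId σ) ≤ pot σ := by
  obtain ⟨w, hw, hw'⟩ := exists_minId hp
  rw [size, card_filter, pot, pot, ← sum_add_distrib]
  refine sum_le_sum fun u _ => ?_
  have h1 := (hσ.unflag (minId σ)).phi_splits_le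
    (js.flatMap (lineSets sub {u | σ.c u = minId σ})) u
  have h2 := phi_unflag_le σ (minId σ) u
  have h3 : σ.c u = minId σ → σ.p u := fun h => hσ.pend w u (hw'.trans h.symm) hw
  have h4 : (σ.p u ∧ σ.c u = minId σ) ↔ σ.c u = minId σ := ⟨And.right, fun h => ⟨h3 h, h⟩⟩
  simp only [h4] at h2
  exact (Nat.add_le_add_right h1 _).trans h2

theorem Inv.pot_process_lt (hσ : Inv σ) (js : List J) (hp : ∃ u, σ.p u) :
    pot (Refinement.process sub js (minId σ) σ) < pot σ := by
  have h1 := hσ.pot_process (sub := sub) js hp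
  obtain ⟨w, hw, hw'⟩ := exists_minId hp
  have := size_pos σ.c w
  rw [hw'] at this
  omega

noncomputable def refine (sub : J → T → X → T) (js : List J) (σ : St T) : St T :=
  (step sub js)^[pot σ] σ

theorem refine_of_not {js : List J} (hp : ¬ ∃ u, σ.p u) : refine sub js σ = σ := by
  have : step sub js σ = σ := if_neg hp
  exact Function.iterate_fixed this _

theorem Inv.iterate_step (hσ : Inv σ) (js : List J) (i : ℕ) (hi : pot σ ≤ i) :
    (Refinement.step sub js)^[i] σ = refine sub js σ ∧ ¬ ∃ u, (refine sub js σ).p u := by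
  induction hk : pot σ using Nat.strong_induction_on generalizing σ i with
  | _ k ih =>
    by_cases hp : ∃ u, σ.p u
    · have hs : Refinement.step sub js σ = Refinement.process sub js (minId σ) σ := if_pos hp
      have hlt := hσ.pot_process_lt (sub := sub) js hp
      rw [← hs] at hlt
      have h1 := ih _ (hk ▸ hlt) (hσ.step (sub := sub) js) (i - 1) (by omega) rfl
      have h2 := ih _ (hk ▸ hlt) (hσ.step (sub := sub) js) (pot σ - 1) (by omega) rfl
      have h3 : ∀ i, 0 < i → (Refinement.step sub js)^[i] σ =
          (Refinement.step sub js)^[i - 1] (Refinement.step sub js σ) := by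
        intro i hi
        rw [← Function.iterate_succ_apply, Nat.succ_eq_add_one, Nat.sub_add_cancel hi]
      have h4 : refine sub js σ = refine sub js (Refinement.step sub js σ) := by
        rw [← h2.1]
        exact h3 _ (by omega)
      rw [h4, h3 i (by omega)]
      exact h1
    · rw [refine_of_not hp]
      exact ⟨Function.iterate_fixed (show Refinement.step sub js σ = σ from if_neg hp) i, hp⟩

theorem Inv.refine_process (hσ : Inv σ) (js : List J) (hp : ∃ u, σ.p u) :
    refine sub js (Refinement.process sub js (minId σ) σ) = refine sub js σ := by
  have hs : Refinement.step sub js σ = Refinement.process sub js (minId σ) σ := if_pos hp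
  have hlt := hσ.pot_process_lt (sub := sub) js hp
  rw [← hs] at hlt ⊢
  rw [← ((hσ.step (sub := sub) js).iterate_step js (pot σ) hlt.le).1,
    ← (hσ.iterate_step js (pot σ + 1) (Nat.le_succ _)).1, Function.iterate_succ_apply]

theorem Spans.refine (hσ : Inv σ) (h : Spans sub σ 0) {js : List J} (hjs : ∀ j, j ∈ js) :
    Spans sub (refine sub js σ) 0 := by
  have : ∀ i, Inv ((Refinement.step sub js)^[i] σ) ∧ Spans sub ((Refinement.step sub js)^[i] σ) 0 := by
    intro i
    induction i with
    | zero => exact ⟨hσ, h⟩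
    | succ i ih =>
      rw [Function.iterate_succ_apply']
      refine ⟨ih.1.step js, ?_⟩
      unfold Refinement.step
      split_ifs
      · exact ih.2.process ih.1 hjs _
      · exact ih.2
  exact (this _).2

theorem Inv.refine (hσ : Inv σ) (js : List J) : Inv (refine sub js σ) := by
  have : ∀ i, Inv ((Refinement.step sub js)^[i] σ) := by
    intro i
    induction i with
    | zero => exact hσ
    | succ i ih =>
      rw [Function.iterate_succ_apply']
      exact ih.step js
  exact this _

theorem Inv.process_c_eq (hσ : Inv σ) (js : List J) (s : ℕ) {u w : T}
    (h : (Refinement.process sub js s σ).c u = (Refinement.process sub js s σ).c w) : σ.c u = σ.c w :=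
  ((hσ.unflag s).splits_c_eq _ h).1

theorem Inv.refine_c_eq (hσ : Inv σ) (js : List J) {u w : T}
    (h : (Refinement.refine sub js σ).c u = (Refinement.refine sub js σ).c w) :
    σ.c u = σ.c w := by
  have : ∀ i, Inv ((Refinement.step sub js)^[i] σ) ∧ (((Refinement.step sub js)^[i] σ).c u =
      ((Refinement.step sub js)^[i] σ).c w → σ.c u = σ.c w) := by
    intro i
    induction i with
    | zero => exact ⟨hσ, id⟩
    | succ i ih =>
      rw [Function.iterate_succ_apply']
      refine ⟨ih.1.step js, fun h => ih.2 ?_⟩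
      unfold Refinement.step at h
      split_ifs at h
      · exact ih.1.process_c_eq js _ h
      · exact h
  exact (this _).2 h

/-- One class, which is pending. -/
def trivialSt (T : Type*) : St T := ⟨fun _ => 0, fun _ => True⟩

theorem inv_trivialSt : Inv (trivialSt T) :=
  ⟨fun u => by simp [trivialSt], fun _ _ _ h => h⟩

omit [Fintype T] in
theorem spans_trivialSt : Spans sub (trivialSt T) F := fun u =>
  AddSubgroup.subset_closure (Or.inl (Or.inr ⟨u, trivial, rfl⟩))

theorem pot_trivialSt_le : pot (trivialSt T) ≤ Fintype.card T * (Nat.log 2 (Fintype.card T) + 1) := by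
  rw [pot, ← smul_eq_mul, ← card_univ]
  refine sum_le_card_nsmul _ _ _ fun u _ => ?_
  simp [phi, trivialSt, size]

theorem Inv.pot_split_le (hσ : Inv σ) (A : Set T) : pot (Refinement.split A σ) ≤ pot σ :=
  sum_le_sum fun u _ => hσ.phi_split_le A u

theorem Inv.pot_splits_le (hσ : Inv σ) (l : List (Set T)) : pot (Refinement.splits l σ) ≤ pot σ :=
  sum_le_sum fun u _ => hσ.phi_splits_le l u

/-! #### Equivariance -/

section
variable {T' X' : Type*} [Fintype T'] [Fintype X'] {sub' : J → T' → X' → T'} {σ' : St T'}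

/-- The bijection `e` maps the state `σ` to the state `σ'`. -/
def Corr (e : T ≃ T') (σ : St T) (σ' : St T') : Prop :=
  ∀ u, σ'.c (e u) = σ.c u ∧ (σ'.p (e u) ↔ σ.p u)

theorem card_filter_equiv {Y Y' : Type*} [Fintype Y] [Fintype Y'] (e : Y ≃ Y') {P : Y → Prop}
    {P' : Y' → Prop} [DecidablePred P] [DecidablePred P'] (h : ∀ u, P' (e u) ↔ P u) : #{u | P' u} = #{u | P u} := by
  refine (card_bij (fun u _ => e u) (fun u hu => ?_) (fun u _ w _ h => e.injective h)
    fun u hu => ⟨e.symm u, ?_, by simp⟩).symm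
  · simpa [h] using hu
  · simp only [mem_filter, mem_univ, true_and] at hu ⊢
    rw [← h]
    simpa using hu

variable {e : T ≃ T'}

theorem Corr.split (h : Corr e σ σ') {A : Set T} {A' : Set T'} (hA : ∀ u, e u ∈ A' ↔ u ∈ A) :
    Corr e (split A σ) (split A' σ') := by
  have h1 : ∀ x, hit σ'.c A' x = hit σ.c A x := by
    intro x
    rw [hit, hit]
    exact card_filter_equiv e fun u => by rw [(h u).1, hA]
  have h2 : ∀ x, rest σ'.c A' x = rest σ.c A x := by
    intro x
    rw [rest, rest]
    exact card_filter_equiv e fun u => by rw [(h u).1, hA]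
  intro u
  simp only [Refinement.split, h1, h2, (h u).1, hA, (h u).2, and_self]

theorem Corr.splits (h : Corr e σ σ') {l : List (Set T)} {l' : List (Set T')}
    (hl : List.Forall₂ (fun A A' => ∀ u, e u ∈ A' ↔ u ∈ A) l l') :
    Corr e (splits l σ) (splits l' σ') := by
  induction hl generalizing σ σ' with
  | nil => exact h
  | cons hA _ ih => exact ih (h.split hA)

theorem Corr.process (h : Corr e σ σ') {f : X ≃ X'}
    (hs : ∀ j u x, sub' j (e u) (f x) = e (sub j u x)) (js : List J) (s : ℕ) :
    Corr e (process sub js s σ) (process sub' js s σ') := by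
  refine Corr.splits (σ := unflag s σ) (σ' := unflag s σ')
    (fun u => ⟨(h u).1, and_congr (h u).2 (by rw [(h u).1])⟩) ?_
  induction js with
  | nil => exact List.Forall₂.nil
  | cons j js ih =>
    rw [List.flatMap_cons, List.flatMap_cons]
    refine List.rel_append ?_ ih
    rw [lineSets, lineSets, Fintype.card_congr f]
    refine List.forall₂_map_left_iff.2 (List.forall₂_map_right_iff.2 (List.forall₂_same.2 ?_))
    intro t _ u
    simp only [lineSet, Set.mem_ofPred_eq]
    rw [card_filter_equiv f (P := fun x => σ.c (sub j u x) = s)]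
    intro x
    rw [hs, (h _).1]

omit [Fintype T] [Fintype T'] in
theorem Corr.minId_eq (h : Corr e σ σ') : minId σ' = minId σ := by
  unfold minId
  congr 1
  ext x
  simp only [Set.mem_ofPred_eq]
  rw [← e.exists_congr_right]
  simp only [(h _).1, (h _).2]

theorem Corr.step (h : Corr e σ σ') {f : X ≃ X'}
    (hs : ∀ j u x, sub' j (e u) (f x) = e (sub j u x)) (js : List J) :
    Corr e (step sub js σ) (step sub' js σ') := by
  have hp : (∃ u, σ'.p u) ↔ ∃ u, σ.p u := by
    rw [← e.exists_congr_right]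
    simp only [(h _).2]
  unfold Refinement.step
  rw [h.minId_eq]
  simp only [hp]
  split_ifs
  · exact h.process hs js _
  · exact h

theorem Corr.pot_eq (h : Corr e σ σ') : pot σ' = pot σ := by
  rw [pot, pot, ← e.sum_comp]
  refine sum_congr rfl fun u _ => ?_
  have : ∀ x, size σ'.c x = size σ.c x := by
    intro x
    rw [size, size]
    exact card_filter_equiv e fun u => by rw [(h u).1]
  simp only [phi, (h u).1, this, (h u).2]

theorem Corr.refine (h : Corr e σ σ') {f : X ≃ X'}
    (hs : ∀ j u x, sub' j (e u) (f x) = e (sub j u x)) (js : List J) :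
    Corr e (refine sub js σ) (refine sub' js σ') := by
  unfold Refinement.refine
  rw [h.pot_eq]
  generalize pot σ = i
  induction i with
  | zero => exact h
  | succ i ih =>
    rw [Function.iterate_succ_apply', Function.iterate_succ_apply']
    exact ih.step hs js

end

end
end Refinement

/-! ### Stable partitions of tuples and the Weisfeiler-Leman algorithm -/

namespace Refinement

open Finset Classical

/-- The tuple `u` with its `j`-th entry replaced by `x`. -/
def subst {d n : ℕ} (j : Fin d) (u : Fin d → Fin n) (x : Fin n) : Fin d → Fin n :=
  Function.update u j x

def diag (d : ℕ) {n : ℕ} (v : Fin n) : Fin d → Fin n := fun _ => v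

/-- The partition `c` refines the partition into atomic types. -/
def Atomic {d : ℕ} (G : ColouredGraph) (c : (Fin d → Fin G.order) → ℕ) : Prop :=
  ∀ u u', c u = c u' → ∀ a b, (u a = u b ↔ u' a = u' b) ∧
    (G.graph.Adj (u a) (u b) ↔ G.graph.Adj (u' a) (u' b)) ∧ G.colour (u a) = G.colour (u' a)

theorem exists_equiv_of_card_fiber {Y Y' Z : Type*} [Fintype Y] [Fintype Y'] [DecidableEq Z]
    (f : Y → Z) (g : Y' → Z)
    (h : ∀ z, #{y | f y = z} = #{y | g y = z}) : ∃ e : Y ≃ Y', ∀ y, g (e y) = f y := by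
  have : ∀ z, Nonempty ({y // f y = z} ≃ {y // g y = z}) := fun z =>
    Fintype.card_eq.1 (by rw [Fintype.card_subtype, Fintype.card_subtype, h])
  exact ⟨Equiv.ofFiberEquiv fun z => (this z).some, fun y => Equiv.ofFiberEquiv_map _ _⟩

section
variable {d : ℕ} {G : ColouredGraph} {c : (Fin d → Fin G.order) → ℕ}

theorem Stable.exists_equiv (hc : Stable subst c) (j : Fin d) {u u' : Fin d → Fin G.order}
    (h : c u = c u') : ∃ f : Fin G.order ≃ Fin G.order, ∀ x, c (subst j u' (f x)) = c (subst j u x) :=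
  exists_equiv_of_card_fiber (fun x => c (subst j u x)) (fun x => c (subst j u' x))
    fun z => hc j u u' z h

theorem Stable.subst_entry (hc : Stable subst c) (ha : Atomic G c) (a b : Fin d)
    {u u' : Fin d → Fin G.order} (h : c u = c u') : c (subst a u (u b)) = c (subst a u' (u' b)) := by
  by_cases hab : b = a
  · subst hab
    simpa [subst] using h
  · obtain ⟨f, hf⟩ := hc.exists_equiv a h
    have h1 := (ha _ _ (hf (u b)) a b).1
    simp only [subst, Function.update_self, Function.update_of_ne hab, iff_true] at h1
    rw [← hf, h1]

theorem Stable.diag_entry (hc : Stable subst c) (ha : Atomic G c) (b : Fin d)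
    {u u' : Fin d → Fin G.order} (h : c u = c u') : c (diag d (u b)) = c (diag d (u' b)) := by
  have key : ∀ s : Finset (Fin d), c (fun a => if a ∈ s then u b else u a) =
      c (fun a => if a ∈ s then u' b else u' a) := by
    intro s
    induction s using Finset.induction_on with
    | empty => simpa using h
    | insert a s has ih =>
      have := hc.subst_entry ha a b ih
      simp only [ite_self] at this
      have e : ∀ u : Fin d → Fin G.order, (if b ∈ s then u b else u b) = u b := fun u => ite_self _
      convert this using 2 <;>
      · funext x
        by_cases hx : x = a
        · subst hx; simp [subst]
        · simp [subst, hx]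
  have := key univ
  simp only [mem_univ, if_true] at this
  exact this

end

section
variable {k : ℕ} {G : ColouredGraph} {c : (Fin (k + 2) → Fin G.order) → ℕ}

/-- The first `k` entries. -/
def init {n k : ℕ} (u : Fin (k + 2) → Fin n) : Fin k → Fin n := fun a => u a.castSucc.castSucc

/-- The graph `G` with the vertex `v` individualised, and the vertices in `D` named. -/
noncomputable abbrev pinned (G : ColouredGraph) (D : Set (Fin G.order)) (v : Fin G.order) :
    ColouredGraph where
  order := G.order
  graph := G.graph
  colour x := Nat.pair (if x ∈ D then (x : ℕ) + 2 else if x = v then 1 else 0) (G.colour x)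

theorem wl_pinned_eq (hc : Stable subst c) (ha : Atomic G c) {D : Set (Fin G.order)}
    (hD : ∀ x ∈ D, ∀ u, c u = c (diag _ x) → u = diag _ x) (i : ℕ)
    {u u' : Fin (k + 2) → Fin G.order} (h : c u = c u') :
    (pinned G D (u (Fin.last _))).wl k i (init u) = (pinned G D (u' (Fin.last _))).wl k i (init u') := by
  induction i generalizing u u' with
  | zero =>
    refine Prod.ext (funext fun a => ?_) (Prod.ext (funext fun a => funext fun b => ?_)
      (funext fun a => funext fun b => ?_))
    · have h1 := ha u u' h a.castSucc.castSucc (Fin.last _)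
      have hdiag := hc.diag_entry ha a.castSucc.castSucc h
      have hmem : ∀ u u' : Fin (k + 2) → Fin G.order,
          c (diag _ (u a.castSucc.castSucc)) = c (diag _ (u' a.castSucc.castSucc)) →
          u a.castSucc.castSucc ∈ D → u' a.castSucc.castSucc = u a.castSucc.castSucc := by
        intro u u' h hu
        exact congrFun (hD _ hu _ h.symm) 0
      suffices hmark : (if u a.castSucc.castSucc ∈ D then (u a.castSucc.castSucc : ℕ) + 2
          else if u a.castSucc.castSucc = u (Fin.last _) then 1 else 0) =
          (if u' a.castSucc.castSucc ∈ D then (u' a.castSucc.castSucc : ℕ) + 2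
          else if u' a.castSucc.castSucc = u' (Fin.last _) then 1 else 0) from
        congrArg₂ Nat.pair hmark h1.2.2
      by_cases hu : u a.castSucc.castSucc ∈ D
      · rw [hmem u u' hdiag hu]
        simp [hu]
      · have hu' : u' a.castSucc.castSucc ∉ D := fun hu' => hu (by
          rw [hmem u' u hdiag.symm hu']; exact hu')
        simp [hu, hu', h1.1]
    · exact propext (ha u u' h a.castSucc.castSucc b.castSucc.castSucc).1
    · exact propext (ha u u' h a.castSucc.castSucc b.castSucc.castSucc).2.1
  | succ i ih =>
    refine Prod.ext (ih h) ?_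
    obtain ⟨f, hf⟩ := hc.exists_equiv (Fin.last k).castSucc h
    have hne : ∀ a : Fin k, a.castSucc.castSucc ≠ (Fin.last k).castSucc := fun a h =>
      absurd (Fin.castSucc_injective _ h) (Fin.castSucc_lt_last a).ne
    have hfilter : univ.filter (fun w : Fin G.order => k = 1 → ∀ a, G.graph.Adj (init u' a) w) =
        (univ.filter (fun w : Fin G.order => k = 1 → ∀ a, G.graph.Adj (init u a) w)).map
          f.toEmbedding := by
      ext w
      simp only [mem_filter, mem_univ, true_and, Finset.mem_map, Equiv.coe_toEmbedding]
      have : ∀ x a, G.graph.Adj (init u' a) (f x) ↔ G.graph.Adj (init u a) x := by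
        intro x a
        have := (ha _ _ (hf x) a.castSucc.castSucc (Fin.last k).castSucc).2.1
        simpa [subst, hne a, init] using this
      constructor
      · intro h1
        refine ⟨f.symm w, ?_, by simp⟩
        intro hk a
        rw [← this]
        simpa using h1 hk a
      · rintro ⟨x, hx, rfl⟩ hk a
        rw [this]
        exact hx hk a
    have ih' : ∀ {u u' : Fin (k + 2) → Fin G.order} {x x' t t'}, c u = c u' → u (Fin.last _) = x →
        u' (Fin.last _) = x' → init u = t → init u' = t' →
        (pinned G D x).wl k i t = (pinned G D x').wl k i t' := by
      rintro u u' _ _ _ _ h rfl rfl rfl rfl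
      exact ih h
    have key : ∀ w : Fin G.order,
        (fun a => (pinned G D (u (Fin.last _))).wl k i (Function.update (init u) a w)) =
        (fun a => (pinned G D (u' (Fin.last _))).wl k i (Function.update (init u') a (f w))) := by
      intro w
      funext a
      have h1 := hc.subst_entry ha a.castSucc.castSucc (Fin.last k).castSucc (hf w)
      have hl : ∀ b : Fin (k + 1), Fin.last (k + 1) ≠ b.castSucc := fun b h =>
        (Fin.castSucc_lt_last b).ne h.symm
      have h3 : ∀ (u : Fin (k + 2) → Fin G.order) (w : Fin G.order),
          init (Function.update (Function.update u (Fin.last k).castSucc w) a.castSucc.castSucc w) =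
            Function.update (init u) a w := by
        intro u w
        funext b
        by_cases hb : b = a
        · subst hb; simp [init]
        · simp [init, hb, hne b]
      simp only [subst, Function.update_self] at h1
      exact ih' h1.symm (by rw [Function.update_of_ne (hl _), Function.update_of_ne (hl _)])
        (by rw [Function.update_of_ne (hl _), Function.update_of_ne (hl _)]) (h3 u w) (h3 u' (f w))
    calc _ = Multiset.map (fun w a => (pinned G D (u (Fin.last _))).wl k i
          (Function.update (init u) a w))
          (univ.filter (fun w : Fin G.order => k = 1 → ∀ a, G.graph.Adj (init u a) w)).val := rfl
      _ = Multiset.map (fun w a => (pinned G D (u' (Fin.last _))).wl k i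
          (Function.update (init u') a w))
          (univ.filter (fun w : Fin G.order => k = 1 → ∀ a, G.graph.Adj (init u' a) w)).val := by
        rw [hfilter, Finset.map_val, Multiset.map_map]
        exact Multiset.map_congr rfl fun w _ => key w
      _ = _ := rfl

end

section
variable {d : ℕ} {G : ColouredGraph} {c : (Fin d → Fin G.order) → ℕ}

theorem Stable.card_agree (hc : Stable subst c) (s : Finset (Fin d)) {b b' : Fin d → Fin G.order}
    (h : c b = c b') (x : ℕ) :
    #{u : Fin d → Fin G.order | (∀ a ∉ s, u a = b a) ∧ c u = x} =
      #{u : Fin d → Fin G.order | (∀ a ∉ s, u a = b' a) ∧ c u = x} := by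
  induction s using Finset.induction_on generalizing b b' with
  | empty =>
    have : ∀ b u : Fin d → Fin G.order, (∀ a ∉ (∅ : Finset (Fin d)), u a = b a) ↔ u = b := fun b u =>
      ⟨fun h => funext fun a => h a (by simp), fun h a _ => h ▸ rfl⟩
    simp only [this]
    have h2 : ∀ b : Fin d → Fin G.order, #{u | u = b ∧ c u = x} = if c b = x then 1 else 0 := by
      intro b
      split_ifs with hb
      · rw [card_eq_one]
        refine ⟨b, ?_⟩
        ext u
        simp only [mem_filter, mem_univ, true_and, mem_singleton, and_iff_left_iff_imp]
        rintro rfl; exact hb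
      · rw [card_eq_zero, filter_eq_empty_iff]
        rintro u - ⟨rfl, h⟩
        exact hb h
    rw [h2, h2, h]
  | insert a s has ih =>
    have key : ∀ b : Fin d → Fin G.order,
        #{u : Fin d → Fin G.order | (∀ z ∉ insert a s, u z = b z) ∧ c u = x} =
        ∑ y, #{u : Fin d → Fin G.order | (∀ z ∉ s, u z = subst a b y z) ∧ c u = x} := by
      intro b
      rw [card_eq_sum_card_fiberwise (f := fun u => u a) (t := univ) (fun _ _ => mem_univ _)]
      refine sum_congr rfl fun y _ => ?_
      rw [filter_filter]
      congr 1
      ext u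
      simp only [mem_filter, mem_univ, true_and]
      constructor
      · rintro ⟨⟨h1, h2⟩, h3⟩
        refine ⟨fun z hz => ?_, h2⟩
        by_cases hza : z = a
        · subst hza; simpa [subst] using h3
        · simp [subst, hza, h1 z (by simp [hza, hz])]
      · rintro ⟨h1, h2⟩
        refine ⟨⟨fun z hz => ?_, h2⟩, ?_⟩
        · simp only [mem_insert, not_or] at hz
          simpa [subst, hz.1] using h1 z hz.2
        · simpa [subst] using h1 a has
    obtain ⟨f, hf⟩ := hc.exists_equiv a h
    rw [key, key b', ← f.sum_comp fun y =>
      #{u : Fin d → Fin G.order | (∀ z ∉ s, u z = subst a b' y z) ∧ c u = x}]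
    exact sum_congr rfl fun y _ => ih (hf y).symm

end

section
variable {k : ℕ} {G : ColouredGraph} {c : (Fin (k + 2) → Fin G.order) → ℕ}

theorem exists_equiv_wl_pinned (hc : Stable subst c) (ha : Atomic G c) {D : Set (Fin G.order)}
    (hD : ∀ x ∈ D, ∀ u, c u = c (diag _ x) → u = diag _ x) {v w : Fin G.order}
    (h : c (diag _ v) = c (diag _ w)) : ∃ F : (Fin k → Fin G.order) ≃ (Fin k → Fin G.order),
      ∀ i t, (pinned G D w).wl k i (F t) = (pinned G D v).wl k i t := by
  set s : Finset (Fin (k + 2)) := {a | a ≠ Fin.last _ ∧ a ≠ (Fin.last k).castSucc} with hs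
  let ext : ∀ v : Fin G.order, (Fin k → Fin G.order) ≃
      {u : Fin (k + 2) → Fin G.order // ∀ a ∉ s, u a = v} := fun v =>
    { toFun := fun t => ⟨Fin.snoc (Fin.snoc t v : Fin (k + 1) → Fin G.order) v, fun a ha => by
        have : a = Fin.last _ ∨ a = (Fin.last k).castSucc := by
          by_contra hcon
          exact ha (by simpa [hs] using hcon)
        rcases this with rfl | rfl
        · rw [Fin.snoc_last]
        · rw [Fin.snoc_castSucc, Fin.snoc_last]⟩
      invFun := fun u => init u.1
      left_inv := fun t => by
        funext a
        simp only [init]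
        rw [Fin.snoc_castSucc, Fin.snoc_castSucc]
      right_inv := fun u => by
        obtain ⟨u, hu⟩ := u
        refine Subtype.ext (funext fun a => ?_)
        refine Fin.lastCases ?_ (fun a => ?_) a
        · simp [hu _ (show Fin.last _ ∉ s by simp [hs])]
        · simp only [Fin.snoc_castSucc]
          refine Fin.lastCases ?_ (fun a => ?_) a
          · rw [Fin.snoc_last, hu _ (by simp [hs])]
          · rw [Fin.snoc_castSucc]
            rfl }
  obtain ⟨E, hE⟩ := exists_equiv_of_card_fiber
    (fun u : {u : Fin (k + 2) → Fin G.order // ∀ a ∉ s, u a = v} => c u.1)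
    (fun u : {u : Fin (k + 2) → Fin G.order // ∀ a ∉ s, u a = w} => c u.1) fun z => by
      have key : ∀ v : Fin G.order,
          #{u : {u : Fin (k + 2) → Fin G.order // ∀ a ∉ s, u a = v} | c u.1 = z} =
          #{u : Fin (k + 2) → Fin G.order | (∀ a ∉ s, u a = diag _ v a) ∧ c u = z} := by
        intro v
        refine card_bij (fun u _ => u.1) (fun u hu => ?_) (fun u _ u' _ h => Subtype.ext h)
          fun u hu => ?_
        · simp only [mem_filter, mem_univ, true_and] at hu ⊢
          exact ⟨u.2, hu⟩
        · simp only [mem_filter, mem_univ, true_and] at hu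
          exact ⟨⟨u, hu.1⟩, by simp [hu.2], rfl⟩
      have h1 := key v
      have h2 := key w
      rw [hc.card_agree s h, ← h2] at h1
      convert h1
  refine ⟨((ext v).trans E).trans (ext w).symm, fun i t => ?_⟩
  have hlast : ∀ (v : Fin G.order) (u : {u : Fin (k + 2) → Fin G.order // ∀ a ∉ s, u a = v}),
      u.1 (Fin.last _) = v := fun v u => u.2 _ (by simp [hs])
  have h1 := wl_pinned_eq hc ha hD i (hE (ext v t))
  rw [hlast, hlast] at h1
  have h2 : init (ext v t).1 = t := (ext v).symm_apply_apply t
  exact h1.trans (congrArg ((pinned G D v).wl k i) h2)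

theorem not_wlDistinguishes_of_equiv {G H : ColouredGraph} (F : (Fin k → Fin G.order) ≃
    (Fin k → Fin H.order)) (hF : ∀ i t, H.wl k i (F t) = G.wl k i t) :
    ¬ ColouredGraph.WLDistinguishes k G H := by
  have hst : ∀ i, G.WLStableAt k i ↔ H.WLStableAt k i := by
    intro i
    unfold ColouredGraph.WLStableAt
    rw [← F.forall_congr_right]
    refine forall_congr' fun v => ?_
    rw [← F.forall_congr_right]
    simp only [hF]
  have hr : G.wlStableRound k = H.wlStableRound k := by
    unfold ColouredGraph.wlStableRound
    refine le_antisymm ?_ ?_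
    · exact Nat.find_min' _ ((hst _).2 (Nat.find_spec (H.exists_wlStableAt k)))
    · exact Nat.find_min' _ ((hst _).1 (Nat.find_spec (G.exists_wlStableAt k)))
  have hs : ∀ t, H.wlStable k (F t) = G.wlStable k t := by
    intro t
    unfold ColouredGraph.wlStable
    rw [hr, hF]
  rintro ⟨x, hx⟩
  apply hx
  rw [← Set.ncard_image_of_injective _ F.injective]
  congr 1
  ext t
  simp only [Set.mem_image, Set.mem_ofPred_eq]
  constructor
  · rintro ⟨u, hu, rfl⟩
    rw [hs, hu]
  · intro h
    refine ⟨F.symm t, ?_, by simp⟩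
    rw [← hs]
    simpa using h

/-- Vertices in the same class of a stable partition are in the same orbit, if the
Weisfeiler-Leman algorithm identifies all colourings of the graph. -/
theorem exists_automorphism (hid : ∀ χ, ColouredGraph.WLIdentifies k ⟨G.order, G.graph, χ⟩)
    (hc : Stable subst c) (ha : Atomic G c) {D : Set (Fin G.order)}
    (hD : ∀ x ∈ D, ∀ u, c u = c (diag _ x) → u = diag _ x) {v w : Fin G.order}
    (h : c (diag _ v) = c (diag _ w)) : ∃ e : G.graph ≃g G.graph,
      (∀ x, G.colour (e x) = G.colour x) ∧ (∀ x ∈ D, e x = x) ∧ e v = w := by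
  obtain ⟨F, hF⟩ := exists_equiv_wl_pinned hc ha hD h
  have hiso : (pinned G D v).Iso (pinned G D w) := by
    by_contra hcon
    exact not_wlDistinguishes_of_equiv (G := pinned G D v) (H := pinned G D w) F hF
      (hid _ (pinned G D w) hcon)
  obtain ⟨e, he⟩ := hiso
  replace he : ∀ x : Fin G.order, (if (e x : Fin G.order) ∈ D then ((e x : Fin G.order) : ℕ) + 2
      else if (e x : Fin G.order) = w then 1 else 0) =
      (if x ∈ D then (x : ℕ) + 2 else if x = v then 1 else 0) ∧ G.colour (e x) = G.colour x :=
    fun x => Nat.pair_eq_pair.1 (by convert he x)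
  have hfix : ∀ x ∈ D, e x = x := by
    intro x hx
    have := (he x).1
    rw [if_pos hx] at this
    split_ifs at this
    · exact Fin.ext (by omega)
    all_goals omega
  refine ⟨e, fun x => (he x).2, hfix, ?_⟩
  by_cases hv : v ∈ D
  · rw [hfix v hv]
    exact (congrFun (hD v hv _ h.symm) 0).symm
  · have := (he v).1
    rw [if_neg hv, if_pos rfl] at this
    split_ifs at this with h1 h2
    · omega
    · exact h2

end
end Refinement

/-! ### The canonical labelling -/

namespace Refinement

open Finset Classical

section
variable (d : ℕ) (G : ColouredGraph)

/-- The number of vertices of smaller colour. -/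
def colourRank (v : Fin G.order) : ℕ := #{x | G.colour x < G.colour v}

/-- The atomic type of a pair of vertices. -/
noncomputable def pairType (v w : Fin G.order) : ℕ :=
  if v = w then colourRank G v + 2 else if G.graph.Adj v w then 1 else 0

def pairTypeSet (a b : Fin d) (q : ℕ) : Set (Fin d → Fin G.order) :=
  {u | pairType G (u a) (u b) = q}

def initialSets : List (Set (Fin d → Fin G.order)) :=
  (List.finRange d).flatMap fun a => (List.finRange d).flatMap fun b =>
    (List.range (G.order + 2)).map fun q => pairTypeSet d G a b q

/-- The stable partition after the individualisation of the vertices in a list. -/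
noncomputable def state : List (Fin G.order) → St (Fin d → Fin G.order)
  | [] => refine subst (List.finRange d) (splits (initialSets d G) (trivialSt _))
  | v :: vs => refine subst (List.finRange d) (split {diag d v} (state vs))

/-- The vertices in the list are obtained by choosing repeatedly, among the vertices not yet chosen,
one in the first class. -/
inductive Selected : List (Fin G.order) → Prop
  | nil : Selected []
  | cons (v : Fin G.order) (vs : List (Fin G.order)) : Selected vs → v ∉ vs →
      (∀ w ∉ vs, (state d G vs).c (diag d v) ≤ (state d G vs).c (diag d w)) → Selected (v :: vs)

end

section
variable {d : ℕ} {G : ColouredGraph}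

theorem colourRank_lt (v : Fin G.order) : colourRank G v < G.order := by
  conv_rhs => rw [← Fintype.card_fin G.order]
  exact card_lt_univ_of_notMem (x := v) (by simp)

theorem pairType_lt (v w : Fin G.order) : pairType G v w < G.order + 2 := by
  have := colourRank_lt v
  unfold pairType
  split_ifs <;> omega

theorem colour_eq_of_colourRank_eq {v w : Fin G.order} (h : colourRank G v = colourRank G w) :
    G.colour v = G.colour w := by
  by_contra hne
  wlog hlt : G.colour v < G.colour w generalizing v w
  · exact this h.symm (Ne.symm hne) (by omega)
  · refine absurd h (card_lt_card ?_).ne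
    refine ⟨fun x hx => ?_, fun hsub => ?_⟩
    · simp only [mem_filter, mem_univ, true_and] at hx ⊢
      omega
    · simpa using hsub (show v ∈ _ by simpa using hlt)

theorem inv_state (vs : List (Fin G.order)) : Inv (state d G vs) := by
  induction vs with
  | nil => exact (inv_trivialSt.splits _).refine _
  | cons v vs ih => exact (ih.split _).refine _

theorem spans_state (vs : List (Fin G.order)) : Spans subst (state d G vs) 0 := by
  induction vs with
  | nil =>
    exact (spans_trivialSt.splits inv_trivialSt _).refine (inv_trivialSt.splits _)
      (fun j => List.mem_finRange j)
  | cons v vs ih =>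
    exact (ih.split (inv_state vs) _).refine ((inv_state vs).split _) (fun j => List.mem_finRange j)

theorem not_pending_state (vs : List (Fin G.order)) : ¬ ∃ u, (state d G vs).p u := by
  cases vs with
  | nil => exact ((inv_trivialSt.splits _).iterate_step _ _ le_rfl).2
  | cons v vs => exact (((inv_state vs).split _).iterate_step _ _ le_rfl).2

theorem stable_state (vs : List (Fin G.order)) : Stable subst (state d G vs).c :=
  (spans_state vs).stable (not_pending_state vs)

theorem atomic_state (vs : List (Fin G.order)) : Atomic G (state d G vs).c := by
  induction vs with
  | nil =>
    intro u u' h a b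
    have h1 := (inv_trivialSt.splits _).refine_c_eq _ h
    have h2 := (inv_trivialSt.splits_c_eq _ h1).2
    have key : ∀ a b, pairType G (u' a) (u' b) = pairType G (u a) (u b) := by
      intro a b
      refine (h2 (pairTypeSet d G a b (pairType G (u a) (u b))) ?_).1 rfl
      simp only [initialSets, List.mem_flatMap, List.mem_finRange, List.mem_map, List.mem_range,
        true_and]
      exact ⟨a, b, _, pairType_lt _ _, rfl⟩
    have h3 := key a b
    have h4 := key a a
    simp only [pairType, if_true, Nat.add_right_cancel_iff] at h3 h4
    refine ⟨?_, ?_, (colour_eq_of_colourRank_eq h4).symm⟩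
    · split_ifs at h3 <;> omega
    · split_ifs at h3 with h5 h6 h7 h8 h9 <;> first | omega | simp [*]
  | cons v vs ih =>
    intro u u' h a b
    have h1 := ((inv_state vs).split _).refine_c_eq _ h
    exact ih u u' (((inv_state vs).split_c_eq_iff _ _).1 h1).1 a b

theorem eq_diag_of_mem {vs : List (Fin G.order)} {x : Fin G.order} (hx : x ∈ vs)
    {u : Fin d → Fin G.order} (h : (state d G vs).c u = (state d G vs).c (diag d x)) :
    u = diag d x := by
  induction vs with
  | nil => cases hx
  | cons v vs ih =>
    have h1 := ((inv_state vs).split_c_eq_iff _ _).1 (((inv_state vs).split _).refine_c_eq _ h)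
    rcases List.mem_cons.1 hx with rfl | hx
    · exact h1.2.2 rfl
    · exact ih hx h1.1

/-- The bijection of the tuples that is induced by a bijection of the vertices. -/
def tupleEquiv (d : ℕ) {n m : ℕ} (e : Fin n ≃ Fin m) : (Fin d → Fin n) ≃ (Fin d → Fin m) :=
  Equiv.piCongrRight fun _ => e

@[simp] theorem tupleEquiv_apply {n m : ℕ} (e : Fin n ≃ Fin m) (u : Fin d → Fin n) (a : Fin d) :
    tupleEquiv d e u a = e (u a) := rfl

theorem subst_tupleEquiv {n m : ℕ} (e : Fin n ≃ Fin m) (j : Fin d) (u : Fin d → Fin n) (x : Fin n) :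
    subst j (tupleEquiv d e u) (e x) = tupleEquiv d e (subst j u x) := by
  funext a
  by_cases h : a = j
  · subst h; simp [subst]
  · simp [subst, h]

variable {H : ColouredGraph}

theorem pairType_iso (e : G.graph ≃g H.graph) (he : ∀ v, H.colour (e v) = G.colour v)
    (v w : Fin G.order) : pairType H (e v) (e w) = pairType G v w := by
  have h1 : ∀ v, colourRank H (e v) = colourRank G v := by
    intro v
    rw [colourRank, colourRank]
    exact card_filter_equiv e.toEquiv fun x => by
      change H.colour (e x) < _ ↔ _
      rw [he, he]
  unfold pairType
  simp only [h1, e.injective.eq_iff, e.map_adj_iff]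

theorem corr_state (e : G.graph ≃g H.graph) (he : ∀ v, H.colour (e v) = G.colour v)
    (vs : List (Fin G.order)) :
    Corr (tupleEquiv d e.toEquiv) (state d G vs) (state d H (vs.map e)) := by
  induction vs with
  | nil =>
    refine Corr.refine (f := e.toEquiv) (Corr.splits ?_ ?_)
      (fun j u x => subst_tupleEquiv e.toEquiv j u x) _
    · intro u
      simp [trivialSt]
    · have hcard : H.order = G.order := by
        simpa using (Fintype.card_congr e.toEquiv).symm
      have : ∀ l : List (Fin d × Fin d × ℕ), List.Forall₂
          (fun (A : Set (Fin d → Fin G.order)) (A' : Set (Fin d → Fin H.order)) =>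
            ∀ u, tupleEquiv d e.toEquiv u ∈ A' ↔ u ∈ A)
          (l.map fun t => pairTypeSet d G t.1 t.2.1 t.2.2)
          (l.map fun t => pairTypeSet d H t.1 t.2.1 t.2.2) := by
        intro l
        refine List.forall₂_map_left_iff.2 (List.forall₂_map_right_iff.2 (List.forall₂_same.2 ?_))
        intro t _ u
        exact iff_of_eq (congrArg (· = t.2.2) (pairType_iso e he _ _))
      have h2 := this ((List.finRange d).flatMap fun a => (List.finRange d).flatMap fun b =>
        (List.range (G.order + 2)).map fun q => (a, b, q))
      simp only [List.map_flatMap, List.map_map] at h2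
      simp only [initialSets, hcard]
      exact h2
  | cons v vs ih =>
    refine Corr.refine (f := e.toEquiv) (Corr.split ih fun u => ?_)
      (fun j u x => subst_tupleEquiv e.toEquiv j u x) _
    change tupleEquiv d e.toEquiv u = tupleEquiv d e.toEquiv (diag d v) ↔ _
    rw [(tupleEquiv d e.toEquiv).injective.eq_iff]
    rfl

theorem Selected.nodup {vs : List (Fin G.order)} (h : Selected d G vs) : vs.Nodup := by
  induction h with
  | nil => exact List.nodup_nil
  | cons v vs _ hv _ ih => exact List.nodup_cons.2 ⟨hv, ih⟩

end

section
variable {k : ℕ} {G H : ColouredGraph}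

theorem Selected.exists_iso (hid : ∀ χ, ColouredGraph.WLIdentifies k ⟨H.order, H.graph, χ⟩)
    {vs : List (Fin G.order)} {ws : List (Fin H.order)} (hv : Selected (k + 2) G vs)
    (hw : Selected (k + 2) H ws) (hlen : vs.length = ws.length) (hiso : G.Iso H) :
    ∃ e : G.graph ≃g H.graph, (∀ v, H.colour (e v) = G.colour v) ∧ ws = vs.map e := by
  induction hv generalizing ws with
  | nil =>
    obtain ⟨e, he⟩ := hiso
    exact ⟨e, he, List.length_eq_zero_iff.1 hlen.symm⟩
  | cons v vs hvs hv hmin ih =>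
    cases hw with
    | nil => simp at hlen
    | cons w ws hws hw hmin' =>
      obtain ⟨e, he, rfl⟩ := ih hws (by simpa using hlen)
      have hcorr := corr_state (d := k + 2) e he vs
      have hdiag : ∀ x, (state (k + 2) H (vs.map e)).c (diag _ (e x)) =
          (state (k + 2) G vs).c (diag _ x) := fun x => (hcorr (diag _ x)).1
      have h1 := hmin' (e v) (by simpa using hv)
      have h2 := hmin (e.symm w) (fun h => hw (List.mem_map.2 ⟨_, h, by simp⟩))
      rw [← hdiag, ← hdiag, RelIso.apply_symm_apply] at h2
      obtain ⟨a, ha, hfix, hav⟩ := exists_automorphism hid (stable_state (vs.map e))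
        (atomic_state (vs.map e)) (D := {x | x ∈ vs.map e})
        (fun x hx u hu => eq_diag_of_mem hx hu) (le_antisymm h2 h1)
      refine ⟨e.trans a, fun x => ?_, ?_⟩
      · change H.colour (a (e x)) = _
        rw [ha, he]
      · rw [List.map_cons]
        congr 1
        · exact hav.symm
        · refine List.map_congr_left fun x hx => ?_
          exact (hfix (e x) (List.mem_map_of_mem hx)).symm

/-- The graph `G` with its vertices relabelled according to their positions in the list `vs`. -/
def relabel (G : ColouredGraph) (vs : List (Fin G.order)) (h : vs.length = G.order) :
    ColouredGraph where
  order := G.order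
  graph := G.graph.comap fun i => vs[(i : ℕ)]'(by omega)
  colour i := G.colour (vs[(i : ℕ)]'(by omega))

theorem relabel_eq_of_iso {vs : List (Fin G.order)} {ws : List (Fin H.order)}
    (hv : vs.length = G.order) (hw : ws.length = H.order) (e : G.graph ≃g H.graph)
    (he : ∀ v, H.colour (e v) = G.colour v) (h : ws = vs.map e) : relabel G vs hv = relabel H ws hw := by
  obtain ⟨n, g, c⟩ := G
  obtain ⟨m, g', c'⟩ := H
  obtain rfl : n = m := by simpa using Fintype.card_congr e.toEquiv
  subst h
  simp only [relabel, ColouredGraph.mk.injEq, heq_eq_eq, true_and]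
  constructor
  · ext i j
    simp only [SimpleGraph.comap_adj, List.getElem_map]
    exact (e.map_adj_iff).symm
  · funext i
    simp only [List.getElem_map]
    exact (he _).symm

theorem relabel_iso {vs : List (Fin G.order)} (hv : vs.length = G.order) (hnd : vs.Nodup) :
    (relabel G vs hv).Iso G := by
  have hinj : Function.Injective fun i : Fin G.order => vs[(i : ℕ)]'(by omega) := fun i j h =>
    Fin.ext ((List.Nodup.getElem_inj_iff hnd).1 h)
  exact ⟨⟨Equiv.ofBijective _ (Finite.injective_iff_bijective.1 hinj), Iff.rfl⟩, fun _ => rfl⟩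

end
end Refinement

/-! ### Basic data structures on the machine -/

namespace RAM

open Finset Refinement

local notation:max "vN" => 0
local notation:max "vM" => 1
local notation:max "aTree" => 10

/-- The word size suffices for tuples of length `d` of `n` vertices. -/
structure Params (W n d : ℕ) : Prop where
  pos : 0 < n
  dim : 2 ≤ d
  word : (d + 4) * n ^ d + n + d + 4 < W

/-- The variables that hold the parameters. -/
structure Env (n d : ℕ) (s : Store) : Prop where
  order : s.var vN = n
  tuples : s.var vM = n ^ d

theorem Env.frame {n d X : ℕ} {L : List ℕ} {s s' : Store} (h : Env n d s) (hf : Frame X L s s')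
    (hX : 2 ≤ X) : Env n d s' :=
  ⟨(hf.1 _ (by omega)).trans h.order, (hf.1 _ (by omega)).trans h.tuples⟩

/-! #### The tree of pending classes -/

/-- Level `l` of the tree counts the elements of `P` in the blocks of length `n ^ l`. -/
structure TreeRep (n d : ℕ) (s : Store) (P : Finset ℕ) : Prop where
  lt : ∀ x ∈ P, x < n ^ d
  count : ∀ l ≤ d, ∀ q < n ^ d, s.arr aTree (l * n ^ d + q) = #{x ∈ P | x / n ^ l = q}

theorem TreeRep.congr {n d : ℕ} {s s' : Store} {P : Finset ℕ} (h : TreeRep n d s P)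
    (hs : s'.arr aTree = s.arr aTree) : TreeRep n d s' P :=
  ⟨h.lt, fun l hl q hq => by rw [hs]; exact h.count l hl q hq⟩

/-- Insert the value of variable `50`. -/
def treeInsert (d : ℕ) : Cmd :=
  .seq (.asg 52 (.v 50)) (.for' 51 (.lit (d + 1)) (.seq
    (.wr aTree (.v 51 * .v vM + .v 52) (.get aTree (.v 51 * .v vM + .v 52) + .lit 1))
    (.asg 52 (.v 52 / .v vN))))

/-- Erase the value of variable `50`. -/
def treeErase (d : ℕ) : Cmd :=
  .seq (.asg 52 (.v 50)) (.for' 51 (.lit (d + 1)) (.seq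
    (.wr aTree (.v 51 * .v vM + .v 52) (.get aTree (.v 51 * .v vM + .v 52) - .lit 1))
    (.asg 52 (.v 52 / .v vN))))

/-- Find the least element and assign it to variable `52`. -/
def treeMin (d : ℕ) : Cmd :=
  .seq (.asg 52 (.lit 0)) (.for' 51 (.lit d) (.seq (.asg 52 (.v vN * .v 52))
    (.whl (.lt (.get aTree ((.lit (d - 1) - .v 51) * .v vM + .v 52)) (.lit 1))
      (.asg 52 (.v 52 + .lit 1)))))

theorem eq_of_mul_add_eq {M l l' q q' : ℕ} (hq : q < M) (hq' : q' < M)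
    (h : l * M + q = l' * M + q') : l = l' ∧ q = q' := by
  have h1 := congrArg (· / M) h
  have h2 := congrArg (· % M) h
  simp only [Nat.mul_add_mod_self_right, Nat.mod_eq_of_lt hq, Nat.mod_eq_of_lt hq'] at h2
  subst h2
  exact ⟨Nat.eq_of_mul_eq_mul_right (by omega) (Nat.add_right_cancel h), rfl⟩

section
variable {W n d : ℕ} {s : Store} {P : Finset ℕ}

theorem Params.mul_add_lt (hW : Params W n d) {l q c : ℕ} (hl : l ≤ d) (hq : q < n ^ d) (hc : c ≤ 4) :
    l * n ^ d + q + c < W := by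
  have h1 := hW.word
  have h2 : l * n ^ d ≤ d * n ^ d := Nat.mul_le_mul_right _ hl
  rw [add_mul] at h1
  omega

theorem TreeRep.card_le (ht : TreeRep n d s P) (l q : ℕ) : #{x ∈ P | x / n ^ l = q} ≤ n ^ d := by
  have h : P ⊆ range (n ^ d) := fun x hx => mem_range.2 (ht.lt x hx)
  calc _ ≤ #P := card_filter_le _ _
    _ ≤ _ := card_le_card h
    _ = _ := card_range _

theorem TreeRep.mem_iff (ht : TreeRep n d s P) {x : ℕ} (hx : x < n ^ d) :
    0 < s.arr aTree x ↔ x ∈ P := by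
  have := ht.count 0 (Nat.zero_le _) x hx
  simp only [zero_mul, zero_add, pow_zero, Nat.div_one] at this
  rw [this, card_pos, filter_eq', Finset.Nonempty]
  split_ifs with h <;> simp [h]

theorem TreeRep.nonempty_iff (ht : TreeRep n d s P) (hn : 0 < n) :
    0 < s.arr aTree (d * n ^ d) ↔ P.Nonempty := by
  have := ht.count d le_rfl 0 (pow_pos hn d)
  rw [add_zero] at this
  rw [this, card_pos, filter_true_of_mem]
  exact fun x hx => Nat.div_eq_of_lt (ht.lt x hx)

theorem wp_treeInsert (hW : Params W n d) (hs : Env n d s) (ht : TreeRep n d s P) {x : ℕ}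
    (hx : s.var 50 = x) (hxM : x < n ^ d) (hxP : x ∉ P) :
    (treeInsert d).wp W (fun _ s' => TreeRep n d s' (insert x P) ∧ Frame 51 [aTree] s s')
      (80 * (d + 2)) s := by
  have hword := hW.word
  have hcard : ∀ l q, #{y ∈ insert x P | y / n ^ l = q} =
      #{y ∈ P | y / n ^ l = q} + if q = x / n ^ l then 1 else 0 := by
    intro l q
    rw [filter_insert]
    split_ifs with h1 h2 h3
    · rw [card_insert_of_notMem (by simp [hxP])]
    · exact absurd h1.symm h2
    · exact absurd h3.symm h1
    · rfl
  have hdiv : ∀ l, x / n ^ l < n ^ d := fun l => (Nat.div_le_self _ _).trans_lt hxM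
  have hd : 2 ≤ d := hW.dim
  have hMle : n ^ d ≤ (d + 4) * n ^ d := Nat.le_mul_of_pos_left _ (by omega)
  simp only [treeInsert, Cmd.wp_seq, Cmd.wp_asg, Ex.fits_v, Ex.ok_v, Ex.cost_v, Ex.depth_v,
    Ex.eval_v, hx]
  refine ⟨by omega, by omega, trivial, by omega, ?_⟩
  refine Cmd.wp_for (d + 1) 50 (fun j s' => s'.var 52 = x / n ^ j ∧ Frame 51 [aTree] s s' ∧
    ∀ l ≤ d, ∀ q < n ^ d, s'.arr aTree (l * n ^ d + q) =
      #{y ∈ P | y / n ^ l = q} + if l < j ∧ q = x / n ^ l then 1 else 0)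
    (by norm_num) trivial (by omega) ?_ ?_ ?_ ?_ ?_
  · refine ⟨by simp, (Frame.refl.setVar _ (by norm_num)).setVar _ (by norm_num), ?_⟩
    intro l hl q hq
    simpa using ht.count l hl q hq
  · intro j s' _ _
    exact ⟨show d + 1 < W by omega, rfl⟩
  · simp only [Cmd.forCost, Ex.cost_lit, Ex.depth_lit]
    omega
  · rintro j s' hj ⟨h52, hf, hI⟩ h51
    have henv := hs.frame hf (by norm_num)
    have haddr := hW.mul_add_lt (Nat.lt_succ_iff.1 hj) (hdiv j) (c := 0) (by norm_num)
    have hval := hI j (Nat.lt_succ_iff.1 hj) _ (hdiv j)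
    rw [if_neg (by simp)] at hval
    have hle := ht.card_le j (x / n ^ j)
    simp only [Cmd.wp_seq, Cmd.wp_wr, Cmd.wp_asg, Tst.fits_lt, Tst.ok_lt, Tst.cost_lt]
    simp [h51, h52, henv.order, henv.tuples, hval]
    refine ⟨by omega, by rw [pow_succ, Nat.div_div_eq_div_mul], ?_, ?_⟩
    · exact ((hf.setArr _ _ (by simp)).setVar _ (by norm_num)).setVar _ (by norm_num)
    · intro l hl q hq
      by_cases hlq : l * n ^ d + q = j * n ^ d + x / n ^ j
      · obtain ⟨rfl, rfl⟩ := eq_of_mul_add_eq hq (hdiv j) hlq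
        simp
      · rw [if_neg hlq, hI l hl q hq]
        congr 1
        have : l = j → q ≠ x / n ^ l := by
          rintro rfl rfl
          exact hlq rfl
        by_cases h2 : q = x / n ^ l
        · have : l ≠ j := fun h => this h h2
          simp only [h2, and_true]
          congr 1
          simp only [eq_iff_iff]
          omega
        · simp [h2]
  · rintro r s' ⟨h52, hf, hI⟩ h51 -
    refine ⟨⟨?_, fun l hl q hq => ?_⟩, hf⟩
    · intro y hy
      rcases mem_insert.1 hy with rfl | hy
      · exact hxM
      · exact ht.lt y hy
    · rw [hI l hl q hq, hcard]
      simp [Nat.lt_succ_of_le hl]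

theorem wp_treeErase (hW : Params W n d) (hs : Env n d s) (ht : TreeRep n d s P) {x : ℕ}
    (hx : s.var 50 = x) (hxP : x ∈ P) :
    (treeErase d).wp W (fun _ s' => TreeRep n d s' (P.erase x) ∧ Frame 51 [aTree] s s')
      (80 * (d + 2)) s := by
  have hword := hW.word
  have hxM := ht.lt x hxP
  have hcard : ∀ l q, #{y ∈ P.erase x | y / n ^ l = q} =
      #{y ∈ P | y / n ^ l = q} - if q = x / n ^ l then 1 else 0 := by
    intro l q
    rw [filter_erase]
    split_ifs with h1
    · rw [card_erase_of_mem (by simp [hxP, h1])]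
    · rw [erase_eq_of_notMem (by simp [Ne.symm h1]), Nat.sub_zero]
  have hdiv : ∀ l, x / n ^ l < n ^ d := fun l => (Nat.div_le_self _ _).trans_lt hxM
  have hd : 2 ≤ d := hW.dim
  have hMle : n ^ d ≤ (d + 4) * n ^ d := Nat.le_mul_of_pos_left _ (by omega)
  simp only [treeErase, Cmd.wp_seq, Cmd.wp_asg, Ex.fits_v, Ex.ok_v, Ex.cost_v, Ex.depth_v,
    Ex.eval_v, hx]
  refine ⟨by omega, by omega, trivial, by omega, ?_⟩
  refine Cmd.wp_for (d + 1) 50 (fun j s' => s'.var 52 = x / n ^ j ∧ Frame 51 [aTree] s s' ∧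
    ∀ l ≤ d, ∀ q < n ^ d, s'.arr aTree (l * n ^ d + q) =
      #{y ∈ P | y / n ^ l = q} - if l < j ∧ q = x / n ^ l then 1 else 0)
    (by norm_num) trivial (by omega) ?_ ?_ ?_ ?_ ?_
  · refine ⟨by simp, (Frame.refl.setVar _ (by norm_num)).setVar _ (by norm_num), ?_⟩
    intro l hl q hq
    simpa using ht.count l hl q hq
  · intro j s' _ _
    exact ⟨show d + 1 < W by omega, rfl⟩
  · simp only [Cmd.forCost, Ex.cost_lit, Ex.depth_lit]
    omega
  · rintro j s' hj ⟨h52, hf, hI⟩ h51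
    have henv := hs.frame hf (by norm_num)
    have haddr := hW.mul_add_lt (Nat.lt_succ_iff.1 hj) (hdiv j) (c := 0) (by norm_num)
    have hval := hI j (Nat.lt_succ_iff.1 hj) _ (hdiv j)
    rw [if_neg (by simp)] at hval
    simp only [Cmd.wp_seq, Cmd.wp_wr, Cmd.wp_asg, Tst.fits_lt, Tst.ok_lt, Tst.cost_lt]
    simp [h51, h52, henv.order, henv.tuples, hval]
    refine ⟨by omega, by rw [pow_succ, Nat.div_div_eq_div_mul], ?_, ?_⟩
    · exact ((hf.setArr _ _ (by simp)).setVar _ (by norm_num)).setVar _ (by norm_num)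
    · intro l hl q hq
      by_cases hlq : l * n ^ d + q = j * n ^ d + x / n ^ j
      · obtain ⟨rfl, rfl⟩ := eq_of_mul_add_eq hq (hdiv j) hlq
        simp
      · rw [if_neg hlq, hI l hl q hq]
        congr 1
        have : l = j → q ≠ x / n ^ l := by
          rintro rfl rfl
          exact hlq rfl
        by_cases h2 : q = x / n ^ l
        · have : l ≠ j := fun h => this h h2
          simp only [h2, and_true]
          congr 1
          simp only [eq_iff_iff]
          omega
        · simp [h2]
  · rintro r s' ⟨h52, hf, hI⟩ h51 -
    refine ⟨⟨fun y hy => ht.lt y (mem_of_mem_erase hy), fun l hl q hq => ?_⟩, hf⟩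
    rw [hI l hl q hq, hcard]
    simp [Nat.lt_succ_of_le hl]

theorem wp_treeMin (hW : Params W n d) (hs : Env n d s) (ht : TreeRep n d s P) {m : ℕ}
    (hm : m ∈ P) (hmin : ∀ x ∈ P, m ≤ x) :
    (treeMin d).wp W (fun _ s' => s'.var 52 = m ∧ Frame 51 [] s s') ((d + 1) * (80 * (n + 1))) s := by
  have hword := hW.word
  have hxM := ht.lt m hm
  have hdiv : ∀ l, m / n ^ l < n ^ d := fun l => (Nat.div_le_self _ _).trans_lt hxM
  have hd : 2 ≤ d := hW.dim
  have hMle : n ^ d ≤ (d + 4) * n ^ d := Nat.le_mul_of_pos_left _ (by omega)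
  have hbudget : (d + 1) * (80 * (n + 1)) = d * (80 * (n + 1)) + 80 * (n + 1) := Nat.succ_mul _ _
  have hbudget' : d * (30 * n + 40 + (1 + 1 + 15)) ≤ d * (80 * (n + 1)) := Nat.mul_le_mul_left _ (by omega)
  simp only [treeMin, Cmd.wp_seq, Cmd.wp_asg, Ex.fits_lit, Ex.ok_lit, Ex.cost_lit, Ex.depth_lit,
    Ex.eval_lit]
  refine ⟨by omega, trivial, by omega, by omega, ?_⟩
  refine Cmd.wp_for d (30 * n + 40) (fun j s' => s'.var 52 = m / n ^ (d - j) ∧ Frame 51 [] s s')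
    (by norm_num) trivial (by omega) ?_ ?_ ?_ ?_ ?_
  · refine ⟨?_, (Frame.refl.setVar _ (by norm_num)).setVar _ (by norm_num)⟩
    simp [Nat.div_eq_of_lt hxM]
  · intro j s' _ _
    exact ⟨show d < W by omega, rfl⟩
  · simp only [Cmd.forCost, Ex.cost_lit, Ex.depth_lit]
    omega
  · rintro j s' hj ⟨h52, hf⟩ h51
    have henv := hs.frame hf (by norm_num)
    obtain ⟨l, hl⟩ : ∃ l, d - j = l + 1 := ⟨d - j - 1, by omega⟩
    have hl' : d - 1 - j = l := by omega
    have hld : l ≤ d := by omega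
    have hq1 : n * (m / n ^ (l + 1)) ≤ m / n ^ l := by
      rw [pow_succ, ← Nat.div_div_eq_div_mul]
      exact Nat.mul_div_le _ _
    have hq2 : m / n ^ l < n * (m / n ^ (l + 1)) + n := by
      rw [pow_succ, ← Nat.div_div_eq_div_mul]
      exact Nat.lt_mul_div_succ _ hW.pos
    rw [hl] at h52
    have hlM := hdiv l
    have hnM : n * (m / n ^ (l + 1)) < W := by omega
    have htree : s'.arr aTree = s.arr aTree := hf.2 _ (by simp)
    simp only [Cmd.wp_seq, Cmd.wp_asg]
    simp [h52, henv.order, hnM]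
    refine ⟨by simp, fun r s1 => ∃ q, s1.var 52 = q ∧
      n * (m / n ^ (l + 1)) ≤ q ∧ q ≤ m / n ^ l ∧ 30 * (m / n ^ l - q) + 20 ≤ r ∧ s1.var 51 = j ∧
      Frame 51 [] s s1, ⟨_, rfl, ?_⟩, ?_⟩
    · simp [h51]
      exact ⟨hq1, by omega, hf.setVar _ (by norm_num)⟩
    · rintro r s1 ⟨q, rfl, hq3, hq4, hr, hs51, hf1⟩
      have henv1 := hs.frame hf1 (by norm_num)
      have htree1 : s1.arr aTree = s.arr aTree := hf1.2 _ (by simp)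
      have haddr := hW.mul_add_lt hld (show s1.var 52 < n ^ d by omega) (c := 0) (by norm_num)
      have hcount := ht.count l hld (s1.var 52) (by omega)
      simp only [Tst.ok_lt, Tst.cost_lt, Tst.holds_lt, Cmd.wp_asg]
      simp [hs51, hl', henv1.tuples, htree1, hcount]
      have hlast : s1.var 52 < m / n ^ l ∨ s1.var 52 = m / n ^ l := by omega
      refine ⟨by omega, by omega, fun hzero => ?_, fun w hw hdivw => ?_⟩
      · have hlt : s1.var 52 < m / n ^ l := by
          rcases hlast with h | h
          · exact h
          · exact absurd h.symm (hzero hm)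
        refine ⟨by omega, by omega, by omega, by omega, by omega, ?_⟩
        exact hf1.setVar _ (by norm_num)
      · have : m / n ^ l ≤ w / n ^ l := Nat.div_le_div_right (hmin w hw)
        refine ⟨?_, hf1.setVar _ (by norm_num)⟩
        have : d - (j + 1) = l := by omega
        rw [this]
        omega
  · rintro r s' ⟨h52, hf⟩ h51 -
    exact ⟨by simpa using h52, hf⟩

end
end RAM

namespace RAM

open Finset Refinement Classical

/-! ### The variables and arrays of the algorithm -/

local notation:max "vN" => 0
local notation:max "vM" => 1
local notation:max "vLen" => 40
local notation:max "aCls" => 2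
local notation:max "aEl" => 3
local notation:max "aPos" => 4
local notation:max "aSize" => 5
local notation:max "aList" => 6
local notation:max "aOld" => 7
local notation:max "aHit" => 8
local notation:max "aMov" => 9
local notation:max "aTree" => 10
local notation:max "aSpl" => 11
local notation:max "aCnt" => 12
local notation:max "aPow" => 13
local notation:max "aType" => 14
local notation:max "aMark" => 15
local notation:max "aOrd" => 16
local notation:max "aColNew" => 17
local notation:max "aAdjNew" => 18

/-! ### Splitting the classes of a partition -/

/-- The number that represents a tuple. -/
def code {d n : ℕ} (u : Fin d → Fin n) : ℕ := finFunctionFinEquiv u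

section
variable {d n : ℕ}

theorem code_lt (u : Fin d → Fin n) : code u < n ^ d := (finFunctionFinEquiv u).2

theorem code_inj {u w : Fin d → Fin n} : code u = code w ↔ u = w := by
  rw [code, code, Fin.val_inj, finFunctionFinEquiv.injective.eq_iff]

theorem exists_code {p : ℕ} (hp : p < n ^ d) : ∃ u : Fin d → Fin n, code u = p :=
  ⟨finFunctionFinEquiv.symm ⟨p, hp⟩, by simp [code]⟩

theorem code_eq_sum (u : Fin d → Fin n) : code u = ∑ j, (u j : ℕ) * n ^ (j : ℕ) :=
  finFunctionFinEquiv_apply u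

theorem card_tuples : Fintype.card (Fin d → Fin n) = n ^ d := by simp

/-- The arrays represent the ordered partition `c`: the class of a tuple, the sizes of the classes,
and a list of the tuples in which the classes are intervals. -/
structure PartRep (s : Store) (c : (Fin d → Fin n) → ℕ) : Prop where
  cls : ∀ u, s.arr aCls (code u) = c u
  size : ∀ u, s.arr aSize (c u) = size c (c u)
  el : ∀ u : Fin d → Fin n, s.arr aEl (s.arr aPos (code u)) = code u
  le_pos : ∀ u, c u ≤ s.arr aPos (code u)
  pos_lt : ∀ u, s.arr aPos (code u) < c u + Refinement.size c (c u)

/-- Variable `vLen` and the array `aList` hold the list `a 0, …, a (N - 1)`. -/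
structure ListRep (s : Store) (N : ℕ) (a : ℕ → Fin d → Fin n) : Prop where
  len : s.var vLen = N
  entry : ∀ i < N, s.arr aList i = code (a i)
  inj : ∀ i < N, ∀ j < N, a i = a j → i = j

theorem ListRep.le {s : Store} {N : ℕ} {a : ℕ → Fin d → Fin n} (h : ListRep s N a) : N ≤ n ^ d := by
  have : #(range N) ≤ Fintype.card (Fin d → Fin n) :=
    card_le_card_of_injOn a (fun _ _ => mem_univ _) fun i hi j hj hij => by
      simp only [coe_range, Set.mem_Iio] at hi hj
      exact h.inj i hi j hj hij
  rwa [card_range, card_tuples] at this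

/-- The number of entries of the list before position `i` that belong to class `x`. -/
def hitUpTo (c : (Fin d → Fin n) → ℕ) (a : ℕ → Fin d → Fin n) (i x : ℕ) : ℕ :=
  #{j ∈ range i | c (a j) = x}

theorem hitUpTo_zero (c : (Fin d → Fin n) → ℕ) (a : ℕ → Fin d → Fin n) (x : ℕ) :
    hitUpTo c a 0 x = 0 := by simp [hitUpTo]

theorem hitUpTo_succ (c : (Fin d → Fin n) → ℕ) (a : ℕ → Fin d → Fin n) (i x : ℕ) :
    hitUpTo c a (i + 1) x = hitUpTo c a i x + if x = c (a i) then 1 else 0 := by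
  rw [hitUpTo, range_add_one, filter_insert]
  split_ifs with h1 h2 h3
  · rw [card_insert_of_notMem (by simp)]
    rfl
  · exact absurd h1.symm h2
  · exact absurd h3.symm h1
  · rfl

theorem hitUpTo_le (c : (Fin d → Fin n) → ℕ) (a : ℕ → Fin d → Fin n) (i x : ℕ) :
    hitUpTo c a i x ≤ i := (card_filter_le _ _).trans (card_range i).le

theorem hitUpTo_mono (c : (Fin d → Fin n) → ℕ) (a : ℕ → Fin d → Fin n) {i j : ℕ} (h : i ≤ j) (x : ℕ) :
    hitUpTo c a i x ≤ hitUpTo c a j x :=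
  card_le_card (filter_subset_filter _ (range_mono h))

/-- The set of the entries of a list. -/
def listSet (N : ℕ) (a : ℕ → Fin d → Fin n) : Set (Fin d → Fin n) := {u | ∃ i < N, a i = u}

theorem ListRep.hitUpTo_eq {s : Store} {N : ℕ} {a : ℕ → Fin d → Fin n} (h : ListRep s N a)
    (c : (Fin d → Fin n) → ℕ) (x : ℕ) : hitUpTo c a N x = hit c (listSet N a) x := by
  refine card_bij (fun i _ => a i) (fun i hi => ?_) (fun i hi j hj hij => ?_) fun u hu => ?_
  · simp only [mem_filter, mem_range, mem_univ, true_and] at hi ⊢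
    exact ⟨hi.2, i, hi.1, rfl⟩
  · simp only [mem_filter, mem_range] at hi hj
    exact h.inj i hi.1 j hj.1 hij
  · simp only [mem_filter, mem_univ, true_and] at hu
    obtain ⟨hu, i, hi, rfl⟩ := hu
    exact ⟨i, by simp [hi, hu], rfl⟩

/-- Record the classes of the entries of the list, and count the entries of each class. -/
def countHits : Cmd :=
  .for' 41 (.v vLen) (.seq
    (.wr aOld (.v 41) (.get aCls (.get aList (.v 41))))
    (.wr aHit (.get aOld (.v 41)) (.get aHit (.get aOld (.v 41)) + .lit 1)))

/-- Move the entries of the list to the ends of their classes, and give them a new class. -/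
def moveHits : Cmd :=
  .for' 41 (.v vLen) (.seq (.asg 42 (.get aList (.v 41))) (.seq (.asg 43 (.get aOld (.v 41)))
    (.ite (.lt (.get aHit (.v 43)) (.get aSize (.v 43)))
      (.seq (.asg 44 (.v 43 + .get aSize (.v 43) - .lit 1 - .get aMov (.v 43)))
      (.seq (.wr aMov (.v 43) (.get aMov (.v 43) + .lit 1))
      (.seq (.asg 45 (.get aEl (.v 44)))
      (.seq (.asg 46 (.get aPos (.v 42)))
      (.seq (.wr aEl (.v 44) (.v 42))
      (.seq (.wr aPos (.v 42) (.v 44))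
      (.seq (.wr aEl (.v 46) (.v 45))
      (.seq (.wr aPos (.v 45) (.v 46))
      (.wr aCls (.v 42) (.v 43 + (.get aSize (.v 43) - .get aHit (.v 43))))))))))))
      .skip)))

variable {W : ℕ} {s : Store} {N : ℕ} {a : ℕ → Fin d → Fin n} {c : (Fin d → Fin n) → ℕ}

theorem wp_countHits (hW : Params W n d) (hl : ListRep s N a)
    (hc : ∀ u, s.arr aCls (code u) = c u) (hz : ∀ x, s.arr aHit x = 0) :
    countHits.wp W (fun _ s' => (∀ i < N, s'.arr aOld i = c (a i)) ∧
      (∀ x, s'.arr aHit x = hitUpTo c a N x) ∧ Frame 41 [aOld, aHit] s s') (100 * (N + 1)) s := by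
  have hword := hW.word
  have hMle : n ^ d ≤ (d + 4) * n ^ d := Nat.le_mul_of_pos_left _ (by omega)
  have hN := hl.le
  refine Cmd.wp_for N 60 (fun j s' => (∀ i < j, s'.arr aOld i = c (a i)) ∧
    (∀ x, s'.arr aHit x = hitUpTo c a j x) ∧ Frame 41 [aOld, aHit] s s')
    (by norm_num) (by simp) (by omega) ?_ ?_ ?_ ?_ ?_
  · refine ⟨by simp, by simpa [hitUpTo_zero] using hz, Frame.refl.setVar _ le_rfl⟩
  · rintro j s' ⟨-, -, hf⟩ -
    exact ⟨trivial, (hf.1 _ (by norm_num)).trans hl.len⟩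
  · simp only [Cmd.forCost, Ex.cost_v, Ex.depth_v]
    omega
  · rintro j s' hj ⟨h1, h2, hf⟩ h41
    have e1 : s'.arr aList j = code (a j) := by rw [hf.2 _ (by simp), hl.entry j hj]
    have e2 : s'.arr aCls (code (a j)) = c (a j) := by rw [hf.2 _ (by simp), hc]
    have := hitUpTo_le c a j (c (a j))
    simp [h41, e1, e2, h2]
    refine ⟨by omega, fun i hi => ?_, fun x => ?_, ?_⟩
    · split_ifs with h
      · rw [h]
      · exact h1 i (by omega)
    · rw [hitUpTo_succ]
      split_ifs with h
      · rw [h]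
      · rfl
    · exact ((hf.setArr _ _ (by simp)).setArr _ _ (by simp)).setVar _ (by norm_num)
  · rintro r s' h - -
    exact h

theorem exists_pos (hr : Ranked c) (hel : ∀ u : Fin d → Fin n, s.arr aEl (s.arr aPos (code u)) = code u)
    (hlt : ∀ u, s.arr aPos (code u) < c u + size c (c u)) {p : ℕ} (hp : p < n ^ d) :
    ∃ u : Fin d → Fin n, s.arr aPos (code u) = p ∧ s.arr aEl p = code u := by
  have hlt : ∀ u : Fin d → Fin n, s.arr aPos (code u) < n ^ d := fun u => by
    have h1 := hr.add_size_le_card u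
    have h2 := hlt u
    rw [card_tuples] at h1
    omega
  let f : (Fin d → Fin n) → Fin (n ^ d) := fun u => ⟨_, hlt u⟩
  have hf : Function.Injective f := fun u w huw => by
    have : s.arr aPos (code u) = s.arr aPos (code w) := congrArg Fin.val huw
    rw [← code_inj, ← hel u, ← hel w, this]
  have hb : Function.Bijective f := (Fintype.bijective_iff_injective_and_card f).2
    ⟨hf, by rw [card_tuples, Fintype.card_fin]⟩
  obtain ⟨u, hu⟩ := hb.2 ⟨p, hp⟩
  have hu' : s.arr aPos (code u) = p := congrArg Fin.val hu
  exact ⟨u, hu', hu' ▸ hel u⟩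

/-- The situation after the first `j` entries of the list have been moved. -/
structure Moved (s : Store) (c : (Fin d → Fin n) → ℕ) (A : Set (Fin d → Fin n)) (a : ℕ → Fin d → Fin n)
    (j : ℕ) : Prop where
  mov : ∀ x, s.arr aMov x = if 0 < rest c A x then hitUpTo c a j x else 0
  cls : ∀ u, s.arr aCls (code u) =
    if u ∈ listSet j a ∧ 0 < rest c A (c u) then c u + rest c A (c u) else c u
  el : ∀ u : Fin d → Fin n, s.arr aEl (s.arr aPos (code u)) = code u
  le_pos : ∀ u, c u ≤ s.arr aPos (code u)
  pos_lt : ∀ u, s.arr aPos (code u) < c u + size c (c u)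
  moved : ∀ u, u ∈ listSet j a → 0 < rest c A (c u) →
    c u + size c (c u) ≤ s.arr aPos (code u) + s.arr aMov (c u)
  unmoved : ∀ u, ¬ (u ∈ listSet j a ∧ 0 < rest c A (c u)) →
    s.arr aPos (code u) + s.arr aMov (c u) < c u + size c (c u)

theorem mem_listSet_succ {j : ℕ} {u : Fin d → Fin n} :
    u ∈ listSet (j + 1) a ↔ u ∈ listSet j a ∨ u = a j := by
  simp only [listSet, Set.mem_ofPred_eq, Nat.lt_succ_iff_lt_or_eq]
  constructor
  · rintro ⟨i, hi | rfl, rfl⟩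
    · exact Or.inl ⟨i, hi, rfl⟩
    · exact Or.inr rfl
  · rintro (⟨i, hi, rfl⟩ | rfl)
    · exact ⟨i, Or.inl hi, rfl⟩
    · exact ⟨j, Or.inr rfl, rfl⟩

theorem ListRep.notMem {s : Store} (h : ListRep s N a) {j : ℕ} (hj : j < N) : a j ∉ listSet j a := by
  rintro ⟨i, hi, hij⟩
  have := h.inj i (by omega) j hj hij
  omega

theorem Moved.step {s s' : Store} {A : Set (Fin d → Fin n)} {j x t : ℕ} {y z : Fin d → Fin n}
    (hm : Moved s c A a j) (hl : ∃ s₀, ListRep s₀ N a) (hj : j < N) (hy : y = a j)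
    (hrest : 0 < rest c A x)
    (hcy : c y = x) (hcz : c z = x) (hz : s.arr aPos (code z) = t)
    (ht : t + s.arr aMov x + 1 = x + size c x)
    (hmov : ∀ x', s'.arr aMov x' = if x' = x then s.arr aMov x + 1 else s.arr aMov x')
    (hcls : ∀ w, s'.arr aCls w = if w = code y then x + rest c A x else s.arr aCls w)
    (hel : ∀ p, s'.arr aEl p = if p = s.arr aPos (code y) then code z else
      if p = t then code y else s.arr aEl p)
    (hpos : ∀ w, s'.arr aPos w = if w = code z then s.arr aPos (code y) else
      if w = code y then t else s.arr aPos w) :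
    Moved s' c A a (j + 1) := by
  obtain ⟨s₀, hl⟩ := hl
  have hy' : y ∉ listSet j a := hy ▸ hl.notMem hj
  have hpinj : ∀ u w : Fin d → Fin n, s.arr aPos (code u) = s.arr aPos (code w) → u = w := by
    intro u w h
    rw [← code_inj, ← hm.el u, ← hm.el w, h]
  have hpy := hm.unmoved y fun h => hy' h.1
  have hpy' := hm.le_pos y
  have hpy'' := hm.pos_lt y
  have hpz' := hm.le_pos z
  have hpz'' := hm.pos_lt z
  have hzu : z ∉ listSet j a := fun h => by
    have := hm.moved z h (hcz ▸ hrest)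
    rw [hcz] at this
    omega
  rw [hcy] at hpy hpy' hpy''
  rw [hcz] at hpz' hpz''
  refine ⟨fun x' => ?_, fun u => ?_, fun u => ?_, fun u => ?_, fun u => ?_, fun u hu hu' => ?_,
    fun u hu => ?_⟩
  · rw [hmov, hitUpTo_succ, ← hy, hcy]
    have h1 := hm.mov x
    rw [if_pos hrest] at h1
    by_cases h2 : x' = x
    · subst h2; simp [h1, hrest]
    · simp [h2, hm.mov]
  · simp only [hcls, code_inj, mem_listSet_succ, ← hy]
    split_ifs with h1 h2 h2
    · rw [h1, hcy]
    · subst h1; exact absurd ⟨Or.inr rfl, hcy ▸ hrest⟩ h2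
    · rw [hm.cls, if_pos ⟨h2.1.resolve_right h1, h2.2⟩]
    · rw [hm.cls, if_neg fun h => h2 ⟨Or.inl h.1, h.2⟩]
  · simp only [hpos, code_inj]
    split_ifs with h1 h2
    · rw [hel, if_pos rfl, h1]
    · rw [hel, if_neg, if_pos rfl, h2]
      intro h
      exact h1 (h2.trans (hpinj y z (h.symm.trans hz.symm)))
    · rw [hel, if_neg, if_neg, hm.el]
      · intro h
        exact h1 (hpinj u z (h.trans hz.symm))
      · intro h
        exact h2 (hpinj u y h)
  · simp only [hpos, code_inj]
    split_ifs with h1 h2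
    · rw [h1, hcz]; exact hpy'
    · rw [h2, hcy]; omega
    · exact hm.le_pos u
  · simp only [hpos, code_inj]
    split_ifs with h1 h2
    · rw [h1, hcz]; exact hpy''
    · rw [h2, hcy]; omega
    · exact hm.pos_lt u
  · rw [mem_listSet_succ, ← hy] at hu
    simp only [hpos, code_inj, hmov]
    by_cases huy : u = y
    · subst huy
      simp only [hcy, if_true]
      split_ifs with h1
      · rw [← h1] at hz
        omega
      · omega
    · have hu1 := hu.resolve_right huy
      have := hm.moved u hu1 hu'
      rw [if_neg (show ¬ u = z from fun h => hzu (h ▸ hu1)), if_neg huy]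
      split_ifs with h1
      · rw [h1] at this ⊢; omega
      · exact this
  · rw [mem_listSet_succ, ← hy] at hu
    have huy : u ≠ y := by
      rintro rfl
      exact hu ⟨Or.inr rfl, hcy ▸ hrest⟩
    have := hm.unmoved u fun h => hu ⟨Or.inl h.1, h.2⟩
    simp only [hpos, code_inj, hmov, huy, if_false]
    split_ifs with h1 h2 h2
    · rw [h2]
      have h3 : s.arr aPos (code y) ≠ t := fun h => huy (h1.trans (hpinj y z (h.trans hz.symm)).symm)
      omega
    · exact absurd (h1 ▸ hcz) h2
    · have h3 : s.arr aPos (code u) ≠ t := fun h => h1 (hpinj u z (h.trans hz.symm))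
      rw [h2] at this ⊢
      omega
    · exact this

theorem wp_moveHits (hW : Params W n d) (hr : Ranked c) (hl : ListRep s N a) (hp : PartRep s c)
    (hold : ∀ i < N, s.arr aOld i = c (a i)) (hhit : ∀ x, s.arr aHit x = hitUpTo c a N x)
    (hz : ∀ x, s.arr aMov x = 0) :
    moveHits.wp W (fun _ s' => Moved s' c (listSet N a) a N ∧
      Frame 41 [aCls, aEl, aPos, aMov] s s') (300 * (N + 1)) s := by
  have hword := hW.word
  have hMle : n ^ d ≤ (d + 4) * n ^ d := Nat.le_mul_of_pos_left _ (by omega)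
  have hN := hl.le
  set A := listSet N a with hA
  refine Cmd.wp_for N 250 (fun j s' => Moved s' c A a j ∧ Frame 41 [aCls, aEl, aPos, aMov] s s')
    (by norm_num) (by simp) (by omega) ?_ ?_ ?_ ?_ ?_
  · refine ⟨⟨?_, ?_, hp.el, hp.le_pos, hp.pos_lt, ?_, ?_⟩, Frame.refl.setVar _ le_rfl⟩
    · simpa [hitUpTo_zero] using hz
    · simpa [listSet] using hp.cls
    · simp [listSet]
    · simpa [hz] using fun u _ => hp.pos_lt u
  · rintro j s' ⟨-, hf⟩ -
    exact ⟨trivial, (hf.1 _ (by norm_num)).trans hl.len⟩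
  · simp only [Cmd.forCost, Ex.cost_v, Ex.depth_v]
    omega
  · rintro j s' hj ⟨hm, hf⟩ h41
    have e1 : s'.arr aList j = code (a j) := by rw [hf.2 _ (by simp), hl.entry j hj]
    have e2 : s'.arr aOld j = c (a j) := by rw [hf.2 _ (by simp), hold j hj]
    have e3 : s'.arr aHit (c (a j)) = hit c A (c (a j)) := by
      rw [hf.2 _ (by simp), hhit, hl.hitUpTo_eq]
    have e4 : s'.arr aSize (c (a j)) = size c (c (a j)) := by rw [hf.2 _ (by simp), hp.size]
    have hsum := hit_add_rest c A (c (a j))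
    have haj := hl.notMem hj
    have hajA : a j ∈ A := ⟨j, hj, rfl⟩
    have hle := hr.add_size_le_card (a j)
    rw [card_tuples] at hle
    simp only [Cmd.wp_seq, Cmd.wp_asg, Cmd.wp_ite]
    by_cases hrest : 0 < rest c A (c (a j))
    · set y := a j with hy
      set x := c y with hx
      set t := x + size c x - 1 - s'.arr aMov x with ht
      have hpy := hm.unmoved y (fun h => haj h.1)
      have hmov : s'.arr aMov x = hitUpTo c a j x := by rw [hm.mov, if_pos hrest]
      have hxy : c y = x := rfl
      rw [hxy] at hpy
      have htM : t < n ^ d := by omega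
      obtain ⟨z, hz1, hz2⟩ : ∃ u, s'.arr aPos (code u) = t ∧ s'.arr aEl t = code u :=
        exists_pos hr hm.el hm.pos_lt htM
      have hcz : c z = x := by
        refine hr.eq_of_mem (q := t) ?_ ?_ ?_ ?_
        · rw [← hz1]; exact hm.le_pos z
        · rw [← hz1]; exact hm.pos_lt z
        · have := hm.le_pos y
          rw [hxy] at this ⊢
          omega
        · rw [hxy]
          omega
      have hlt : hit c A x < size c x := by omega
      simp [h41, e1, e2, e3, e4, hlt]
      refine ⟨⟨by omega, by omega⟩, ⟨by omega, by omega⟩, by omega, ?_, ?_⟩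
      · refine hm.step (t := t) (y := y) ⟨s, hl⟩ hj hy hrest hxy hcz hz1 (by omega) (fun x' => ?_) (fun w => ?_)
          (fun p => ?_) (fun w => ?_)
        · simp
        · simp only [Store.arr_setVar]
          simp [show size c x - hit c A x = rest c A x by omega]
        · simp [← ht, hz2]
        · simp [← ht, hz2]
      · refine Frame.setVar (Frame.setArr (Frame.setArr (Frame.setArr (Frame.setArr (Frame.setArr
          (Frame.setVar (Frame.setVar (Frame.setArr (Frame.setVar (Frame.setVar (Frame.setVar hf
          _ ?_) _ ?_) _ ?_) _ _ ?_) _ ?_) _ ?_) _ _ ?_) _ _ ?_) _ _ ?_) _ _ ?_) _ _ ?_) _ ?_ <;> simp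
    · have hrest : rest c A (c (a j)) = 0 := by omega
      simp [h41, e1, e2, e3, e4, show ¬ hit c A (c (a j)) < size c (c (a j)) by omega]
      refine ⟨⟨fun x => ?_, fun u => ?_, hm.el, hm.le_pos, hm.pos_lt, fun u hu hu' => ?_,
        fun u hu => ?_⟩, ((hf.setVar _ ?_).setVar _ ?_).setVar _ ?_⟩
      · refine (hm.mov x).trans ?_
        rw [hitUpTo_succ]
        by_cases hx : x = c (a j)
        · subst hx; simp [hrest]
        · simp [hx]
      · refine (hm.cls u).trans ?_
        rw [mem_listSet_succ]
        by_cases hu : u = a j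
        · subst hu; simp [hrest]
        · simp [hu]
      · rcases mem_listSet_succ.1 hu with hu | rfl
        · exact hm.moved u hu hu'
        · omega
      · exact hm.unmoved u fun h => hu ⟨mem_listSet_succ.2 (Or.inl h.1), h.2⟩
      all_goals simp
  · rintro r s' h - -
    exact h

end

section
variable {W d n : ℕ} {s : Store} {N : ℕ} {a : ℕ → Fin d → Fin n} {σ : St (Fin d → Fin n)}
  {A : Set (Fin d → Fin n)}

/-- The names of the pending classes. -/
noncomputable def ids (σ : St (Fin d → Fin n)) : Finset ℕ := ({u | σ.p u} : Finset _).image σ.c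

theorem mem_ids {x : ℕ} : x ∈ ids σ ↔ ∃ u, σ.p u ∧ σ.c u = x := by simp [ids]

theorem mem_ids_iff (hσ : Inv σ) (u : Fin d → Fin n) : σ.c u ∈ ids σ ↔ σ.p u := by
  rw [mem_ids]
  exact ⟨fun ⟨w, hw, h⟩ => hσ.pend w u h hw, fun h => ⟨u, h, rfl⟩⟩

/-- The class that becomes pending when class `x` is split. -/
noncomputable def newId (σ : St (Fin d → Fin n)) (A : Set (Fin d → Fin n)) (x : ℕ) : ℕ :=
  if x ∈ ids σ ∨ hit σ.c A x ≤ rest σ.c A x then x + rest σ.c A x else x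

/-- The pending classes after the classes of the first `j` entries of the list have been split. -/
noncomputable def pendUpTo (σ : St (Fin d → Fin n)) (A : Set (Fin d → Fin n))
    (a : ℕ → Fin d → Fin n) (j : ℕ) : Finset ℕ :=
  ids σ ∪ ({i ∈ range j | 0 < rest σ.c A (σ.c (a i))} : Finset ℕ).image
    fun i => newId σ A (σ.c (a i))

theorem pendUpTo_succ (j : ℕ) : pendUpTo σ A a (j + 1) =
    if 0 < rest σ.c A (σ.c (a j)) then insert (newId σ A (σ.c (a j))) (pendUpTo σ A a j)
    else pendUpTo σ A a j := by
  rw [pendUpTo, range_add_one, filter_insert]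
  split_ifs with h
  · rw [image_insert, union_insert]
    rfl
  · rfl

theorem mem_pendUpTo {j x : ℕ} : x ∈ pendUpTo σ A a j ↔
    x ∈ ids σ ∨ ∃ i < j, 0 < rest σ.c A (σ.c (a i)) ∧ newId σ A (σ.c (a i)) = x := by
  simp [pendUpTo, and_assoc]

theorem le_newId (x : ℕ) : x ≤ newId σ A x := by
  rw [newId]; split_ifs <;> omega

theorem newId_lt {u : Fin d → Fin n} (h : 0 < hit σ.c A (σ.c u)) :
    newId σ A (σ.c u) < σ.c u + size σ.c (σ.c u) := by
  have := hit_add_rest σ.c A (σ.c u)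
  rw [newId]; split_ifs <;> omega

theorem newId_notMem (hσ : Inv σ) {u : Fin d → Fin n} (h : 0 < hit σ.c A (σ.c u))
    (h' : 0 < rest σ.c A (σ.c u)) : newId σ A (σ.c u) ∉ ids σ := by
  intro hm
  have hlt := newId_lt h
  rw [newId] at hm hlt
  split_ifs at hm hlt with h1
  · obtain ⟨w, hw, hwc⟩ := mem_ids.1 hm
    have := size_pos σ.c w
    have := hσ.ranked.eq_of_mem (u := u) (w := w) (q := σ.c w) (by omega) (by omega) le_rfl
      (by omega)
    omega
  · exact h1 (Or.inl hm)

theorem ids_split (hσ : Inv σ) : ids (split (listSet N a) σ) = pendUpTo σ (listSet N a) a N := by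
  set A := listSet N a with hA
  ext x
  rw [mem_pendUpTo, mem_ids]
  constructor
  · rintro ⟨u, hu, rfl⟩
    have hp : ∀ u, u ∈ A → ∃ i < N, a i = u := fun u h => h
    by_cases hpu : σ.p u
    · by_cases hr : u ∈ A ∧ 0 < rest σ.c A (σ.c u)
      · obtain ⟨i, hi, rfl⟩ := hp u hr.1
        exact Or.inr ⟨i, hi, hr.2, by
          rw [newId, if_pos (Or.inl ((mem_ids_iff hσ _).2 hpu)), split_c_of_mem hr.1]⟩
      · left
        have : (split A σ).c u = σ.c u := if_neg hr
        rw [this]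
        exact (mem_ids_iff hσ u).2 hpu
    · obtain ⟨h1, h2, h3⟩ := hu.resolve_left hpu
      obtain ⟨w, hw, hwA⟩ := exists_of_hit_pos h1
      obtain ⟨i, hi, rfl⟩ := hp w hwA
      refine Or.inr ⟨i, hi, by rwa [hw], ?_⟩
      have hids : σ.c u ∉ ids σ := fun h => hpu ((mem_ids_iff hσ u).1 h)
      rw [hw, newId]
      by_cases huA : u ∈ A
      · rw [if_pos (Or.inr (h3.2 huA)), split_c_of_mem huA]
      · rw [if_neg (by rw [h3]; tauto), split_c_of_notMem huA]
  · rintro (h | ⟨i, hi, h, rfl⟩)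
    · obtain ⟨u, hu, rfl⟩ := mem_ids.1 h
      rcases Nat.eq_zero_or_pos (rest σ.c A (σ.c u)) with h0 | h0
      · refine ⟨u, Or.inl hu, ?_⟩
        simp [split, h0]
      · obtain ⟨w, hw, hwA⟩ := exists_of_rest_pos h0
        exact ⟨w, Or.inl (hσ.pend u w hw.symm hu), by rw [split_c_of_notMem hwA, hw]⟩
    · have hiA : a i ∈ A := ⟨i, hi, rfl⟩
      rw [newId]
      split_ifs with h1
      · refine ⟨a i, ?_, split_c_of_mem hiA⟩
        rcases h1 with h1 | h1
        · exact Or.inl ((mem_ids_iff hσ _).1 h1)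
        · exact Or.inr ⟨hit_pos hiA, h, by simp [h1, hiA]⟩
      · obtain ⟨w, hw, hwA⟩ := exists_of_rest_pos h
        refine ⟨w, Or.inr ?_, by rw [split_c_of_notMem hwA, hw]⟩
        rw [hw]
        exact ⟨hit_pos hiA, h, by simp only [hwA, iff_false]; tauto⟩

/-- Update the sizes of the classes and the set of pending classes, and clear the counters. -/
def renewClasses (d : ℕ) : Cmd :=
  .seq (.for' 41 (.v vLen) (.seq (.asg 43 (.get aOld (.v 41)))
    (.ite (.lt (.lit 0) (.get aHit (.v 43)))
      (.seq (.ite (.lt (.get aHit (.v 43)) (.get aSize (.v 43)))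
          (.seq (.asg 44 (.v 43 + (.get aSize (.v 43) - .get aHit (.v 43))))
          (.seq (.wr aSize (.v 44) (.get aHit (.v 43)))
          (.seq (.wr aSize (.v 43) (.get aSize (.v 43) - .get aHit (.v 43)))
          (.seq (.ite (.lt (.lit 0) (.get aTree (.v 43))) (.asg 50 (.v 44))
            (.ite (.lt (.get aSize (.v 43)) (.get aSize (.v 44))) (.asg 50 (.v 43))
              (.asg 50 (.v 44))))
          (treeInsert d)))))
          .skip)
      (.seq (.wr aHit (.v 43) (.lit 0)) (.wr aMov (.v 43) (.lit 0))))
      .skip)))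
  (.asg vLen (.lit 0))

/-- Some of the first `j` entries of the list belong to the class `x`. -/
def Seen (c : (Fin d → Fin n) → ℕ) (a : ℕ → Fin d → Fin n) (j x : ℕ) : Prop := ∃ i < j, c (a i) = x

theorem seen_succ {c : (Fin d → Fin n) → ℕ} {j x : ℕ} :
    Seen c a (j + 1) x ↔ Seen c a j x ∨ x = c (a j) := by
  simp only [Seen, Nat.lt_succ_iff_lt_or_eq]
  constructor
  · rintro ⟨i, hi | rfl, rfl⟩
    · exact Or.inl ⟨i, hi, rfl⟩
    · exact Or.inr rfl
  · rintro (⟨i, hi, rfl⟩ | rfl)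
    · exact ⟨i, Or.inl hi, rfl⟩
    · exact ⟨j, Or.inr rfl, rfl⟩

/-- The situation after the classes of the first `j` entries of the list have been renewed. -/
structure Renewed (s s' : Store) (σ : St (Fin d → Fin n)) (A : Set (Fin d → Fin n))
    (a : ℕ → Fin d → Fin n) (j : ℕ) : Prop where
  tree : TreeRep n d s' (pendUpTo σ A a j)
  hit : ∀ x, s'.arr aHit x = if Seen σ.c a j x then 0 else hit σ.c A x
  mov : ∀ x, s'.arr aMov x = if Seen σ.c a j x then 0 else s.arr aMov x
  size : ∀ u, s'.arr aSize (σ.c u) =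
    if Seen σ.c a j (σ.c u) ∧ 0 < rest σ.c A (σ.c u) then rest σ.c A (σ.c u) else size σ.c (σ.c u)
  size' : ∀ u, Seen σ.c a j (σ.c u) → 0 < rest σ.c A (σ.c u) →
    s'.arr aSize (σ.c u + rest σ.c A (σ.c u)) = Refinement.hit σ.c A (σ.c u)

theorem wp_renewClasses (hW : Params W n d) (hs : Env n d s) (hσ : Inv σ) (hl : ListRep s N a)
    (ht : TreeRep n d s (ids σ)) (hold : ∀ i < N, s.arr aOld i = σ.c (a i))
    (hhit : ∀ x, s.arr aHit x = hit σ.c (listSet N a) x)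
    (hsize : ∀ u, s.arr aSize (σ.c u) = size σ.c (σ.c u)) :
    (renewClasses d).wp W (fun _ s' => Renewed s s' σ (listSet N a) a N ∧ s'.var vLen = 0 ∧
      Frame 40 [aSize, aHit, aMov, aTree] s s') ((80 * (d + 2) + 300) * (N + 1)) s := by
  have hword := hW.word
  have hMle : n ^ d ≤ (d + 4) * n ^ d := Nat.le_mul_of_pos_left _ (by omega)
  have hN := hl.le
  have hcM : ∀ u, σ.c u + size σ.c (σ.c u) ≤ n ^ d := fun u => by
    have := hσ.ranked.add_size_le_card u
    rwa [card_tuples] at this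
  set A := listSet N a with hA
  obtain ⟨K, hK⟩ : ∃ K, K = 80 * (d + 2) := ⟨_, rfl⟩
  have hbud : N * (K + 250 + 17) ≤ N * (K + 300) := Nat.mul_le_mul_left _ (by omega)
  have hbud' : (K + 300) * (N + 1) = N * (K + 300) + (K + 300) := by ring
  rw [← hK]
  rw [renewClasses, Cmd.wp_seq]
  refine Cmd.wp_for N (K + 250) (fun j s' => Renewed s s' σ A a j ∧
    Frame 41 [aSize, aHit, aMov, aTree] s s') (by norm_num) (by simp) (by omega) ?_ ?_ ?_ ?_ ?_
  · refine ⟨⟨?_, ?_, ?_, ?_, ?_⟩, Frame.refl.setVar _ le_rfl⟩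
    · have : pendUpTo σ A a 0 = ids σ := by simp [pendUpTo]
      rw [this]
      exact ht.congr rfl
    · simpa [Seen] using hhit
    · simp [Seen]
    · simpa [Seen] using hsize
    · simp [Seen]
  · rintro j s' ⟨-, hf⟩ -
    exact ⟨trivial, (hf.1 _ (by norm_num)).trans hl.len⟩
  · have h17 : Cmd.forCost (.v vLen) = 17 := rfl
    rw [h17, hbud']
    exact Nat.add_le_add hbud (by linarith)
  · rintro j s' hj ⟨hI, hf⟩ h41
    have henv := hs.frame hf (by norm_num)
    have hajA : a j ∈ A := ⟨j, hj, rfl⟩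
    have e1 : s'.arr aOld j = σ.c (a j) := by rw [hf.2 _ (by simp), hold j hj]
    have e2 := hI.hit (σ.c (a j))
    have e3 := hI.size (a j)
    have e4 : 0 < s'.arr aTree (σ.c (a j)) ↔ σ.c (a j) ∈ pendUpTo σ A a j :=
      hI.tree.mem_iff (by have := hcM (a j); have := size_pos σ.c (a j); omega)
    have hle := hcM (a j)
    have hsum := hit_add_rest σ.c A (σ.c (a j))
    have hpos := hit_pos (c := σ.c) hajA
    simp only [Cmd.wp_seq, Cmd.wp_asg, Cmd.wp_ite, Cmd.wp_wr]
    by_cases hseen : Seen σ.c a j (σ.c (a j))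
    · rw [if_pos hseen] at e2
      simp [h41, e1, e2]
      refine ⟨by omega, ⟨?_, ?_, ?_, ?_, ?_⟩, (hf.setVar _ ?_).setVar _ ?_⟩
      · refine TreeRep.congr (s := s') ?_ rfl
        rw [pendUpTo_succ]
        split_ifs with h0
        · obtain ⟨i, hi, hij⟩ := hseen
          rw [insert_eq_self.2]
          · exact hI.tree
          · exact mem_pendUpTo.2 (Or.inr ⟨i, hi, by rw [hij]; exact ⟨h0, rfl⟩⟩)
        · exact hI.tree
      · intro x
        refine (hI.hit x).trans ?_
        rw [seen_succ]
        by_cases hx : x = σ.c (a j)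
        · subst hx; simp [hseen]
        · simp [hx]
      · intro x
        refine (hI.mov x).trans ?_
        rw [seen_succ]
        by_cases hx : x = σ.c (a j)
        · subst hx; simp [hseen]
        · simp [hx]
      · intro u
        refine (hI.size u).trans ?_
        rw [seen_succ]
        by_cases hx : σ.c u = σ.c (a j)
        · simp [hx, hseen]
        · simp [hx]
      · intro u hu hu'
        rw [seen_succ] at hu
        refine hI.size' u (hu.elim id fun h => ?_) hu'
        rw [h]; exact hseen
      all_goals simp
    · rw [if_neg hseen] at e2
      rw [if_neg (fun h => hseen h.1)] at e3
      have hnot : ∀ x, x ∈ pendUpTo σ A a j → x ∉ ids σ → σ.c (a j) ≤ x →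
          x < σ.c (a j) + size σ.c (σ.c (a j)) → False := by
        intro x hx hx' h1 h2
        obtain ⟨i, hi, hi1, rfl⟩ := (mem_pendUpTo.1 hx).resolve_left hx'
        refine hseen ⟨i, hi, ?_⟩
        exact (hσ.ranked.eq_of_mem h1 h2 (le_newId _)
          (newId_lt (hit_pos (c := σ.c) ⟨i, by omega, rfl⟩))).symm
      by_cases hrest : 0 < rest σ.c A (σ.c (a j))
      · have hlt : hit σ.c A (σ.c (a j)) < size σ.c (σ.c (a j)) := by omega
        have hsub : size σ.c (σ.c (a j)) - hit σ.c A (σ.c (a j)) = rest σ.c A (σ.c (a j)) := by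
          omega
        have e5 : 0 < s'.arr aTree (σ.c (a j)) ↔ σ.c (a j) ∈ ids σ := by
          rw [e4]
          refine ⟨fun h => ?_, fun h => mem_pendUpTo.2 (Or.inl h)⟩
          by_contra h'
          exact hnot _ h h' le_rfl (by omega)
        have hstep : ∀ (r : ℕ) (s2 : Store), K + 20 ≤ r →
            s2.var 50 = newId σ A (σ.c (a j)) → s2.var 41 = j → s2.var 43 = σ.c (a j) →
            s2.arr aTree = s'.arr aTree → s2.arr aHit = s'.arr aHit →
            s2.arr aMov = s'.arr aMov →
            (∀ x, s2.arr aSize x = if x = σ.c (a j) then rest σ.c A (σ.c (a j)) else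
              if x = σ.c (a j) + rest σ.c A (σ.c (a j)) then hit σ.c A (σ.c (a j))
              else s'.arr aSize x) →
            Frame 41 [aSize, aHit, aMov, aTree] s s2 →
            (treeInsert d).wp W ((Cmd.seq (.wr aHit (.v 43) (.lit 0)) (.wr aMov (.v 43) (.lit 0))).wp W
              (fun _ s' => s'.var 41 = j ∧ Renewed s (s'.setVar 41 (j + 1)) σ A a (j + 1) ∧
                Frame 41 [aSize, aHit, aMov, aTree] s (s'.setVar 41 (j + 1)))) r s2 := by
          intro r s2 hr h50 h41 h43 htree hhit hmov hsz hf2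
          have h1 := newId_notMem hσ hpos hrest
          have h2 := newId_lt (A := A) hpos
          have h3 := le_newId (σ := σ) (A := A) (σ.c (a j))
          refine Cmd.wp_call _ (wp_treeInsert hW (hs.frame hf2 (by norm_num)) (hI.tree.congr htree)
            h50 (by omega) (fun h => hnot _ h h1 h3 h2)) (by omega) ?_
          rintro r1 r2 s3 hr12 ⟨ht3, hf3⟩
          have g41 : s3.var 41 = j := (hf3.1 _ (by norm_num)).trans h41
          have g43 : s3.var 43 = σ.c (a j) := (hf3.1 _ (by norm_num)).trans h43
          have gh : s3.arr aHit = s'.arr aHit := (hf3.2 _ (by simp)).trans hhit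
          have gm : s3.arr aMov = s'.arr aMov := (hf3.2 _ (by simp)).trans hmov
          have gs : s3.arr aSize = s2.arr aSize := hf3.2 _ (by simp)
          simp [g41, g43]
          refine ⟨by omega, by omega, by omega, by omega, ⟨?_, ?_, ?_, ?_, ?_⟩, ?_⟩
          · rw [pendUpTo_succ, if_pos hrest]
            exact ht3.congr rfl
          · intro x
            simp only [Store.arr_setVar]
            rw [Store.arr_setArr_of_ne _ _ _ (by norm_num), Store.arr_setArr_self, gh, hI.hit,
              seen_succ]
            by_cases hx : x = σ.c (a j) <;> simp [hx]
          · intro x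
            simp only [Store.arr_setVar]
            rw [Store.arr_setArr_self, Store.arr_setArr_of_ne _ _ _ (by norm_num), gm, hI.mov,
              seen_succ]
            by_cases hx : x = σ.c (a j) <;> simp [hx]
          · intro u
            simp only [Store.arr_setVar]
            rw [Store.arr_setArr_of_ne _ _ _ (by norm_num), Store.arr_setArr_of_ne _ _ _ (by norm_num),
              gs, hsz, seen_succ]
            by_cases hx : σ.c u = σ.c (a j)
            · simp [hx, hrest]
            · have : σ.c u ≠ σ.c (a j) + rest σ.c A (σ.c (a j)) := fun h => hx <| by
                have := size_pos σ.c u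
                exact (hσ.ranked.eq_of_mem (u := a j) (w := u) (q := σ.c u) (by omega) (by omega)
                  le_rfl (by omega)).symm
              simp only [hx, if_false, this, or_false]
              exact hI.size u
          · intro u hu hu'
            simp only [Store.arr_setVar]
            rw [Store.arr_setArr_of_ne _ _ _ (by norm_num), Store.arr_setArr_of_ne _ _ _ (by norm_num),
              gs, hsz]
            by_cases hx : σ.c u = σ.c (a j)
            · rw [hx, if_neg (by omega), if_pos rfl]
            · have hu2 := (seen_succ.1 hu).resolve_right hx
              have hup : 0 < hit σ.c A (σ.c u) := by
                obtain ⟨i, hi, hic⟩ := hu2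
                rw [← hic]
                exact hit_pos (c := σ.c) ⟨i, by omega, rfl⟩
              have hus := hit_add_rest σ.c A (σ.c u)
              rw [if_neg, if_neg]
              · exact hI.size' u hu2 hu'
              · intro h
                exact hx (hσ.ranked.eq_of_mem (u := u) (w := a j) (Nat.le_add_right _ (rest σ.c A (σ.c u)))
                  (by omega) (by omega) (by omega))
              · intro h
                exact hx (hσ.ranked.eq_of_mem (u := u) (w := a j) (Nat.le_add_right _ (rest σ.c A (σ.c u)))
                  (by omega) (by omega) (by omega))
          · have hf4 := hf2.trans (hf3.mono (Y := 41) (L' := [aSize, aHit, aMov, aTree])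
              (by norm_num) (by simp))
            exact ((hf4.setArr _ _ (by simp)).setArr _ _ (by simp)).setVar _ (by norm_num)
        simp [h41, e1, e2, e3, hpos, hlt, hsub, e5, hrest.ne']
        refine ⟨by omega, by omega, by omega, fun hp => ?_, fun hp => ⟨fun hc => ?_, fun hc => ?_⟩⟩
        all_goals
          refine hstep _ _ (by omega) ?_ ?_ ?_ ?_ ?_ ?_ ?_ ?_
        case refine_1.refine_1 => simp [newId, hp]
        case refine_2.refine_1 => simp [newId, hp, hc]
        case refine_3.refine_1 => simp [newId, hp, hc]
        all_goals first
          | exact ((((hf.setVar _ (by simp)).setVar _ (by simp)).setArr _ _ (by simp)).setArr _ _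
              (by simp)).setVar _ (by simp)
          | simp [h41]
      · have hrest : rest σ.c A (σ.c (a j)) = 0 := by omega
        have hnlt : ¬ hit σ.c A (σ.c (a j)) < size σ.c (σ.c (a j)) := by omega
        simp [h41, e1, e2, e3, hpos, hnlt]
        refine ⟨by omega, ⟨?_, ?_, ?_, ?_, ?_⟩, ?_⟩
        · rw [pendUpTo_succ, if_neg (by omega)]
          exact hI.tree.congr rfl
        · intro x
          simp only [Store.arr_setVar]
          rw [Store.arr_setArr_of_ne _ _ _ (by norm_num), Store.arr_setArr_self, Store.arr_setVar,
            hI.hit, seen_succ]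
          by_cases hx : x = σ.c (a j) <;> simp [hx]
        · intro x
          simp only [Store.arr_setVar]
          rw [Store.arr_setArr_self, Store.arr_setArr_of_ne _ _ _ (by norm_num), Store.arr_setVar,
            hI.mov, seen_succ]
          by_cases hx : x = σ.c (a j) <;> simp [hx]
        · intro u
          simp only [Store.arr_setVar]
          rw [Store.arr_setArr_of_ne _ _ _ (by norm_num), Store.arr_setArr_of_ne _ _ _ (by norm_num),
            Store.arr_setVar, hI.size u, seen_succ]
          by_cases hx : σ.c u = σ.c (a j)
          · simp [hx, hrest]
          · simp [hx]
        · intro u hu hu'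
          simp only [Store.arr_setVar]
          rw [Store.arr_setArr_of_ne _ _ _ (by norm_num), Store.arr_setArr_of_ne _ _ _ (by norm_num),
            Store.arr_setVar]
          refine hI.size' u ((seen_succ.1 hu).resolve_right fun h => ?_) hu'
          rw [h] at hu'
          omega
        · exact (((hf.setVar _ (by simp)).setArr _ _ (by simp)).setArr _ _ (by simp)).setVar _
            (by simp)
  · rintro r s' ⟨hI, hf⟩ h41 hr
    rw [show Cmd.forCost (.v vLen) = 17 from rfl, hbud'] at hr
    simp
    refine ⟨by omega, by omega, ⟨hI.tree.congr rfl, hI.hit, hI.mov, hI.size, hI.size'⟩, ?_⟩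
    exact (hf.mono (by norm_num) (by simp)).setVar _ le_rfl

theorem seen_iff (u : Fin d → Fin n) :
    Seen σ.c a N (σ.c u) ↔ 0 < hit σ.c (listSet N a) (σ.c u) := by
  constructor
  · rintro ⟨i, hi, h⟩
    rw [← h]
    exact hit_pos ⟨i, hi, rfl⟩
  · intro h
    obtain ⟨w, hw, i, hi, rfl⟩ := exists_of_hit_pos h
    exact ⟨i, hi, hw⟩

/-- The store represents the partition `σ` with its pending classes. -/
structure Rep (s : Store) (σ : St (Fin d → Fin n)) : Prop where
  inv : Inv σ
  part : PartRep s σ.c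
  tree : TreeRep n d s (ids σ)
  hit : ∀ x, s.arr aHit x = 0
  mov : ∀ x, s.arr aMov x = 0

theorem Rep.frame {X : ℕ} {L : List ℕ} {s s' : Store} (h : Rep s σ) (hf : Frame X L s s')
    (hL : ∀ x ∈ [aCls, aEl, aPos, aSize, aHit, aMov, aTree], x ∉ L) : Rep s' σ := by
  have h2 := hf.2 aCls (hL _ (by simp))
  have h3 := hf.2 aEl (hL _ (by simp))
  have h4 := hf.2 aPos (hL _ (by simp))
  have h5 := hf.2 aSize (hL _ (by simp))
  have h8 := hf.2 aHit (hL _ (by simp))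
  have h9 := hf.2 aMov (hL _ (by simp))
  have h10 := hf.2 aTree (hL _ (by simp))
  refine ⟨h.inv, ⟨?_, ?_, ?_, ?_, ?_⟩, h.tree.congr h10, ?_, ?_⟩
  · rw [h2]; exact h.part.cls
  · rw [h5]; exact h.part.size
  · rw [h3, h4]; exact h.part.el
  · rw [h4]; exact h.part.le_pos
  · rw [h4]; exact h.part.pos_lt
  · rw [h8]; exact h.hit
  · rw [h9]; exact h.mov

/-- Split the classes of the partition by the set of the entries of the list. -/
def splitClasses (d : ℕ) : Cmd := .seq countHits (.seq moveHits (renewClasses d))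

/-- The time for splitting is at most this factor times one plus the length of the list. -/
def splitCost (d : ℕ) : ℕ := 80 * (d + 2) + 700

theorem wp_splitClasses (hW : Params W n d) (hs : Env n d s) (hr : Rep s σ) (hl : ListRep s N a) :
    (splitClasses d).wp W (fun _ s' => Rep s' (split (listSet N a) σ) ∧ s'.var vLen = 0 ∧
      Frame 40 [aCls, aEl, aPos, aSize, aOld, aHit, aMov, aTree] s s') (splitCost d * (N + 1)) s := by
  set A := listSet N a with hA
  have hcost : splitCost d * (N + 1) =
      100 * (N + 1) + 300 * (N + 1) + (80 * (d + 2) + 300) * (N + 1) := by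
    rw [splitCost]; ring
  rw [splitClasses, Cmd.wp_seq]
  refine Cmd.wp_call _ (wp_countHits hW hl hr.part.cls hr.hit) (by omega) ?_
  rintro r1 r1' s1 hr1 ⟨hold1, hhit1, hf1⟩
  have hl1 : ListRep s1 N a := ⟨(hf1.1 _ (by norm_num)).trans hl.len, fun i hi => by
    rw [hf1.2 _ (by simp)]; exact hl.entry i hi, hl.inj⟩
  have hp1 : PartRep s1 σ.c := by
    refine ⟨?_, ?_, ?_, ?_, ?_⟩
    · rw [hf1.2 _ (by simp)]; exact hr.part.cls
    · rw [hf1.2 _ (by simp)]; exact hr.part.size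
    · rw [hf1.2 _ (by simp), hf1.2 _ (by simp)]; exact hr.part.el
    · rw [hf1.2 _ (by simp)]; exact hr.part.le_pos
    · rw [hf1.2 _ (by simp)]; exact hr.part.pos_lt
  rw [Cmd.wp_seq]
  refine Cmd.wp_call _ (wp_moveHits hW hr.inv.ranked hl1 hp1 hold1 hhit1 (by
    rw [hf1.2 _ (by simp)]; exact hr.mov)) (by omega) ?_
  rintro r2 r2' s2 hr2 ⟨hm, hf2⟩
  have hf12 : Frame 41 [aCls, aEl, aPos, aOld, aHit, aMov] s s2 :=
    (hf1.mono le_rfl (by simp)).trans (hf2.mono le_rfl (by simp))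
  refine Cmd.wp_call _ (wp_renewClasses (σ := σ) (a := a) (N := N) hW (hs.frame hf12 (by norm_num))
    hr.inv ⟨(hf12.1 _ (by norm_num)).trans hl.len, fun i hi => ?_, hl.inj⟩
    (hr.tree.congr (hf12.2 _ (by simp))) ?_ ?_ ?_) (by omega) ?_
  · rw [hf12.2 _ (by simp)]; exact hl.entry i hi
  · rw [hf2.2 _ (by simp)]; exact hold1
  · rw [hf2.2 _ (by simp)]
    intro x
    rw [hhit1, hl.hitUpTo_eq]
  · rw [hf12.2 _ (by simp)]; exact hr.part.size
  rintro r3 r3' s3 hr3 ⟨hn, h40, hf3⟩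
  have e2 := hf3.2 aCls (by simp)
  have e3 := hf3.2 aEl (by simp)
  have e4 := hf3.2 aPos (by simp)
  have hinv := hr.inv
  have hmov : ∀ u, 0 < rest σ.c A (σ.c u) → s2.arr aMov (σ.c u) = hit σ.c A (σ.c u) := fun u hu => by
    rw [hm.mov, if_pos hu, hl.hitUpTo_eq]
  refine ⟨⟨hinv.split A, ⟨?_, ?_, ?_, ?_, ?_⟩, ?_, ?_, ?_⟩, h40, ?_⟩
  · intro u
    rw [e2, hm.cls]
    rfl
  · intro u
    have hsum := hit_add_rest σ.c A (σ.c u)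
    by_cases hu : u ∈ A
    · have hpos := hit_pos (c := σ.c) hu
      rw [hinv.size_split_of_mem hu, split_c_of_mem hu]
      rcases Nat.eq_zero_or_pos (rest σ.c A (σ.c u)) with h0 | h0
      · rw [h0, add_zero, hn.size, if_neg (by rw [h0]; simp)]
        rw [h0] at hsum
        exact hsum.symm
      · exact hn.size' u ((seen_iff u).2 hpos) h0
    · have hpos := rest_pos (c := σ.c) hu
      rw [hinv.size_split_of_notMem hu, split_c_of_notMem hu, hn.size]
      split_ifs with h1
      · rfl
      · have : ¬ 0 < hit σ.c A (σ.c u) := fun h => h1 ⟨(seen_iff u).2 h, hpos⟩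
        omega
  · rw [e3, e4]; exact hm.el
  · intro u
    have h1 := hm.le_pos u
    rw [e4, split]
    dsimp only
    split_ifs with h2
    · have h3 := hm.moved u h2.1 h2.2
      have hsum := hit_add_rest σ.c A (σ.c u)
      rw [hmov u h2.2] at h3
      omega
    · exact h1
  · intro u
    have h1 := hm.pos_lt u
    have hsum := hit_add_rest σ.c A (σ.c u)
    rw [e4]
    by_cases hu : u ∈ A
    · rw [hinv.size_split_of_mem hu, split_c_of_mem hu]
      omega
    · have hpos := rest_pos (c := σ.c) hu
      have h3 := hm.unmoved u fun h => hu h.1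
      rw [hmov u hpos] at h3
      rw [hinv.size_split_of_notMem hu, split_c_of_notMem hu]
      omega
  · rw [ids_split hinv]
    exact hn.tree
  · intro x
    rw [hn.hit]
    split_ifs with h1
    · rfl
    · by_contra h
      obtain ⟨u, hu, hu'⟩ := exists_of_hit_pos (Nat.pos_of_ne_zero h)
      obtain ⟨i, hi, rfl⟩ := hu'
      exact h1 ⟨i, hi, hu⟩
  · intro x
    rw [hn.mov]
    split_ifs with h1
    · rfl
    · rw [hm.mov, hl.hitUpTo_eq]
      split_ifs with h2
      · by_contra h
        obtain ⟨u, hu, hu'⟩ := exists_of_hit_pos (Nat.pos_of_ne_zero h)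
        obtain ⟨i, hi, rfl⟩ := hu'
        exact h1 ⟨i, hi, hu⟩
      · rfl
  · exact (hf12.mono (by norm_num) (by simp)).trans (hf3.mono (by norm_num) (by simp))

end

/-! ### Refinement by a class -/

section
variable {W d n : ℕ} {s : Store} {σ : St (Fin d → Fin n)} {A S : Set (Fin d → Fin n)}

/-- The store holds a list of the elements of `A`. -/
def ListOf (s : Store) (A : Set (Fin d → Fin n)) : Prop :=
  ∃ a, ListRep s (s.var vLen) a ∧ listSet (s.var vLen) a = A

theorem ListOf.le (h : ListOf s A) : s.var vLen ≤ n ^ d := by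
  obtain ⟨a, h, -⟩ := h
  exact h.le

theorem listOf_empty (hn : 0 < n) (h : s.var vLen = 0) : ListOf s (∅ : Set (Fin d → Fin n)) :=
  ⟨fun _ _ => ⟨0, hn⟩, ⟨rfl, by simp [h], by simp [h]⟩, by simp [listSet, h]⟩

theorem ListOf.push (h : ListOf s A) {u : Fin d → Fin n} (hu : u ∉ A) {s' : Store}
    (hv : s'.var vLen = s.var vLen + 1)
    (ha : ∀ i, s'.arr aList i = if i = s.var vLen then code u else s.arr aList i) :
    ListOf s' (insert u A) := by
  obtain ⟨a, h, rfl⟩ := h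
  refine ⟨fun i => if i = s.var vLen then u else a i, ⟨rfl, fun i hi => ?_, fun i hi j hj hij => ?_⟩, ?_⟩
  · rw [ha]
    split_ifs with h1
    · rfl
    · exact h.entry i (by omega)
  · split_ifs at hij with h1 h2 h2
    · omega
    · exact absurd ⟨j, by omega, hij.symm⟩ hu
    · exact absurd ⟨i, by omega, hij⟩ hu
    · exact h.inj i (by omega) j (by omega) hij
  · ext w
    simp only [listSet, hv, Set.mem_insert_iff, Set.mem_ofPred_eq]
    constructor
    · rintro ⟨i, hi, rfl⟩
      split_ifs with h1
      · exact Or.inl rfl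
      · exact Or.inr ⟨i, by omega, rfl⟩
    · rintro (rfl | ⟨i, hi, rfl⟩)
      · exact ⟨s.var vLen, by omega, by simp⟩
      · exact ⟨i, by omega, by simp [hi.ne]⟩

theorem ListOf.congr (h : ListOf s A) {s' : Store} (hv : s'.var vLen = s.var vLen)
    (ha : s'.arr aList = s.arr aList) : ListOf s' A := by
  obtain ⟨a, h, hA⟩ := h
  exact ⟨a, ⟨rfl, by rw [hv, ha]; exact h.entry, by rw [hv]; exact h.inj⟩, by rw [hv]; exact hA⟩

theorem wp_splitClasses' (hW : Params W n d) (hs : Env n d s) (hr : Rep s σ) (hl : ListOf s A) :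
    (splitClasses d).wp W (fun _ s' => Rep s' (split A σ) ∧ s'.var vLen = 0 ∧
      Frame 40 [aCls, aEl, aPos, aSize, aOld, aHit, aMov, aTree] s s')
      (splitCost d * (s.var vLen + 1)) s := by
  obtain ⟨a, hl, rfl⟩ := hl
  exact wp_splitClasses hW hs hr hl

/-! #### Lines -/

/-- The number of the tuple obtained by replacing entry `j` of `u` by `0`. -/
def base (j : Fin d) (u : Fin d → Fin n) : ℕ := code u - u j * n ^ (j : ℕ)

theorem digit_eq (u : Fin d → Fin n) (j : Fin d) : code u / n ^ (j : ℕ) % n = u j := by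
  have := finFunctionFinEquiv_symm_apply_val (m := n) (n := d) (finFunctionFinEquiv u) j
  rw [Equiv.symm_apply_apply] at this
  exact this.symm

theorem digit_mul_le (u : Fin d → Fin n) (j : Fin d) : u j * n ^ (j : ℕ) ≤ code u := by
  rw [code_eq_sum]
  exact single_le_sum (f := fun j => (u j : ℕ) * n ^ (j : ℕ)) (fun _ _ => Nat.zero_le _) (mem_univ j)

theorem code_subst (j : Fin d) (u : Fin d → Fin n) (x : Fin n) :
    code (subst j u x) = base j u + x * n ^ (j : ℕ) := by
  have h : ∀ w : Fin d → Fin n, code w =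
      (∑ i ∈ univ.erase j, (w i : ℕ) * n ^ (i : ℕ)) + w j * n ^ (j : ℕ) := fun w => by
    rw [code_eq_sum, sum_erase_add _ _ (mem_univ j)]
  rw [base, h u, Nat.add_sub_cancel, h]
  congr 1
  · refine sum_congr rfl fun i hi => ?_
    rw [subst, Function.update_of_ne (ne_of_mem_erase hi)]
  · rw [subst, Function.update_self]

theorem base_lt (j : Fin d) (u : Fin d → Fin n) : base j u < n ^ d :=
  (Nat.sub_le _ _).trans_lt (code_lt u)

theorem base_subst (j : Fin d) (u : Fin d → Fin n) (x : Fin n) : base j (subst j u x) = base j u := by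
  rw [base, code_subst, subst, Function.update_self, Nat.add_sub_cancel]

theorem eq_subst_of_base_eq {j : Fin d} {u w : Fin d → Fin n} (h : base j u = base j w) :
    u = subst j w (u j) := by
  rw [← code_inj, code_subst, ← h, base, Nat.sub_add_cancel (digit_mul_le u j)]

theorem base_eq_iff {j : Fin d} {u w : Fin d → Fin n} :
    base j u = base j w ↔ ∃ x, u = subst j w x :=
  ⟨fun h => ⟨_, eq_subst_of_base_eq h⟩, by rintro ⟨x, rfl⟩; exact base_subst j w x⟩

theorem subst_inj {j : Fin d} {w : Fin d → Fin n} {x y : Fin n} (h : subst j w x = subst j w y) :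
    x = y := by
  have := congrFun h j
  rwa [subst, subst, Function.update_self, Function.update_self] at this

/-- Append the line through the tuple with number `v 27` to the list. -/
def pushLine : Cmd :=
  .for' 28 (.v vN) (.seq (.wr aList (.v vLen) (.v 27 + .v 28 * .v 24))
    (.asg vLen (.v vLen + .lit 1)))

theorem wp_pushLine (hW : Params W n d) (hs : Env n d s) {j : Fin d} {w : Fin d → Fin n}
    (h24 : s.var 24 = n ^ (j : ℕ)) (h27 : s.var 27 = base j w) (hl : ListOf s A)
    (hA : ∀ u, base j u = base j w → u ∉ A) :
    pushLine.wp W (fun _ s' => ListOf s' (A ∪ {u | base j u = base j w}) ∧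
      s'.var vLen = s.var vLen + n ∧ Frame 28 [aList] s s') (100 * (n + 1)) s := by
  have hword := hW.word
  have hMle : n ^ d ≤ (d + 4) * n ^ d := Nat.le_mul_of_pos_left _ (by omega)
  have hnM : n ≤ n ^ d := Nat.le_self_pow (by have := hW.dim; omega) n
  refine Cmd.wp_for n 70 (fun i s' => ListOf s' (A ∪ {u | ∃ x : Fin n, (x : ℕ) < i ∧ u = subst j w x}) ∧
    s'.var vLen = s.var vLen + i ∧ Frame 28 [aList] s s') (by norm_num) (by simp) (by omega) ?_ ?_ ?_ ?_ ?_
  · refine ⟨?_, by simp, Frame.refl.setVar _ le_rfl⟩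
    have : A ∪ {u | ∃ x : Fin n, (x : ℕ) < 0 ∧ u = subst j w x} = A := by ext; simp
    rw [this]
    exact hl.congr (by simp) rfl
  · rintro i s' ⟨-, -, hf⟩ -
    exact ⟨trivial, (hs.frame hf (by norm_num)).order⟩
  · simp only [Cmd.forCost, Ex.cost_v, Ex.depth_v]
    omega
  · rintro i s' hi ⟨hl', hv, hf⟩ h28
    have g24 : s'.var 24 = n ^ (j : ℕ) := (hf.1 _ (by norm_num)).trans h24
    have g27 : s'.var 27 = base j w := (hf.1 _ (by norm_num)).trans h27
    have hc := code_subst j w ⟨i, hi⟩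
    have hc' := code_lt (subst j w ⟨i, hi⟩)
    have hle := hl'.le
    simp only at hc
    simp [h28, g24, g27]
    refine ⟨by omega, by omega, ?_, by omega, ?_⟩
    · have := hl'.push (u := subst j w ⟨i, hi⟩) (s' := ((s'.setArr aList (s'.var vLen)
        (base j w + i * n ^ (j : ℕ))).setVar vLen (s'.var vLen + 1)).setVar 28 (i + 1)) ?_ ?_ ?_
      · convert this using 1
        ext u
        simp only [Set.mem_union, Set.mem_insert_iff, Set.mem_ofPred_eq]
        constructor
        · rintro (h | ⟨x, hx, rfl⟩)
          · exact Or.inr (Or.inl h)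
          · rcases Nat.lt_or_eq_of_le hx with hx | hx
            · exact Or.inr (Or.inr ⟨x, hx, rfl⟩)
            · exact Or.inl (by rw [← Fin.ext (a := x) (b := ⟨i, hi⟩) hx])
        · rintro (rfl | h | ⟨x, hx, rfl⟩)
          · exact Or.inr ⟨⟨i, hi⟩, le_rfl, rfl⟩
          · exact Or.inl h
          · exact Or.inr ⟨x, by omega, rfl⟩
      · rintro (h | ⟨x, hx, h⟩)
        · exact hA _ (base_subst j w _) h
        · have := subst_inj h
          subst this
          exact lt_irrefl _ hx
      · simp
      · intro i'
        simp [hc]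
    · exact ((hf.setArr _ _ (by simp)).setVar _ (by norm_num)).setVar _ (by norm_num)
  · rintro r s' ⟨hl', hv, hf⟩ - -
    refine ⟨?_, hv, hf⟩
    convert hl' using 2
    ext u
    simp only [Set.mem_ofPred_eq, base_eq_iff]
    exact ⟨fun ⟨x, h⟩ => ⟨x, x.2, h⟩, fun ⟨x, _, h⟩ => ⟨x, h⟩⟩

/-- The array `aSpl` lists the elements of `S`. -/
structure SplRep (s : Store) (m : ℕ) (e : ℕ → Fin d → Fin n) (S : Set (Fin d → Fin n)) : Prop where
  len : s.var 21 = m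
  le : m ≤ n ^ d
  entry : ∀ i < m, s.arr aSpl i = code (e i)
  inj : ∀ i < m, ∀ j < m, e i = e j → i = j
  mem_iff : ∀ u, u ∈ S ↔ ∃ i < m, e i = u

theorem SplRep.frame {m X : ℕ} {e : ℕ → Fin d → Fin n} {L : List ℕ} {s' : Store} (h : SplRep s m e S)
    (hf : Frame X L s s') (hX : 21 < X) (hL : aSpl ∉ L) : SplRep s' m e S :=
  ⟨(hf.1 _ hX).trans h.len, h.le, by rw [hf.2 _ hL]; exact h.entry, h.inj, h.mem_iff⟩

/-- The number of listed elements among the first `i` on the line with base `b`. -/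
def lineCount (e : ℕ → Fin d → Fin n) (j : Fin d) (i b : ℕ) : ℕ := #{i' ∈ range i | base j (e i') = b}

theorem lineCount_succ (e : ℕ → Fin d → Fin n) (j : Fin d) (i b : ℕ) :
    lineCount e j (i + 1) b = lineCount e j i b + if b = base j (e i) then 1 else 0 := by
  rw [lineCount, range_add_one, filter_insert]
  split_ifs with h1 h2 h3
  · rw [card_insert_of_notMem (by simp)]
    rfl
  · exact absurd h1.symm h2
  · exact absurd h3.symm h1
  · rfl

theorem lineCount_pos {e : ℕ → Fin d → Fin n} {j : Fin d} {i b : ℕ} :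
    0 < lineCount e j i b ↔ ∃ i' < i, base j (e i') = b := by
  simp [lineCount, card_pos, Finset.Nonempty]

theorem lineCount_le (e : ℕ → Fin d → Fin n) (j : Fin d) (i b : ℕ) : lineCount e j i b ≤ i :=
  (card_filter_le _ _).trans (card_range i).le

theorem SplRep.lineCount_eq {m : ℕ} {e : ℕ → Fin d → Fin n} (h : SplRep s m e S) (j : Fin d)
    (w : Fin d → Fin n) : lineCount e j m (base j w) = #{x | subst j w x ∈ S} := by
  refine card_bij (fun i _ => e i j) (fun i hi => ?_) (fun i hi i' hi' hij => ?_) fun x hx => ?_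
  · simp only [mem_filter, mem_range, mem_univ, true_and] at hi ⊢
    rw [← eq_subst_of_base_eq hi.2]
    exact (h.mem_iff _).2 ⟨i, hi.1, rfl⟩
  · simp only [mem_filter, mem_range] at hi hi'
    refine h.inj i hi.1 i' hi'.1 ?_
    rw [eq_subst_of_base_eq hi.2, eq_subst_of_base_eq hi'.2, hij]
  · simp only [mem_filter, mem_univ, true_and] at hx
    obtain ⟨i, hi, hie⟩ := (h.mem_iff _).1 hx
    refine ⟨i, by simp [hi, hie, base_subst], ?_⟩
    rw [hie, subst, Function.update_self]

theorem SplRep.lineCount_le_order {m : ℕ} {e : ℕ → Fin d → Fin n} (h : SplRep s m e S) (j : Fin d)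
    (b : ℕ) : lineCount e j m b ≤ n := by
  rcases Nat.eq_zero_or_pos (lineCount e j m b) with h0 | h0
  · omega
  · obtain ⟨i, hi, rfl⟩ := lineCount_pos.1 h0
    rw [h.lineCount_eq]
    exact (card_le_univ _).trans (Fintype.card_fin n).le

theorem SplRep.mem_lineSet_iff {m : ℕ} {e : ℕ → Fin d → Fin n} (h : SplRep s m e S) {j : Fin d}
    {t : ℕ} {u : Fin d → Fin n} : u ∈ lineSet subst S j t ↔ lineCount e j m (base j u) = t := by
  rw [h.lineCount_eq]
  rfl

/-- The base of the line through the tuple with number `e`. -/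
def baseEx (e : Ex) : Ex := e - e / .v 24 % .v vN * .v 24

/-- Count the elements of `aSpl` on the lines. -/
def countLines : Cmd :=
  .for' 22 (.v 21) (.seq (.asg 27 (baseEx (.get aSpl (.v 22))))
    (.wr aCnt (.v 27) (.get aCnt (.v 27) + .lit 1)))

theorem wp_countLines (hW : Params W n d) (hs : Env n d s) {m : ℕ} {e : ℕ → Fin d → Fin n}
    (he : SplRep s m e S) {j : Fin d} (h24 : s.var 24 = n ^ (j : ℕ)) (hz : ∀ b, s.arr aCnt b = 0) :
    countLines.wp W (fun _ s' => (∀ b, s'.arr aCnt b = lineCount e j m b) ∧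
      (∀ x ≠ 22, x ≠ 27 → s'.var x = s.var x) ∧ ∀ a ≠ aCnt, s'.arr a = s.arr a) (100 * (m + 1)) s := by
  have hword := hW.word
  have hMle : n ^ d ≤ (d + 4) * n ^ d := Nat.le_mul_of_pos_left _ (by omega)
  have hm := he.le
  refine Cmd.wp_for m 70 (fun i s' => (∀ b, s'.arr aCnt b = lineCount e j i b) ∧
      (∀ x ≠ 22, x ≠ 27 → s'.var x = s.var x) ∧ ∀ a ≠ aCnt, s'.arr a = s.arr a)
    (by norm_num) (by simp) (by omega) ?_ ?_ ?_ ?_ ?_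
  · refine ⟨by simpa [lineCount] using hz, ?_, fun _ _ => rfl⟩
    intro x hx _
    simp [hx]
  · rintro i s' ⟨-, hv, -⟩ -
    exact ⟨trivial, (hv _ (by norm_num) (by norm_num)).trans he.len⟩
  · simp only [Cmd.forCost, Ex.cost_v, Ex.depth_v]
    omega
  · rintro i s' hi ⟨hI, hv, ha⟩ h22
    have g24 : s'.var 24 = n ^ (j : ℕ) := (hv _ (by norm_num) (by norm_num)).trans h24
    have gN : s'.var vN = n := (hv _ (by norm_num) (by norm_num)).trans hs.order
    have gS : s'.arr aSpl i = code (e i) := by rw [ha _ (by norm_num)]; exact he.entry i hi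
    have h1 := digit_mul_le (e i) j
    have h2 := code_lt (e i)
    have h3 := lineCount_le e j i (base j (e i))
    have hb : code (e i) - e i j * n ^ (j : ℕ) = base j (e i) := rfl
    simp [baseEx, h22, g24, gN, gS, digit_eq, hb, hI]
    refine ⟨by omega, by omega, fun b => ?_, fun x hx hx' => ?_, fun a h => ?_⟩
    · rw [lineCount_succ]
      split_ifs with h
      · rw [h]
      · rfl
    · simp [hx, hx', hv]
    · simp [h, ha]
  · rintro r s' h - -
    exact h

/-- The tuples on the lines that contain `t + 1` elements of the class, one of them among the first
`i` elements. -/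
def collected (e : ℕ → Fin d → Fin n) (j : Fin d) (m t i : ℕ) : Set (Fin d → Fin n) :=
  {u | lineCount e j m (base j u) = t + 1 ∧ ∃ i' < i, base j (e i') = base j u}

/-- Append the lines that contain `v 25 + 1` elements of `aSpl` to the list. -/
def collectLines : Cmd :=
  .for' 26 (.v 21) (.seq (.asg 27 (baseEx (.get aSpl (.v 26))))
    (.ite (.eq (.get aCnt (.v 27)) (.v 25 + .lit 1))
      (.seq (.wr aCnt (.v 27) (.lit 0)) pushLine)
      .skip))

/-- The number of lines that have not been handled. -/
def openLines (n d : ℕ) (s : Store) : ℕ := #{b ∈ range (n ^ d) | 0 < s.arr aCnt b}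

/-- The time that has to be reserved for the open lines and the list. -/
def lineCredit (n d : ℕ) (s : Store) : ℕ :=
  (splitCost d + 300) * n * openLines n d s + splitCost d * s.var vLen

theorem lineCredit_congr {s s' : Store} (hv : s'.var vLen = s.var vLen)
    (ha : s'.arr aCnt = s.arr aCnt) : lineCredit n d s' = lineCredit n d s := by
  rw [lineCredit, lineCredit, openLines, openLines, hv, ha]

theorem openLines_of_clear {s s' : Store} {b : ℕ} (hb : b < n ^ d) (h : 0 < s.arr aCnt b)
    (ha : ∀ b', s'.arr aCnt b' = if b' = b then 0 else s.arr aCnt b') :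
    openLines n d s = openLines n d s' + 1 := by
  rw [openLines, openLines, ← card_erase_add_one (a := b) (by simp [hb, h])]
  congr 2
  ext b'
  simp only [mem_erase, mem_filter, mem_range, ha]
  by_cases hb' : b' = b <;> simp [hb']

theorem wp_collectLines (hW : Params W n d) (hs : Env n d s) {m : ℕ} {e : ℕ → Fin d → Fin n}
    (he : SplRep s m e S) {j : Fin d} (h24 : s.var 24 = n ^ (j : ℕ)) {t : ℕ} (ht : t < n)
    (h25 : s.var 25 = t) (hlen : s.var vLen = 0)
    (hcnt : ∀ b, s.arr aCnt b = if lineCount e j m b ≤ t then 0 else lineCount e j m b) :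
    collectLines.wp W (fun r s' => ListOf s' (lineSet subst S j (t + 1)) ∧
      (∀ b, s'.arr aCnt b = if lineCount e j m b ≤ t + 1 then 0 else lineCount e j m b) ∧
      lineCredit n d s' ≤ r ∧ Frame 26 [aList, aCnt] s s') (200 * (m + 1) + lineCredit n d s) s := by
  have hword := hW.word
  have hMle : n ^ d ≤ (d + 4) * n ^ d := Nat.le_mul_of_pos_left _ (by omega)
  have hnM : n ≤ n ^ d := Nat.le_self_pow (by have := hW.dim; omega) n
  have hm := he.le
  have hcred : lineCredit n d (s.setVar 26 0) = lineCredit n d s := lineCredit_congr (by simp) rfl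
  refine Cmd.wp_for' m 150 (fun i s' => ListOf s' (collected e j m t i) ∧
      (∀ b, s'.arr aCnt b = if lineCount e j m b ≤ t ∨ lineCount e j m b = t + 1 ∧
        ∃ i' < i, base j (e i') = b then 0 else lineCount e j m b) ∧ Frame 26 [aList, aCnt] s s')
    (fun _ s' => lineCredit n d s') (by norm_num) (by simp) (by omega) ?_ ?_ ?_ ?_ ?_
  · refine ⟨?_, ?_, Frame.refl.setVar _ le_rfl⟩
    · have : collected e j m t 0 = ∅ := by ext; simp [collected]
      rw [this]
      exact listOf_empty hW.pos (by simpa using hlen)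
    · simpa using hcnt
  · rintro i s' ⟨-, -, hf⟩ -
    exact ⟨trivial, (hf.1 _ (by norm_num)).trans he.len⟩
  · rw [hcred]
    simp only [Cmd.forCost, Ex.cost_v, Ex.depth_v]
    omega
  · rintro i s' hi ⟨hl, hI, hf⟩ h26
    have henv := hs.frame hf (by norm_num)
    have g24 : s'.var 24 = n ^ (j : ℕ) := (hf.1 _ (by norm_num)).trans h24
    have g25 : s'.var 25 = t := (hf.1 _ (by norm_num)).trans h25
    have gS : s'.arr aSpl i = code (e i) := by rw [hf.2 _ (by simp)]; exact he.entry i hi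
    have h1 := digit_mul_le (e i) j
    have h2 := code_lt (e i)
    have h3 := base_lt j (e i)
    have hb : code (e i) - e i j * n ^ (j : ℕ) = base j (e i) := rfl
    set b := base j (e i) with hbdef
    simp only [Cmd.wp_seq, Cmd.wp_asg, Cmd.wp_ite]
    by_cases hit : s'.arr aCnt b = t + 1
    · have hC : lineCount e j m b = t + 1 ∧ ¬ ∃ i' < i, base j (e i') = b := by
        rw [hI] at hit
        split_ifs at hit with h
        · push Not at h
          exact ⟨hit, fun ⟨i', hi', h'⟩ => h.2 hit i' hi' h'⟩
      simp [baseEx, h26, g24, g25, henv.order, gS, digit_eq, hb, hit]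
      set s1 := (s'.setVar 27 b).setArr aCnt b 0 with hs1
      have hopen : openLines n d s' = openLines n d s1 + 1 :=
        openLines_of_clear h3 (by omega) (fun b' => by simp [hs1])
      have hf1 : Frame 26 [aList, aCnt] s s1 := (hf.setVar _ (by norm_num)).setArr _ _ (by simp)
      have hl1 : ListOf s1 (collected e j m t i) := hl.congr (by simp [hs1]) (by simp [hs1])
      have hv1 : s1.var vLen = s'.var vLen := by simp [hs1]
      have hcr : lineCredit n d s' = (splitCost d + 300) * n * openLines n d s1 +
          splitCost d * n + 300 * n + splitCost d * s1.var vLen := by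
        rw [lineCredit, hopen, hv1]; ring
      have hn := hW.pos
      refine ⟨by omega, by omega, by omega, by omega, by omega, by omega, ?_⟩
      refine Cmd.wp_call _ (wp_pushLine hW (hs.frame hf1 (by norm_num)) (w := e i)
        ((hf1.1 _ (by norm_num)).trans h24) (by simp [hs1, hbdef]) hl1 ?_) ?_ ?_
      · rintro u hu ⟨-, i', hi', hu'⟩
        exact hC.2 ⟨i', hi', hu'.trans hu⟩
      · omega
      · rintro r r' s2 hr ⟨hl2, hv2, hf2⟩
        have hcr2 : lineCredit n d (s2.setVar 26 (i + 1)) =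
            (splitCost d + 300) * n * openLines n d s1 + splitCost d * n +
              splitCost d * s1.var vLen := by
          rw [lineCredit, openLines, Store.arr_setVar, hf2.2 _ (by simp), ← openLines,
            Store.var_setVar, if_neg (by norm_num), hv2]
          ring
        refine ⟨?_, ?_, ?_, ?_, ?_⟩
        · rw [hf2.1 _ (by norm_num)]
          simp [hs1, h26]
        · rw [hcr2]
          omega
        · refine ListOf.congr (s := s2) ?_ (by simp) rfl
          convert hl2 using 1
          ext u
          simp only [collected, Set.mem_union, Set.mem_ofPred_eq]
          constructor
          · rintro ⟨hu, i', hi', hu'⟩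
            rcases (show i' < i ∨ i' = i by omega) with h | rfl
            · exact Or.inl ⟨hu, i', h, hu'⟩
            · exact Or.inr hu'.symm
          · rintro (⟨hu, i', hi', hu'⟩ | hu)
            · exact ⟨hu, i', by omega, hu'⟩
            · exact ⟨by rw [hu]; exact hC.1, i, by omega, hu.symm⟩
        · intro b'
          rw [hf2.2 _ (by simp)]
          simp only [hs1, Store.arr_setArr_self, Store.arr_setVar, hI]
          by_cases hb' : b' = b
          · subst hb'
            rw [if_pos rfl, if_pos (Or.inr ⟨hC.1, i, by omega, rfl⟩)]
          · rw [if_neg hb']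
            congr 1
            simp only [eq_iff_iff]
            refine or_congr Iff.rfl (and_congr Iff.rfl ⟨fun ⟨i', hi', h⟩ => ⟨i', by omega, h⟩,
              fun ⟨i', hi', h⟩ => ?_⟩)
            rcases (show i' < i ∨ i' = i by omega) with h' | rfl
            · exact ⟨i', h', h⟩
            · exact absurd h.symm hb'
        · exact (hf1.trans (hf2.mono (by norm_num) (by simp))).setVar _ le_rfl
    · simp [baseEx, h26, g24, g25, henv.order, gS, digit_eq, hb, hit]
      have hC : lineCount e j m b = t + 1 → ∃ i' < i, base j (e i') = b := by
        intro h
        by_contra h'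
        refine hit ?_
        rw [hI, if_neg, h]
        rintro (h'' | h'')
        · omega
        · exact h' h''.2
      have hcr : lineCredit n d ((s'.setVar 27 b).setVar 26 (i + 1)) = lineCredit n d s' :=
        lineCredit_congr (by simp) rfl
      refine ⟨by omega, by omega, by omega, by omega, by omega, by omega, ?_, fun b' => ?_, (hf.setVar _ (by norm_num)).setVar _ le_rfl⟩
      · refine ListOf.congr (s := s') ?_ (by simp) rfl
        convert hl using 1
        ext u
        simp only [collected, Set.mem_ofPred_eq]
        refine and_congr_right fun hu => ⟨fun ⟨i', hi', h⟩ => ?_, fun ⟨i', hi', h⟩ => ⟨i', by omega, h⟩⟩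
        rcases (show i' < i ∨ i' = i by omega) with h' | rfl
        · exact ⟨i', h', h⟩
        · rw [← h]
          exact hC (by rw [hbdef, h]; exact hu)
      · rw [hI]
        congr 1
        simp only [eq_iff_iff]
        refine or_congr Iff.rfl (and_congr_right fun hu => ⟨fun ⟨i', hi', h⟩ => ⟨i', by omega, h⟩,
          fun ⟨i', hi', h⟩ => ?_⟩)
        rcases (show i' < i ∨ i' = i by omega) with h' | rfl
        · exact ⟨i', h', h⟩
        · rw [← h]
          exact hC (by rw [hbdef, h]; exact hu)
  · rintro r s' ⟨hl, hI, hf⟩ - hr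
    refine ⟨?_, fun b => ?_, by omega, hf⟩
    · convert hl using 1
      ext u
      rw [he.mem_lineSet_iff]
      refine ⟨fun h => ⟨h, lineCount_pos.1 (by omega)⟩, fun h => h.1⟩
    · rw [hI]
      congr 1
      simp only [eq_iff_iff]
      constructor
      · rintro (h | h) <;> omega
      · intro h
        rcases Nat.lt_or_eq_of_le h with h | h
        · exact Or.inl (by omega)
        · exact Or.inr ⟨h, lineCount_pos.1 (by omega)⟩

end

section
variable {W d n : ℕ} {s : Store} {σ : St (Fin d → Fin n)} {A S : Set (Fin d → Fin n)}

/-- Split the classes according to the numbers of elements of `aSpl` on the lines. -/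
def splitLines (d : ℕ) : Cmd := .for' 25 (.v vN) (.seq collectLines (splitClasses d))

theorem wp_splitLines (hW : Params W n d) (hs : Env n d s) {m : ℕ} {e : ℕ → Fin d → Fin n}
    (he : SplRep s m e S) {j : Fin d} (h24 : s.var 24 = n ^ (j : ℕ)) (hr : Rep s σ)
    (hlen : s.var vLen = 0) (hcnt : ∀ b, s.arr aCnt b = lineCount e j m b) :
    (splitLines d).wp W (fun _ s' => Rep s' (splits (lineSets subst S j) σ) ∧ s'.var vLen = 0 ∧
      (∀ b, s'.arr aCnt b = 0) ∧
      Frame 25 [aCls, aEl, aPos, aSize, aList, aOld, aHit, aMov, aTree, aCnt] s s')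
      (n * (200 * (m + 1) + splitCost d + 40) + 20 + lineCredit n d s) s := by
  have hword := hW.word
  have hMle : n ^ d ≤ (d + 4) * n ^ d := Nat.le_mul_of_pos_left _ (by omega)
  have hnM : n ≤ n ^ d := Nat.le_self_pow (by have := hW.dim; omega) n
  have hcred : lineCredit n d (s.setVar 25 0) = lineCredit n d s := lineCredit_congr (by simp) rfl
  refine Cmd.wp_for' n (200 * (m + 1) + splitCost d) (fun t s' =>
      Rep s' (splits ((List.range t).map fun t => lineSet subst S j (t + 1)) σ) ∧ s'.var vLen = 0 ∧
      (∀ b, s'.arr aCnt b = if lineCount e j m b ≤ t then 0 else lineCount e j m b) ∧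
      Frame 25 [aCls, aEl, aPos, aSize, aList, aOld, aHit, aMov, aTree, aCnt] s s')
    (fun _ s' => lineCredit n d s') (by norm_num) (by simp) (by omega) ?_ ?_ ?_ ?_ ?_
  · refine ⟨?_, by simpa using hlen, fun b => ?_, Frame.refl.setVar _ le_rfl⟩
    · exact hr.frame (Frame.refl.setVar (X := 25) (L := []) _ le_rfl) (by simp)
    · rw [Store.arr_setVar, hcnt]
      split_ifs <;> omega
  · rintro t s' ⟨-, -, -, hf⟩ -
    exact ⟨trivial, (hs.frame hf (by norm_num)).order⟩
  · rw [hcred]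
    have h17 : Cmd.forCost (.v vN) = 17 := rfl
    rw [h17, show n * (200 * (m + 1) + splitCost d + 40) =
      n * (200 * (m + 1) + splitCost d + 17) + n * 23 by ring]
    omega
  · rintro t s' ht ⟨hr', hv, hI, hf⟩ h25
    have henv := hs.frame hf (by norm_num)
    rw [Cmd.wp_seq]
    refine Cmd.wp_call _ (wp_collectLines hW henv (he.frame hf (by norm_num) (by simp))
      ((hf.1 _ (by norm_num)).trans h24) ht h25 hv hI) (by omega) ?_
    rintro r1 r1' s1 hr1 ⟨hl1, hI1, hc1, hf1⟩
    have hcr1 : lineCredit n d s1 = (splitCost d + 300) * n * openLines n d s1 +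
      splitCost d * s1.var vLen := rfl
    have hmul : splitCost d * (s1.var vLen + 1) = splitCost d * s1.var vLen + splitCost d := by ring
    refine Cmd.wp_call _ (wp_splitClasses' hW (henv.frame hf1 (by norm_num))
      (hr'.frame hf1 (by simp)) hl1) (by omega) ?_
    rintro r2 r2' s2 hr2 ⟨hr2', hv2, hf2⟩
    have hcr2 : lineCredit n d (s2.setVar 25 (t + 1)) =
        (splitCost d + 300) * n * openLines n d s1 := by
      rw [lineCredit, openLines, Store.arr_setVar, hf2.2 _ (by simp), ← openLines,
        Store.var_setVar, if_neg (by norm_num), hv2, mul_zero, add_zero]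
    refine ⟨?_, by omega, ?_, by simpa using hv2, fun b => ?_, ?_⟩
    · rw [hf2.1 _ (by norm_num), hf1.1 _ (by norm_num), h25]
    · rw [List.range_succ, List.map_append, splits_append]
      exact hr2'.frame (Frame.refl.setVar (X := 25) (L := []) _ le_rfl) (by simp)
    · rw [Store.arr_setVar, hf2.2 _ (by simp)]
      exact hI1 b
    · exact ((hf.trans (hf1.mono (by norm_num) (by simp))).trans
        (hf2.mono (by norm_num) (by simp))).setVar _ le_rfl
  · rintro r s' ⟨hr', hv, hI, hf⟩ - -
    refine ⟨?_, hv, fun b => ?_, hf⟩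
    · rw [lineSets, Fintype.card_fin]
      exact hr'
    · rw [hI, if_pos (he.lineCount_le_order j b)]

/-- List the elements of the class `v 20`, whose size is `v 21`. -/
def copyClass : Cmd := .for' 22 (.v 21) (.wr aSpl (.v 22) (.get aEl (.v 20 + .v 22)))

theorem wp_copyClass (hW : Params W n d) (hr : Rep s σ) {x m : ℕ} (hx : ∃ u, σ.c u = x)
    (hm : size σ.c x = m) (h20 : s.var 20 = x) (h21 : s.var 21 = m) :
    copyClass.wp W (fun _ s' => (∃ e, SplRep s' m e {u | σ.c u = x}) ∧
      s'.var vLen = s.var vLen ∧ Frame 22 [aSpl] s s') (60 * (m + 1)) s := by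
  have hword := hW.word
  have hMle : n ^ d ≤ (d + 4) * n ^ d := Nat.le_mul_of_pos_left _ (by omega)
  obtain ⟨w, rfl⟩ := hx
  have hle := hr.inv.ranked.add_size_le_card w
  rw [card_tuples, hm] at hle
  have hel : ∀ i, ∃ u : Fin d → Fin n, i < m → s.arr aPos (code u) = σ.c w + i ∧
      s.arr aEl (σ.c w + i) = code u := by
    intro i
    by_cases hi : i < m
    · obtain ⟨u, hu⟩ := exists_pos hr.inv.ranked hr.part.el hr.part.pos_lt (p := σ.c w + i) (by omega)
      exact ⟨u, fun _ => hu⟩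
    · exact ⟨w, fun h => absurd h hi⟩
  choose e he using hel
  refine Cmd.wp_for m 30 (fun i s' => (∀ i' < i, s'.arr aSpl i' = code (e i')) ∧
      s'.var vLen = s.var vLen ∧ Frame 22 [aSpl] s s')
    (by norm_num) (by simp) (by omega) ?_ ?_ ?_ ?_ ?_
  · exact ⟨by simp, by simp, Frame.refl.setVar _ le_rfl⟩
  · rintro i s' ⟨-, -, hf⟩ -
    exact ⟨trivial, (hf.1 _ (by norm_num)).trans h21⟩
  · simp only [Cmd.forCost, Ex.cost_v, Ex.depth_v]
    omega
  · rintro i s' hi ⟨hI, hv, hf⟩ h22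
    have g20 : s'.var 20 = σ.c w := (hf.1 _ (by norm_num)).trans h20
    have gE : s'.arr aEl (σ.c w + i) = code (e i) := by rw [hf.2 _ (by simp)]; exact (he i hi).2
    simp [h22, g20, gE]
    refine ⟨by omega, fun i' hi' => ?_, hv, (hf.setArr _ _ (by simp)).setVar _ le_rfl⟩
    split_ifs with h
    · rw [h]
    · exact hI i' (by omega)
  · rintro r s' ⟨hI, hv, hf⟩ - -
    refine ⟨⟨e, ?_, by omega, hI, ?_, fun u => ⟨fun hu => ?_, ?_⟩⟩, hv, hf⟩
    · exact (hf.1 _ (by norm_num)).trans h21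
    · intro i hi i' hi' h
      have h1 := (he i hi).1
      have h2 := (he i' hi').1
      rw [h] at h1
      omega
    · have hu : σ.c u = σ.c w := hu
      have h1 := hr.part.le_pos u
      have h2 := hr.part.pos_lt u
      rw [hu, hm] at h2
      rw [hu] at h1
      refine ⟨s.arr aPos (code u) - σ.c w, by omega, ?_⟩
      have h3 := (he (s.arr aPos (code u) - σ.c w) (by omega)).2
      rw [Nat.add_sub_cancel' h1, hr.part.el] at h3
      exact (code_inj.1 h3).symm
    · rintro ⟨i, hi, rfl⟩
      have h1 := (he i hi).1
      have h2 := hr.part.le_pos (e i)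
      have h3 := hr.part.pos_lt (e i)
      exact hr.inv.ranked.eq_of_mem (q := σ.c w + i) (by omega) (by omega) (by omega) (by omega)

theorem openLines_le {m : ℕ} {e : ℕ → Fin d → Fin n} {j : Fin d}
    (h : ∀ b, s.arr aCnt b = lineCount e j m b) : openLines n d s ≤ m := by
  have : ({b ∈ range (n ^ d) | 0 < s.arr aCnt b} : Finset ℕ) ⊆ (range m).image fun i => base j (e i) := by
    intro b hb
    simp only [mem_filter, h, lineCount_pos, mem_image, mem_range] at hb ⊢
    exact hb.2
  exact (card_le_card this).trans (card_image_le.trans (card_range m).le)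

/-- The store represents `σ` and is ready for a refinement step. -/
structure Ready (s : Store) (σ : St (Fin d → Fin n)) : Prop where
  env : Env n d s
  pow : ∀ j < d, s.arr aPow j = n ^ j
  rep : Rep s σ
  len : s.var vLen = 0
  cnt : ∀ b, s.arr aCnt b = 0

theorem ids_unflag (x : ℕ) : ids (unflag x σ) = (ids σ).erase x := by
  ext y
  simp only [mem_erase, mem_ids, unflag]
  constructor
  · rintro ⟨u, ⟨hp, hx⟩, rfl⟩
    exact ⟨hx, u, hp, rfl⟩
  · rintro ⟨hx, u, hp, rfl⟩
    exact ⟨u, ⟨hp, hx⟩, rfl⟩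

/-- Refine the partition by the class `v 20`. -/
def refineClass (d : ℕ) : Cmd :=
  .seq (.asg 50 (.v 20)) (.seq (treeErase d) (.seq (.asg 21 (.get aSize (.v 20))) (.seq copyClass
    (.for' 23 (.lit d) (.seq (.asg 24 (.get aPow (.v 23))) (.seq countLines (splitLines d)))))))

/-- The time for refining by a class is at most this factor times `n` times the size of the class. -/
def refineCost (d : ℕ) : ℕ := (d + 1) * (2 * splitCost d + 2000)

theorem wp_refineClass (hW : Params W n d) (hs : Ready s σ) {x : ℕ} (hx : x ∈ ids σ)
    (h20 : s.var 20 = x) :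
    (refineClass d).wp W (fun _ s' => Ready s' (process subst (List.finRange d) x σ) ∧
      Frame 20 [aCls, aEl, aPos, aSize, aList, aOld, aHit, aMov, aTree, aSpl, aCnt] s s')
      (refineCost d * (n * size σ.c x)) s := by
  have hword := hW.word
  have hMle : n ^ d ≤ (d + 4) * n ^ d := Nat.le_mul_of_pos_left _ (by omega)
  obtain ⟨w, hw, hwx⟩ := mem_ids.1 hx
  obtain ⟨m, hm⟩ : ∃ m, size σ.c x = m := ⟨_, rfl⟩
  have hm1 : 1 ≤ m := by rw [← hm, ← hwx]; exact size_pos _ _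
  have hn1 : 1 ≤ n := hW.pos
  obtain ⟨p, hp⟩ : ∃ p, p = n * m := ⟨_, rfl⟩
  have hmp : m ≤ p := hp ▸ Nat.le_mul_of_pos_left _ hn1
  have hnp : n ≤ p := hp ▸ Nat.le_mul_of_pos_right _ hm1
  obtain ⟨K, hK⟩ : ∃ K, K = splitCost d := ⟨_, rfl⟩
  have hKd : 80 * (d + 2) ≤ K := by rw [hK, splitCost]; omega
  have hKp : K ≤ K * p := Nat.le_mul_of_pos_right _ (by omega)
  have hbudget : refineCost d * (n * size σ.c x) =
      d * ((2 * K + 2000) * p) + (2 * (K * p) + 2000 * p) := by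
    rw [refineCost, hm, ← hp, ← hK]; ring
  rw [hbudget]
  simp only [refineClass, Cmd.wp_seq]
  simp
  refine ⟨by omega, ?_⟩
  refine Cmd.wp_call _ (wp_treeErase hW (hs.env.frame (Frame.refl.setVar (X := 20) (L := []) _ (by norm_num))
    (by norm_num)) (hs.rep.tree.congr rfl) (by simp [h20]) hx) (by omega) ?_
  rintro r1 r1' s1 hr1 ⟨ht1, hf1⟩
  have hf1' : Frame 20 [aTree] s s1 :=
    (Frame.refl.setVar _ (by norm_num)).trans (hf1.mono (by norm_num) (by simp))
  have g20 : s1.var 20 = x := (hf1.1 _ (by norm_num)).trans (by simp [h20])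
  have gSize : s1.arr aSize x = m := by
    rw [hf1'.2 _ (by simp), ← hwx, hs.rep.part.size, hwx, hm]
  have hrep1 : Rep s1 (unflag x σ) := by
    refine ⟨hs.rep.inv.unflag x, ?_, ?_, ?_, ?_⟩
    · refine ⟨?_, ?_, ?_, ?_, ?_⟩
      · rw [hf1'.2 _ (by simp)]; exact hs.rep.part.cls
      · rw [hf1'.2 _ (by simp)]; exact hs.rep.part.size
      · rw [hf1'.2 _ (by simp), hf1'.2 _ (by simp)]; exact hs.rep.part.el
      · rw [hf1'.2 _ (by simp)]; exact hs.rep.part.le_pos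
      · rw [hf1'.2 _ (by simp)]; exact hs.rep.part.pos_lt
    · rw [ids_unflag]; exact ht1
    · rw [hf1'.2 _ (by simp)]; exact hs.rep.hit
    · rw [hf1'.2 _ (by simp)]; exact hs.rep.mov
  have hlen1 : s1.var vLen = 0 := (hf1.1 _ (by norm_num)).trans (by simpa using hs.len)
  simp [g20, gSize]
  refine ⟨by omega, ?_⟩
  set s2 := s1.setVar 21 m with hs2
  have hf2 : Frame 20 [aTree] s s2 := hf1'.setVar _ (by norm_num)
  have hrep2 : Rep s2 (unflag x σ) :=
    hrep1.frame (Frame.refl.setVar (X := 20) (L := []) _ (by norm_num)) (by simp)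
  refine Cmd.wp_call _ (wp_copyClass hW hrep2 (x := x) (m := m) ⟨w, hwx⟩ hm (by simp [hs2, g20])
    (by simp [hs2])) (by omega) ?_
  rintro r3 r3' s3 hr3 ⟨⟨e, he⟩, hv3, hf3⟩
  have hf3' : Frame 20 [aTree, aSpl] s s3 :=
    (hf2.mono le_rfl (by simp)).trans (hf3.mono (by norm_num) (by simp))
  have hcnt3 : ∀ b, s3.arr aCnt b = 0 := by rw [hf3'.2 _ (by simp)]; exact hs.cnt
  have hrep3 : Rep s3 (unflag x σ) := hrep2.frame hf3 (by simp)
  have hlen3 : s3.var vLen = 0 := by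
    rw [hv3]
    simpa [hs2] using hlen1
  have hbud1 : d * ((2 * K + 1950) * p + 17) ≤ d * ((2 * K + 2000) * p) :=
    Nat.mul_le_mul_left _ (by linarith [show (2 * K + 2000) * p = (2 * K + 1950) * p + 50 * p by ring])
  refine Cmd.wp_for d ((2 * K + 1950) * p) (fun j s' =>
    Rep s' (splits (((List.finRange d).take j).flatMap (lineSets subst {u | σ.c u = x})) (unflag x σ)) ∧
    s'.var vLen = 0 ∧ (∀ b, s'.arr aCnt b = 0) ∧
    Frame 22 [aCls, aEl, aPos, aSize, aList, aOld, aHit, aMov, aTree, aCnt] s3 s')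
    (by norm_num) (by simp) (by omega) ?_ ?_ ?_ ?_ ?_
  · refine ⟨?_, by simpa using hlen3, hcnt3, Frame.refl.setVar _ (by norm_num)⟩
    exact hrep3.frame (Frame.refl.setVar (X := 22) (L := []) _ (by norm_num)) (by simp)
  · intro j s' _ _
    exact ⟨show d < W by omega, rfl⟩
  · have h17 : Cmd.forCost (.lit d) = 17 := rfl
    rw [h17]
    omega
  · rintro j s' hj ⟨hr', hv, hI, hf⟩ h23
    have hfs : Frame 20 [aCls, aEl, aPos, aSize, aList, aOld, aHit, aMov, aTree, aSpl, aCnt] s s' :=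
      (hf3'.mono le_rfl (by simp)).trans (hf.mono (by norm_num) (by simp))
    have gP : s'.arr aPow j = n ^ j := by rw [hfs.2 _ (by simp)]; exact hs.pow j hj
    simp only [Cmd.wp_seq, Cmd.wp_asg]
    simp [h23, gP]
    set s4 := s'.setVar 24 (n ^ j) with hs4
    have hf4 : Frame 22 [] s' s4 := Frame.refl.setVar _ (by norm_num)
    have henv4 : Env n d s4 := hs.env.frame (hfs.trans (hf4.mono (by norm_num) (by simp))) (by norm_num)
    have he4 : SplRep s4 m e {u | σ.c u = x} :=
      he.frame (hf.trans (hf4.mono le_rfl (by simp))) (by norm_num) (by simp)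
    have hKp2 : n * (200 * (m + 1) + splitCost d + 40) ≤ 400 * p + K * p + 40 * p := by
      rw [← hK, show n * (200 * (m + 1) + K + 40) = 200 * (n * m) + 200 * n + K * n + 40 * n by ring, ← hp]
      have := Nat.mul_le_mul_left K hnp
      omega
    have hexp : (2 * K + 1950) * p = 2 * (K * p) + 1950 * p := by ring
    refine ⟨by omega, ?_⟩
    refine Cmd.wp_call _ (wp_countLines hW henv4 he4 (j := ⟨j, hj⟩) (by simp [hs4]) hI) (by omega) ?_
    rintro r5 r5' s5 hr5 ⟨hcnt5, hv5, ha5⟩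
    have hf5 : Frame 22 [aCnt] s4 s5 :=
      ⟨fun y hy => hv5 y (by omega) (by omega), fun a ha => ha5 a (by simpa using ha)⟩
    have hopen := openLines_le (n := n) (d := d) hcnt5
    have hv5' : s5.var vLen = 0 := by rw [hv5 _ (by norm_num) (by norm_num)]; simpa [hs4] using hv
    have hcred : lineCredit n d s5 ≤ K * p + 300 * p := by
      rw [lineCredit, hv5', ← hK, mul_zero, add_zero]
      calc (K + 300) * n * openLines n d s5 ≤ (K + 300) * n * m := Nat.mul_le_mul_left _ hopen
        _ = K * p + 300 * p := by rw [hp]; ring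
    refine Cmd.wp_call _ (wp_splitLines (σ := splits (((List.finRange d).take j).flatMap
      (lineSets subst {u | σ.c u = x})) (unflag x σ)) hW (henv4.frame hf5 (by norm_num))
      (he4.frame hf5 (by norm_num) (by simp)) (j := ⟨j, hj⟩) ?_ ((hr'.frame hf4 (by simp)).frame hf5 (by simp))
      hv5' hcnt5) (by omega) ?_
    · rw [hv5 _ (by norm_num) (by norm_num)]; simp [hs4]
    rintro r6 r6' s6 hr6 ⟨hr6', hv6, hc6, hf6⟩
    refine ⟨?_, ?_, by simpa using hv6, hc6, ?_⟩
    · rw [hf6.1 _ (by norm_num), hv5 _ (by norm_num) (by norm_num)]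
      simp [hs4, h23]
    · rw [List.take_succ_eq_append_getElem (by simpa using hj), List.flatMap_append, splits_append]
      simp only [List.flatMap_cons, List.flatMap_nil, List.append_nil, List.getElem_finRange]
      exact hr6'.frame (Frame.refl.setVar (X := 22) (L := []) _ (by norm_num)) (by simp)
    · exact (((hf.trans (hf4.mono le_rfl (by simp))).trans (hf5.mono le_rfl (by simp))).trans
        (hf6.mono (by norm_num) (by simp))).setVar _ (by norm_num)
  · rintro r s' ⟨hr', hv, hI, hf⟩ - -
    have hfs : Frame 20 [aCls, aEl, aPos, aSize, aList, aOld, aHit, aMov, aTree, aSpl, aCnt] s s' :=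
      (hf3'.mono le_rfl (by simp)).trans (hf.mono (by norm_num) (by simp))
    refine ⟨⟨hs.env.frame hfs (by norm_num), ?_, ?_, hv, hI⟩, hfs⟩
    · rw [hfs.2 _ (by simp)]; exact hs.pow
    · rw [List.take_of_length_le (by simp)] at hr'
      exact hr'

/-- Refine the partition until no class is pending. -/
def refineAll (d : ℕ) : Cmd :=
  .whl (.lt (.lit 0) (.get aTree (.lit d * .v vM)))
    (.seq (treeMin d) (.seq (.asg 20 (.v 52)) (refineClass d)))

/-- The time for refining is at most this factor times `n` times the potential. -/
def roundCost (d : ℕ) : ℕ := refineCost d + 200 * (d + 1)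

theorem wp_refineAll (hW : Params W n d) (hs : Ready s σ) :
    (refineAll d).wp W (fun r s' => Ready s' (refine subst (List.finRange d) σ) ∧
      roundCost d * (n * pot (refine subst (List.finRange d) σ)) ≤ r ∧
      Frame 20 [aCls, aEl, aPos, aSize, aList, aOld, aHit, aMov, aTree, aSpl, aCnt] s s')
      (roundCost d * (n * pot σ) + 20) s := by
  have hword := hW.word
  have hMle : n ^ d ≤ (d + 4) * n ^ d := Nat.le_mul_of_pos_left _ (by omega)
  have hdM : d * n ^ d ≤ (d + 4) * n ^ d := Nat.mul_le_mul_right _ (by omega)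
  have hn1 : 1 ≤ n := hW.pos
  refine ⟨by simp, fun r s' => ∃ τ : St (Fin d → Fin n), Ready s' τ ∧
    refine subst (List.finRange d) τ = refine subst (List.finRange d) σ ∧
    Frame 20 [aCls, aEl, aPos, aSize, aList, aOld, aHit, aMov, aTree, aSpl, aCnt] s s' ∧
    roundCost d * (n * pot τ) + 20 ≤ r, ⟨σ, hs, rfl, Frame.refl, le_rfl⟩, ?_⟩
  rintro r s' ⟨τ, hτ, href, hf, hr⟩
  have hne := hτ.rep.tree.nonempty_iff hW.pos
  have hids : (ids τ).Nonempty ↔ ∃ u, τ.p u := by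
    constructor
    · rintro ⟨x, hx⟩
      obtain ⟨u, hu, -⟩ := mem_ids.1 hx
      exact ⟨u, hu⟩
    · rintro ⟨u, hu⟩
      exact ⟨_, mem_ids.2 ⟨u, hu, rfl⟩⟩
  refine ⟨?_, ?_, fun hh => ?_, fun hh => ?_⟩
  · simp [hτ.env.tuples]
    omega
  · simp
    omega
  · have hp : ∃ u, τ.p u := by
      rw [← hids, ← hne]
      simpa [hτ.env.tuples] using hh
    obtain ⟨u, hu, hux⟩ := exists_minId hp
    have hmem : minId τ ∈ ids τ := mem_ids.2 ⟨u, hu, hux⟩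
    have hmin : ∀ x ∈ ids τ, minId τ ≤ x := fun x hx => Nat.sInf_le (mem_ids.1 hx)
    have hpot := hτ.rep.inv.pot_process (sub := subst) (List.finRange d) hp
    obtain ⟨m, hm⟩ : ∃ m, size τ.c (minId τ) = m := ⟨_, rfl⟩
    have hm1 : 1 ≤ m := by rw [← hm, ← hux]; exact size_pos _ _
    rw [hm] at hpot
    have hpot' := Nat.mul_le_mul_left (roundCost d) (Nat.mul_le_mul_left n hpot)
    have hexp : roundCost d * (n * m) = refineCost d * (n * m) + 200 * ((d + 1) * (n * m)) := by
      rw [roundCost]; ring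
    have hnm : (d + 1) * n ≤ (d + 1) * (n * m) :=
      Nat.mul_le_mul_left _ (Nat.le_mul_of_pos_right _ hm1)
    have hd1 : d + 1 ≤ (d + 1) * n := Nat.le_mul_of_pos_right _ hn1
    have hexp2 : (d + 1) * (80 * (n + 1)) = 80 * ((d + 1) * n) + 80 * (d + 1) := by ring
    rw [Nat.mul_add, Nat.mul_add] at hpot'
    have hcost : (Tst.lt (.lit 0) (.get aTree (.lit d * .v vM))).cost ≤ 12 := by simp
    rw [Cmd.wp_seq]
    refine Cmd.wp_call _ (wp_treeMin hW hτ.env hτ.rep.tree hmem hmin) (by omega) ?_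
    rintro r1 r1' s1 hr1 ⟨h52, hf1⟩
    simp only [Cmd.wp_seq, Cmd.wp_asg]
    simp
    refine ⟨by omega, ?_⟩
    have hf2 : Frame 20 [] s' (s1.setVar 20 (s1.var 52)) :=
      (hf1.mono (by norm_num) (by simp)).setVar _ (by norm_num)
    refine Cmd.wp_call _ (wp_refineClass (σ := τ) hW ⟨hτ.env.frame hf2 (by norm_num), ?_,
      hτ.rep.frame hf2 (by simp), ?_, ?_⟩ hmem (by simp [h52])) (by rw [hm]; omega) ?_
    · rw [hf2.2 _ (by simp)]; exact hτ.pow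
    · rw [Store.var_setVar, if_neg (by norm_num), hf1.1 _ (by norm_num)]; exact hτ.len
    · rw [hf2.2 _ (by simp)]; exact hτ.cnt
    · rintro r2 r2' s3 hr2 ⟨hs3, hf3⟩
      refine ⟨_, hs3, ?_, ?_, ?_⟩
      · rw [hτ.rep.inv.refine_process _ hp, href]
      · exact (hf.trans (hf2.mono le_rfl (by simp))).trans hf3
      · rw [hm] at hr2
        omega
  · have hp : ¬ ∃ u, τ.p u := by
      rw [← hids, ← hne]
      simpa [hτ.env.tuples] using hh
    rw [← href, refine_of_not hp]
    refine ⟨hτ, ?_, hf⟩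
    simp
    omega

end

/-! ### The main program -/

section
variable {W d : ℕ} {G : ColouredGraph} {s : Store}

/-- The store holds the graph `G`. -/
structure HasGraph (s : Store) (G : ColouredGraph) : Prop where
  order : s.var vN = G.order
  colour : ∀ v : Fin G.order, s.arr 0 v = G.colour v
  adj : ∀ u v : Fin G.order, s.arr 1 (G.order * u + v) = if G.graph.Adj u v then 1 else 0

theorem HasGraph.frame {X : ℕ} {L : List ℕ} {s' : Store} (h : HasGraph s G) (hf : Frame X L s s')
    (hX : 1 ≤ X) (h0 : 0 ∉ L) (h1 : 1 ∉ L) : HasGraph s' G :=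
  ⟨(hf.1 _ hX).trans h.order, by rw [hf.2 _ h0]; exact h.colour, by rw [hf.2 _ h1]; exact h.adj⟩

theorem mul_add_inj {n : ℕ} {u v u' v' : Fin n} (h : n * (u : ℕ) + v = n * u' + v') :
    u = u' ∧ v = v' := by
  rw [mul_comm, mul_comm n] at h
  obtain ⟨h1, h2⟩ := eq_of_mul_add_eq v.2 v'.2 h
  exact ⟨Fin.ext h1, Fin.ext h2⟩

theorem mul_add_lt {n : ℕ} (u v : Fin n) : n * (u : ℕ) + v < n * n := by
  have h1 := u.2
  have h2 := v.2
  calc n * (u : ℕ) + v < n * u + n := by omega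
    _ = n * (u + 1) := by ring
    _ ≤ n * n := Nat.mul_le_mul_left _ h1

theorem hasGraph_input (G : ColouredGraph) : HasGraph (input G) G := by
  refine ⟨by simp [input], fun v => by simp [input], fun u v => ?_⟩
  simp only [input, if_neg one_ne_zero, if_true]
  congr 1
  simp only [eq_iff_iff]
  refine ⟨?_, fun h => ⟨u, v, h, rfl⟩⟩
  rintro ⟨u', v', h, h'⟩
  obtain ⟨rfl, rfl⟩ := mul_add_inj h'
  exact h

/-- Compute the powers of `n`, the number of tuples, and the number of the tuple `(1, …, 1)`. -/
def computePowers (d : ℕ) : Cmd :=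
  .seq (.asg 3 (.lit 1)) (.seq (.asg 2 (.lit 0)) (.seq
    (.for' 4 (.lit d) (.seq (.wr aPow (.v 4) (.v 3)) (.seq (.asg 2 (.v 2 + .v 3))
      (.asg 3 (.v 3 * .v vN)))))
    (.asg vM (.v 3))))

/-- The number of the tuple `(1, …, 1)`. -/
def diagFactor (n d : ℕ) : ℕ := ∑ i ∈ range d, n ^ i

theorem code_diag {n : ℕ} (v : Fin n) : code (diag d v) = v * diagFactor n d := by
  rw [code_eq_sum, diagFactor, mul_sum]
  exact Fin.sum_univ_eq_sum_range (fun j => (v : ℕ) * n ^ j) d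

theorem sum_pow_le {n j : ℕ} (hn : 0 < n) (hj : j ≤ d) : ∑ i ∈ range j, n ^ i ≤ d * n ^ d := by
  calc ∑ i ∈ range j, n ^ i ≤ ∑ i ∈ range j, n ^ d := sum_le_sum fun i hi => by
        rw [mem_range] at hi
        exact Nat.pow_le_pow_right hn (by omega)
    _ = j * n ^ d := by simp
    _ ≤ _ := Nat.mul_le_mul_right _ hj

theorem wp_computePowers {n : ℕ} (hW : Params W n d) (h0 : s.var vN = n) :
    (computePowers d).wp W (fun _ s' => s'.var vM = n ^ d ∧ s'.var 2 = diagFactor n d ∧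
      (∀ j < d, s'.arr aPow j = n ^ j) ∧ Frame 1 [aPow] s s') (100 * (d + 1)) s := by
  have hword := hW.word
  have hd := hW.dim
  have hn := hW.pos
  have hexp : (d + 4) * n ^ d = d * n ^ d + 4 * n ^ d := by ring
  simp only [computePowers, Cmd.wp_seq, Cmd.wp_asg]
  simp
  refine ⟨by omega, by omega, by omega, by omega, ?_⟩
  refine Cmd.wp_for d 60 (fun j s' => s'.var 3 = n ^ j ∧ s'.var 2 = ∑ i ∈ range j, n ^ i ∧
    (∀ i < j, s'.arr aPow i = n ^ i) ∧ Frame 1 [aPow] s s') (by norm_num) (by simp) (by omega) ?_ ?_ ?_ ?_ ?_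
  · refine ⟨by simp, by simp, by simp, ?_⟩
    exact ((Frame.refl.setVar _ (by norm_num)).setVar _ (by norm_num)).setVar _ (by norm_num)
  · intro j s' _ _
    exact ⟨show d < W by omega, rfl⟩
  · simp only [Cmd.forCost, Ex.cost_lit, Ex.depth_lit]
    omega
  · rintro j s' hj ⟨h3, h2, hI, hf⟩ h4
    have g0 : s'.var vN = n := (hf.1 _ (by norm_num)).trans h0
    have hp : n ^ j * n ≤ n ^ d := by
      rw [← pow_succ]
      exact Nat.pow_le_pow_right hn hj
    have hs : ∑ i ∈ range j, n ^ i + n ^ j ≤ d * n ^ d := by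
      rw [← sum_range_succ]
      exact sum_pow_le hn hj
    simp [h4, h3, h2, g0]
    refine ⟨by omega, by omega, by rw [pow_succ], by rw [sum_range_succ], fun i hi => ?_, ?_⟩
    · split_ifs with h
      · rw [h]
      · exact hI i (by omega)
    · exact (((hf.setArr _ _ (by simp)).setVar _ (by norm_num)).setVar _ (by norm_num)).setVar _
        (by norm_num)
  · rintro r s' ⟨h3, h2, hI, hf⟩ - hr
    have hfc : Cmd.forCost (.lit d) = 17 := rfl
    rw [hfc] at hr
    simp
    exact ⟨by omega, h3, h2, hI, hf.setVar _ le_rfl⟩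

/-- Compute the types of the pairs of vertices. -/
def computeTypes : Cmd :=
  .for' 4 (.v vN) (.seq (.asg 5 (.lit 0)) (.seq
    (.for' 6 (.v vN) (.ite (.lt (.get 0 (.v 6)) (.get 0 (.v 4))) (.asg 5 (.v 5 + .lit 1)) .skip))
    (.for' 6 (.v vN) (.ite (.eq (.v 4) (.v 6)) (.wr aType (.v vN * .v 4 + .v 6) (.v 5 + .lit 2))
      (.wr aType (.v vN * .v 4 + .v 6) (.get 1 (.v vN * .v 4 + .v 6)))))))

theorem card_filter_lt_succ {n j : ℕ} (P : Fin n → Prop) [DecidablePred P] (hj : j < n) :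
    #{x : Fin n | (x : ℕ) < j + 1 ∧ P x} = #{x : Fin n | (x : ℕ) < j ∧ P x} + if P ⟨j, hj⟩ then 1 else 0 := by
  have h1 : ∀ x : Fin n, (x : ℕ) < j + 1 ↔ x = ⟨j, hj⟩ ∨ (x : ℕ) < j := fun x => by
    rw [Fin.ext_iff]; dsimp only; omega
  split_ifs with h
  · rw [← card_insert_of_notMem (s := {x : Fin n | (x : ℕ) < j ∧ P x}) (a := ⟨j, hj⟩) (by simp)]
    congr 1
    ext x
    simp only [h1, mem_filter, mem_univ, true_and, mem_insert]
    constructor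
    · rintro ⟨h2 | h2, h3⟩
      · exact Or.inl h2
      · exact Or.inr ⟨h2, h3⟩
    · rintro (rfl | ⟨h2, h3⟩)
      · exact ⟨Or.inl rfl, h⟩
      · exact ⟨Or.inr h2, h3⟩
  · rw [add_zero]
    congr 1
    ext x
    simp only [h1, mem_filter, mem_univ, true_and]
    constructor
    · rintro ⟨rfl | h2, h3⟩
      · exact absurd h3 h
      · exact ⟨h2, h3⟩
    · rintro ⟨h2, h3⟩
      exact ⟨Or.inr h2, h3⟩

/-- The number of vertices of smaller colour among the first `j` vertices. -/
def rankUpTo (G : ColouredGraph) (v : Fin G.order) (j : ℕ) : ℕ :=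
  #{x : Fin G.order | (x : ℕ) < j ∧ G.colour x < G.colour v}

theorem rankUpTo_succ (v : Fin G.order) {j : ℕ} (hj : j < G.order) : rankUpTo G v (j + 1) =
    rankUpTo G v j + if G.colour ⟨j, hj⟩ < G.colour v then 1 else 0 := by
  have := card_filter_lt_succ (fun x => G.colour x < G.colour v) hj
  exact this

theorem rankUpTo_le (v : Fin G.order) (j : ℕ) : rankUpTo G v j ≤ G.order :=
  (card_le_univ _).trans (Fintype.card_fin _).le

theorem wp_computeTypes (hW : Params W G.order d) (hs : HasGraph s G) :
    computeTypes.wp W (fun _ s' => (∀ u v : Fin G.order,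
      s'.arr aType (G.order * u + v) = pairType G u v) ∧ Frame 4 [aType] s s')
      (300 * (G.order * G.order + 1)) s := by
  have hword := hW.word
  have hd := hW.dim
  have hn0 := hW.pos
  have hMle : G.order ^ d ≤ (d + 4) * G.order ^ d := Nat.le_mul_of_pos_left _ (by omega)
  have hnM : G.order * G.order ≤ G.order ^ d := by
    rw [← pow_two]
    exact Nat.pow_le_pow_right hn0 hd
  have hnn : G.order ≤ G.order * G.order := Nat.le_mul_of_pos_left _ hn0
  have hbud : G.order * (150 * G.order + 80 + 17) = 150 * (G.order * G.order) + 97 * G.order := by ring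
  have h17 : Cmd.forCost (.v vN) = 17 := rfl
  refine Cmd.wp_for G.order (150 * G.order + 80) (fun i s' => (∀ u v : Fin G.order, (u : ℕ) < i →
      s'.arr aType (G.order * u + v) = pairType G u v) ∧ Frame 4 [aType] s s')
    (by norm_num) (by simp) (by omega) ?_ ?_ ?_ ?_ ?_
  · exact ⟨by simp, Frame.refl.setVar _ le_rfl⟩
  · rintro i s' ⟨-, hf⟩ -
    exact ⟨trivial, (hf.1 _ (by norm_num)).trans hs.order⟩
  · rw [h17]
    omega
  · rintro i s' hi ⟨hI, hf⟩ h4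
    simp only [Cmd.wp_seq, Cmd.wp_asg]
    simp
    refine ⟨by omega, ?_⟩
    refine Cmd.wp_for G.order 40 (fun j s1 =>
      s1.var 5 = rankUpTo G ⟨i, hi⟩ j ∧
      s1.arr = s'.arr ∧ Frame 4 [aType] s s1 ∧ s1.var 4 = i) (by norm_num) (by simp) (by omega) ?_ ?_ ?_ ?_ ?_
    · exact ⟨by simp [rankUpTo], rfl, (hf.setVar _ (by norm_num)).setVar _ (by norm_num), by simp [h4]⟩
    · rintro j s1 ⟨-, -, hf1, -⟩ -
      exact ⟨trivial, (hf1.1 _ (by norm_num)).trans hs.order⟩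
    · rw [h17]
      omega
    · rintro j s1 hj ⟨h5, ha, hf1, g4⟩ h6
      have hg := hs.frame hf1 (by norm_num) (by simp) (by simp)
      have c1 : s1.arr 0 j = G.colour ⟨j, hj⟩ := hg.colour ⟨j, hj⟩
      have c2 : s1.arr 0 i = G.colour ⟨i, hi⟩ := hg.colour ⟨i, hi⟩
      have hle := rankUpTo_le (⟨i, hi⟩ : Fin G.order) j
      have hsucc := rankUpTo_succ (⟨i, hi⟩ : Fin G.order) hj
      simp [h6, g4, c1, c2, h5]
      refine ⟨fun hc => ⟨by omega, ?_, ha, ?_⟩, fun hc => ⟨?_, ha, ?_⟩⟩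
      · rw [hsucc, if_pos hc]
      · exact (hf1.setVar _ (by norm_num)).setVar _ (by norm_num)
      · rw [hsucc, if_neg (by omega)]
        rfl
      · exact hf1.setVar _ (by norm_num)
    · rintro r1 s1 ⟨h5, ha, hf1, g4⟩ - hr1
      have h5' : s1.var 5 = colourRank G ⟨i, hi⟩ := by rw [h5]; simp [rankUpTo, colourRank]
      have hrank := colourRank_lt (G := G) ⟨i, hi⟩
      rw [h17] at hr1
      refine Cmd.wp_for G.order 60 (fun j s2 => (∀ u v : Fin G.order,
          (u : ℕ) < i ∨ (u : ℕ) = i ∧ (v : ℕ) < j →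
          s2.arr aType (G.order * u + v) = pairType G u v) ∧ Frame 4 [aType] s s2 ∧ s2.var 4 = i ∧
          s2.var 5 = colourRank G ⟨i, hi⟩) (by norm_num) (by simp) (by omega) ?_ ?_ ?_ ?_ ?_
      · refine ⟨?_, hf1.setVar _ (by norm_num), by simp [g4], by simp [h5']⟩
        intro u v h
        rw [Store.arr_setVar, ha]
        exact hI u v (by omega)
      · rintro j s2 ⟨-, hf2, -⟩ -
        exact ⟨trivial, (hf2.1 _ (by norm_num)).trans hs.order⟩
      · rw [h17]
        omega
      · rintro j s2 hj ⟨hI2, hf2, k4, k5⟩ h6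
        have hg := hs.frame hf2 (by norm_num) (by simp) (by simp)
        have hlt := mul_add_lt (⟨i, hi⟩ : Fin G.order) ⟨j, hj⟩
        have hadj := hg.adj ⟨i, hi⟩ ⟨j, hj⟩
        simp only at hlt hadj
        simp [h6, k4, k5, hg.order, hadj]
        have key : ∀ m, m = pairType G ⟨i, hi⟩ ⟨j, hj⟩ → ∀ u v : Fin G.order,
            (u : ℕ) < i ∨ (u : ℕ) = i ∧ (v : ℕ) < j + 1 →
            (if G.order * (u : ℕ) + v = G.order * i + j then m else s2.arr aType (G.order * u + v)) =
              pairType G u v := by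
          rintro m rfl u v h
          split_ifs with h1
          · obtain ⟨rfl, rfl⟩ := mul_add_inj (u' := ⟨i, hi⟩) (v' := ⟨j, hj⟩) h1
            rfl
          · refine hI2 u v (h.imp_right fun h => ⟨h.1, ?_⟩)
            by_contra h2
            have h3 : (v : ℕ) = j := by omega
            rw [h.1, h3] at h1
            exact h1 rfl
        have hpt : pairType G ⟨i, hi⟩ ⟨j, hj⟩ = if i = j then colourRank G ⟨i, hi⟩ + 2 else
            if G.graph.Adj ⟨i, hi⟩ ⟨j, hj⟩ then 1 else 0 := by
          simp [pairType]
        refine ⟨fun hc => ?_, fun hc => ?_⟩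
        · refine ⟨by omega, fun u v h => key _ ?_ u v (h.imp_right (And.imp_right Nat.lt_succ_of_le)), ?_⟩
          · rw [hpt, if_pos hc]
          · exact (hf2.setArr _ _ (by simp)).setVar _ (by norm_num)
        · refine ⟨by omega, fun u v h => key _ ?_ u v (h.imp_right (And.imp_right Nat.lt_succ_of_le)), ?_⟩
          · rw [hpt, if_neg hc]
          · exact (hf2.setArr _ _ (by simp)).setVar _ (by norm_num)
      · rintro r2 s2 ⟨hI2, hf2, k4, k5⟩ - -
        refine ⟨k4, fun u v h => ?_, hf2.setVar _ le_rfl⟩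
        exact hI2 u v (by have := v.2; omega)
  · rintro r s' ⟨hI, hf⟩ - -
    exact ⟨fun u v => hI u v u.2, hf⟩

end

section
variable {W d n : ℕ} {s : Store}

/-- Fill the first entries of an array. -/
theorem wp_fill {x a : ℕ} {e f : Ex} {Q : ℕ → Store → Prop} {T : ℕ} (N : ℕ) (F : ℕ → ℕ) (hx : x < 1000)
    (he : e.Fits) (hf : f.Fits) (hW : N + 1 < W)
    (heN : ∀ s', (∀ y ≠ x, s'.var y = s.var y) → (∀ b ≠ a, s'.arr b = s.arr b) →
      e.Ok W s' ∧ e.eval s' = N)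
    (hF : ∀ i < N, ∀ s', s'.var x = i → (∀ y ≠ x, s'.var y = s.var y) →
      (∀ b ≠ a, s'.arr b = s.arr b) → f.Ok W s' ∧ f.eval s' = F i)
    (hT : N * (f.cost + f.depth + 20 + Cmd.forCost e) + Cmd.forCost e ≤ T)
    (hQ : ∀ r s', (∀ i < N, s'.arr a i = F i) → (∀ y ≠ x, s'.var y = s.var y) →
      (∀ b ≠ a, s'.arr b = s.arr b) →
      T - (N * (f.cost + f.depth + 20 + Cmd.forCost e) + Cmd.forCost e) ≤ r → Q r s') :
    (Cmd.for' x e (.wr a (.v x) f)).wp W Q T s := by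
  refine Cmd.wp_for N (f.cost + f.depth + 20) (fun i s' => (∀ i' < i, s'.arr a i' = F i') ∧
    (∀ y ≠ x, s'.var y = s.var y) ∧ ∀ b ≠ a, s'.arr b = s.arr b) hx he hW ?_ ?_ hT ?_ ?_
  · exact ⟨by simp, fun y hy => by simp [hy], fun _ _ => rfl⟩
  · rintro i s' ⟨-, hv, ha⟩ -
    exact heN s' hv ha
  · rintro i s' hi ⟨hI, hv, ha⟩ hs'
    obtain ⟨hok, hev⟩ := hF i hi s' hs' hv ha
    simp only [Cmd.wp_wr, Tst.fits_lt, Tst.ok_lt, Tst.cost_lt, Ex.fits_v, Ex.ok_v, Ex.cost_v,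
      Ex.depth_v, Ex.eval_v, hs', hev]
    refine ⟨⟨hx, hf⟩, ⟨trivial, hok⟩, by omega, hs', fun i' hi' => ?_, fun y hy => ?_, fun b hb => ?_⟩
    · simp only [Store.arr_setVar, Store.arr_setArr_self]
      split_ifs with h
      · rw [h]
      · exact hI i' (by omega)
    · simp [hy, hv y hy]
    · simp [hb, ha b hb]
  · rintro r s' ⟨hI, hv, ha⟩ - hr
    exact hQ r s' hI hv ha hr

/-- Initialise the trivial partition. -/
def initPartition (d : ℕ) : Cmd :=
  .seq (.for' 4 (.v vM) (.wr aEl (.v 4) (.v 4))) (.seq (.for' 4 (.v vM) (.wr aPos (.v 4) (.v 4)))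
    (.seq (.wr aSize (.lit 0) (.v vM)) (.seq (.asg vLen (.lit 0)) (.seq (.asg 50 (.lit 0))
      (treeInsert d)))))

theorem wp_initPartition (hW : Params W n d) (hs : Env n d s) (hpow : ∀ j < d, s.arr aPow j = n ^ j)
    (hz : ∀ a ∈ [aCls, aHit, aMov, aTree, aCnt], ∀ j, s.arr a j = 0) :
    (initPartition d).wp W (fun _ s' => Ready s' (trivialSt (Fin d → Fin n)) ∧
      Frame 4 [aEl, aPos, aSize, aTree] s s') (splitCost d + 100 * n ^ d) s := by
  have hword := hW.word
  have hMle : n ^ d ≤ (d + 4) * n ^ d := Nat.le_mul_of_pos_left _ (by omega)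
  have hM : 0 < n ^ d := pow_pos hW.pos d
  have hKd : splitCost d = 80 * (d + 2) + 700 := rfl
  have h17 : Cmd.forCost (.v vM) = 17 := rfl
  have htup : Nonempty (Fin d → Fin n) := ⟨fun _ => ⟨0, hW.pos⟩⟩
  simp only [initPartition, Cmd.wp_seq]
  refine wp_fill (n ^ d) id (by norm_num) (by simp) (by simp) (by omega)
    (fun s' hv _ => ⟨trivial, (hv _ (by norm_num)).trans hs.tuples⟩) (fun i _ s' h4 _ _ => ⟨trivial, h4⟩)
    ?_ ?_
  · rw [h17]
    simp
    omega
  intro r1 s1 hel hv1 ha1 hr1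
  rw [h17] at hr1
  simp at hr1
  refine wp_fill (n ^ d) id (by norm_num) (by simp) (by simp) (by omega)
    (fun s' hv _ => ⟨trivial, (hv _ (by norm_num)).trans ((hv1 _ (by norm_num)).trans hs.tuples)⟩)
    (fun i _ s' h4 _ _ => ⟨trivial, h4⟩) ?_ ?_
  · rw [h17]
    simp
    omega
  intro r2 s2 hpos hv2 ha2 hr2
  rw [h17] at hr2
  simp at hr2
  have g1 : s2.var vM = n ^ d := by rw [hv2 _ (by norm_num), hv1 _ (by norm_num)]; exact hs.tuples
  have hf2 : Frame 4 [aEl, aPos] s s2 := by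
    refine ⟨fun y hy => ?_, fun b hb => ?_⟩
    · rw [hv2 _ (by omega), hv1 _ (by omega)]
    · simp only [List.mem_cons, List.not_mem_nil, or_false, not_or] at hb
      rw [ha2 _ hb.2, ha1 _ hb.1]
  simp [g1]

  refine ⟨by omega, by omega, by omega, by omega, by omega, by omega, ?_⟩
  set s3 := ((s2.setArr aSize 0 (n ^ d)).setVar vLen 0).setVar 50 0 with hs3
  have hf3 : Frame 4 [aEl, aPos, aSize] s s3 :=
    (((hf2.mono le_rfl (by simp)).setArr _ _ (by simp)).setVar _ (by norm_num)).setVar _ (by norm_num)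
  have ht3 : TreeRep n d s3 ∅ := by
    refine ⟨by simp, fun l _ q _ => ?_⟩
    rw [hf3.2 _ (by simp), hz _ (by simp)]
    simp
  refine Cmd.wp_call _ (wp_treeInsert hW (hs.frame hf3 (by norm_num)) ht3 (x := 0) (by simp [hs3]) hM
    (by simp)) (by omega) ?_
  rintro r4 r4' s4 hr4 ⟨ht4, hf4⟩
  have hf : Frame 4 [aEl, aPos, aSize, aTree] s s4 :=
    (hf3.mono le_rfl (by simp)).trans (hf4.mono (by norm_num) (by simp))
  have hsz : ∀ x, s4.arr aSize x = if x = 0 then n ^ d else s2.arr aSize x := fun x => by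
    rw [hf4.2 _ (by simp)]
    simp [hs3]
  have hpos4 : ∀ u : Fin d → Fin n, s4.arr aPos (code u) = code u := fun u => by
    rw [hf4.2 _ (by simp)]
    exact hpos _ (code_lt u)
  have hel4 : ∀ u : Fin d → Fin n, s4.arr aEl (code u) = code u := fun u => by
    rw [hf4.2 _ (by simp)]
    change s2.arr aEl (code u) = code u
    rw [ha2 _ (by norm_num)]
    exact hel _ (code_lt u)
  have hsize : size (trivialSt (Fin d → Fin n)).c 0 = n ^ d := by
    rw [size, filter_true_of_mem (p := fun u => (trivialSt (Fin d → Fin n)).c u = 0) (fun _ _ => rfl),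
      card_univ, Fintype.card_fun, Fintype.card_fin, Fintype.card_fin]
  refine ⟨⟨hs.frame hf (by norm_num), ?_, ⟨inv_trivialSt, ⟨fun u => ?_, fun u => ?_, fun u => ?_, fun u => ?_,
    fun u => ?_⟩, ?_, ?_, ?_⟩, ?_, ?_⟩, hf⟩
  · rw [hf.2 _ (by simp)]; exact hpow
  · rw [hf.2 _ (by simp)]; exact hz _ (by simp) _
  · change s4.arr aSize 0 = size (trivialSt (Fin d → Fin n)).c 0
    rw [hsz, if_pos rfl, hsize]
  · rw [hpos4, hel4]
  · exact Nat.zero_le _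
  · change s4.arr aPos (code u) < 0 + size (trivialSt (Fin d → Fin n)).c 0
    rw [hpos4, hsize, zero_add]
    exact code_lt u
  · have : ids (trivialSt (Fin d → Fin n)) = insert 0 ∅ := by
      ext x
      simp [mem_ids, trivialSt, eq_comm]
    rw [this]
    exact ht4
  · rw [hf.2 _ (by simp)]; exact hz _ (by simp)
  · rw [hf.2 _ (by simp)]; exact hz _ (by simp)
  · rw [hf4.1 _ (by norm_num)]
    simp [hs3]
  · rw [hf.2 _ (by simp)]; exact hz _ (by simp)

theorem Ready.setVar {σ : St (Fin d → Fin n)} (h : Ready s σ) {x : ℕ} (m : ℕ) (hx : 2 ≤ x)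
    (hx' : x ≠ vLen) : Ready (s.setVar x m) σ := by
  have hf : Frame 2 [] s (s.setVar x m) := Frame.refl.setVar _ hx
  refine ⟨h.env.frame hf le_rfl, h.pow, h.rep.frame hf (by simp), ?_, h.cnt⟩
  rw [Store.var_setVar, if_neg hx'.symm]
  exact h.len

theorem wp_splitReady {σ : St (Fin d → Fin n)} {A : Set (Fin d → Fin n)} {s' : Store}
    (hW : Params W n d) (hs : Ready s σ) {L : List ℕ} (hf : Frame 2 L s s') 
    (hL : ∀ x ∈ [aCls, aEl, aPos, aSize, aHit, aMov, aTree, aCnt, aPow], x ∉ L) (hl : ListOf s' A) :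
    (splitClasses d).wp W (fun _ s'' => Ready s'' (split A σ) ∧
      Frame 40 [aCls, aEl, aPos, aSize, aOld, aHit, aMov, aTree] s' s'')
      (splitCost d * (s'.var vLen + 1)) s' := by
  refine Cmd.wp_mono _ ?_ (wp_splitClasses' hW (hs.env.frame hf le_rfl)
    (hs.rep.frame hf fun x hx => hL x (by simp at hx ⊢; tauto)) hl)
  rintro r s'' ⟨hr, hv, hf'⟩
  refine ⟨⟨(hs.env.frame hf le_rfl).frame hf' (by norm_num), ?_, hr, hv, ?_⟩, hf'⟩
  · rw [hf'.2 _ (by simp), hf.2 _ (hL _ (by simp))]; exact hs.pow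
  · rw [hf'.2 _ (by simp), hf.2 _ (hL _ (by simp))]; exact hs.cnt

end

section
variable {W d : ℕ} {G : ColouredGraph} {s : Store}

/-- The tables that are computed at the beginning. -/
structure Tables (d : ℕ) (s : Store) (G : ColouredGraph) : Prop where
  graph : HasGraph s G
  diag : s.var 2 = diagFactor G.order d
  type : ∀ u v : Fin G.order, s.arr aType (G.order * u + v) = pairType G u v

theorem Tables.frame {X : ℕ} {L : List ℕ} {s' : Store} (h : Tables d s G) (hf : Frame X L s s')
    (hX : 3 ≤ X) (hL : ∀ x ∈ [0, 1, aType], x ∉ L) : Tables d s' G :=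
  ⟨h.graph.frame hf (by omega) (hL _ (by simp)) (hL _ (by simp)), (hf.1 _ (by omega)).trans h.diag,
    by rw [hf.2 _ (hL _ (by simp))]; exact h.type⟩

/-- Append the tuples in which the entries `v 4` and `v 5` have type `v 6` to the list. -/
def pushTypes : Cmd :=
  .for' 7 (.v vM) (.ite (.eq (.get aType (.v vN * (.v 7 / .get aPow (.v 4) % .v vN) +
      .v 7 / .get aPow (.v 5) % .v vN)) (.v 6))
    (.seq (.wr aList (.v vLen) (.v 7)) (.asg vLen (.v vLen + .lit 1)))
    .skip)

theorem wp_pushTypes (hW : Params W G.order d) (hs : Tables d s G) (henv : Env G.order d s)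
    (hpow : ∀ j < d, s.arr aPow j = G.order ^ j) (hlen : s.var vLen = 0) {a b : Fin d} {q : ℕ}
    (h4 : s.var 4 = a) (h5 : s.var 5 = b) (h6 : s.var 6 = q) :
    pushTypes.wp W (fun _ s' => ListOf s' (pairTypeSet d G a b q) ∧ Frame 7 [aList] s s')
      (150 * (G.order ^ d + 1)) s := by
  have hword := hW.word
  have hMle : G.order ^ d ≤ (d + 4) * G.order ^ d := Nat.le_mul_of_pos_left _ (by omega)
  have hnM : G.order * G.order ≤ G.order ^ d := by
    rw [← pow_two]
    exact Nat.pow_le_pow_right hW.pos hW.dim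
  refine Cmd.wp_for (G.order ^ d) 100 (fun i s' =>
    ListOf s' {u | code u < i ∧ u ∈ pairTypeSet d G a b q} ∧ Frame 7 [aList] s s')
    (by norm_num) (by simp) (by omega) ?_ ?_ ?_ ?_ ?_
  · refine ⟨?_, Frame.refl.setVar _ le_rfl⟩
    have : {u | code u < 0 ∧ u ∈ pairTypeSet d G a b q} = ∅ := by ext; simp
    rw [this]
    exact listOf_empty hW.pos (by simpa using hlen)
  · rintro i s' ⟨-, hf⟩ -
    exact ⟨trivial, (henv.frame hf (by norm_num)).tuples⟩
  · simp only [Cmd.forCost, Ex.cost_v, Ex.depth_v]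
    omega
  · rintro i s' hi ⟨hl, hf⟩ h7
    obtain ⟨u, rfl⟩ := exists_code hi
    have henv' := henv.frame hf (by norm_num)
    have k4 : s'.var 4 = a := (hf.1 _ (by norm_num)).trans h4
    have k5 : s'.var 5 = b := (hf.1 _ (by norm_num)).trans h5
    have k6 : s'.var 6 = q := (hf.1 _ (by norm_num)).trans h6
    have p4 : s'.arr aPow a = G.order ^ (a : ℕ) := by rw [hf.2 _ (by simp)]; exact hpow a a.2
    have p5 : s'.arr aPow b = G.order ^ (b : ℕ) := by rw [hf.2 _ (by simp)]; exact hpow b b.2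
    have ht := (hs.frame hf (by norm_num) (by simp)).type (u a) (u b)
    have hlt := mul_add_lt (u a) (u b)
    have hle := hl.le
    simp [h7, k4, k5, k6, p4, p5, henv'.order, digit_eq, ht]
    have hset : ∀ w : Fin d → Fin G.order, code w ≤ code u ↔ w = u ∨ code w < code u := by
      intro w
      rw [← code_inj]
      omega
    refine ⟨by omega, fun hq => ⟨by omega, ?_, ?_⟩, fun hq => ⟨?_, ?_⟩⟩
    · have := hl.push (u := u) (s' := ((s'.setArr aList (s'.var vLen) (code u)).setVar vLen
        (s'.var vLen + 1)).setVar 7 (code u + 1)) (by simp) (by simp) (by simp)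
      convert this using 1
      ext w
      simp only [Set.mem_ofPred_eq, Set.mem_insert_iff, hset]
      constructor
      · rintro ⟨rfl | h1, h2⟩
        · exact Or.inl rfl
        · exact Or.inr ⟨h1, h2⟩
      · rintro (rfl | ⟨h1, h2⟩)
        · exact ⟨Or.inl rfl, hq⟩
        · exact ⟨Or.inr h1, h2⟩
    · exact ((hf.setArr _ _ (by simp)).setVar _ (by norm_num)).setVar _ (by norm_num)
    · refine ListOf.congr (s := s') ?_ (by simp) rfl
      convert hl using 1
      ext w
      simp only [Set.mem_ofPred_eq, hset]
      constructor
      · rintro ⟨rfl | h1, h2⟩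
        · exact absurd h2 hq
        · exact ⟨h1, h2⟩
      · rintro ⟨h1, h2⟩
        exact ⟨Or.inr h1, h2⟩
    · exact hf.setVar _ (by norm_num)
  · rintro r s' ⟨hl, hf⟩ - -
    refine ⟨?_, hf⟩
    convert hl using 1
    ext u
    simp [code_lt]

end

section
variable {W d : ℕ} {G : ColouredGraph} {s : Store} {σ : St (Fin d → Fin G.order)}

/-- Split the classes by the types of the pairs of entries. -/
def splitTypes (d : ℕ) : Cmd :=
  .for' 4 (.lit d) (.for' 5 (.lit d) (.for' 6 (.v vN + .lit 2) (.seq pushTypes (splitClasses d))))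

/-- The time for splitting the classes by the types of one pair of entries. -/
def typesCost (d n : ℕ) : ℕ := (n + 2) * ((150 + splitCost d) * (n ^ d + 1) + 20) + 20

theorem wp_splitTypes₁ (hW : Params W G.order d) (hs : Tables d s G) (hr : Ready s σ) {a b : Fin d}
    (h4 : s.var 4 = a) (h5 : s.var 5 = b) :
    (Cmd.for' 6 (.v vN + .lit 2) (.seq pushTypes (splitClasses d))).wp W (fun _ s' =>
      Ready s' (splits ((List.range (G.order + 2)).map (pairTypeSet d G a b)) σ) ∧
      Frame 6 [aCls, aEl, aPos, aSize, aList, aOld, aHit, aMov, aTree] s s')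
      (typesCost d G.order) s := by
  have hword := hW.word
  have hMle : G.order ^ d ≤ (d + 4) * G.order ^ d := Nat.le_mul_of_pos_left _ (by omega)
  have hnM : G.order ≤ G.order ^ d := Nat.le_self_pow (by have := hW.dim; omega) _
  have h20 : Cmd.forCost (.v vN + .lit 2) = 20 := rfl
  refine Cmd.wp_for (G.order + 2) ((150 + splitCost d) * (G.order ^ d + 1)) (fun q s' =>
      Ready s' (splits ((List.range q).map (pairTypeSet d G a b)) σ) ∧
      Frame 6 [aCls, aEl, aPos, aSize, aList, aOld, aHit, aMov, aTree] s s')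
    (by norm_num) (by simp) (by omega) ?_ ?_ ?_ ?_ ?_
  · exact ⟨hr.setVar _ (by norm_num) (by norm_num), Frame.refl.setVar _ le_rfl⟩
  · rintro q s' ⟨hr', -⟩ -
    have := hr'.env.order
    simp [this]
    omega
  · rw [h20]
    exact le_rfl
  · rintro q s' hq ⟨hr', hf⟩ h6
    rw [Cmd.wp_seq]
    have hexp : (150 + splitCost d) * (G.order ^ d + 1) =
        150 * (G.order ^ d + 1) + splitCost d * (G.order ^ d + 1) := by ring
    refine Cmd.wp_call _ (wp_pushTypes hW (hs.frame hf (by norm_num) (by simp)) hr'.env hr'.pow hr'.len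
      ((hf.1 _ (by norm_num)).trans h4) ((hf.1 _ (by norm_num)).trans h5) h6) (by omega) ?_
    rintro r1 r1' s1 hr1 ⟨hl1, hf1⟩
    have hle := Nat.mul_le_mul_left (splitCost d) (Nat.add_le_add_right hl1.le 1)
    refine Cmd.wp_call _ (wp_splitReady hW hr' (hf1.mono (by norm_num) (List.Subset.refl _)) (by simp) hl1)
      (by omega) ?_
    rintro r2 r2' s2 hr2 ⟨hs2, hf2⟩
    refine ⟨?_, ?_, ?_⟩
    · rw [hf2.1 _ (by norm_num), hf1.1 _ (by norm_num), h6]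
    · rw [List.range_succ, List.map_append, splits_append]
      exact hs2.setVar _ (by norm_num) (by norm_num)
    · exact ((hf.trans (hf1.mono (by norm_num) (by simp))).trans
        (hf2.mono (by norm_num) (by simp))).setVar _ le_rfl
  · rintro r s' h - -
    exact h

theorem wp_splitTypes₂ (hW : Params W G.order d) (hs : Tables d s G) (hr : Ready s σ) {a : Fin d}
    (h4 : s.var 4 = a) :
    (Cmd.for' 5 (.lit d) (.for' 6 (.v vN + .lit 2) (.seq pushTypes (splitClasses d)))).wp W (fun _ s' =>
      Ready s' (splits ((List.finRange d).flatMap fun b =>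
        (List.range (G.order + 2)).map (pairTypeSet d G a b)) σ) ∧
      Frame 5 [aCls, aEl, aPos, aSize, aList, aOld, aHit, aMov, aTree] s s')
      (d * (typesCost d G.order + 17) + 17) s := by
  have hword := hW.word
  have hdW : d < W := by omega
  refine Cmd.wp_for d (typesCost d G.order) (fun b s' =>
      Ready s' (splits (((List.finRange d).take b).flatMap fun b =>
        (List.range (G.order + 2)).map (pairTypeSet d G a b)) σ) ∧
      Frame 5 [aCls, aEl, aPos, aSize, aList, aOld, aHit, aMov, aTree] s s')
    (by norm_num) (by simp) (by omega) ?_ ?_ le_rfl ?_ ?_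
  · exact ⟨hr.setVar _ (by norm_num) (by norm_num), Frame.refl.setVar _ le_rfl⟩
  · intro b s' _ _
    exact ⟨hdW, rfl⟩
  · rintro b s' hb ⟨hr', hf⟩ h5
    refine Cmd.wp_mono _ ?_ (wp_splitTypes₁ hW (hs.frame hf (by norm_num) (by simp)) hr'
      ((hf.1 _ (by norm_num)).trans h4) (b := ⟨b, hb⟩) h5)
    rintro r s2 ⟨hs2, hf2⟩
    refine ⟨?_, ?_, ?_⟩
    · rw [hf2.1 _ (by norm_num), h5]
    · rw [List.take_succ_eq_append_getElem (by simpa using hb), List.flatMap_append, splits_append]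
      simp only [List.flatMap_cons, List.flatMap_nil, List.append_nil, List.getElem_finRange]
      exact hs2.setVar _ (by norm_num) (by norm_num)
    · exact (hf.trans (hf2.mono (by norm_num) (by simp))).setVar _ le_rfl
  · rintro r s' ⟨hr', hf⟩ - -
    rw [List.take_of_length_le (by simp)] at hr'
    exact ⟨hr', hf⟩

theorem wp_splitTypes (hW : Params W G.order d) (hs : Tables d s G) (hr : Ready s σ) :
    (splitTypes d).wp W (fun _ s' => Ready s' (splits (initialSets d G) σ) ∧
      Frame 4 [aCls, aEl, aPos, aSize, aList, aOld, aHit, aMov, aTree] s s')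
      (d * (d * (typesCost d G.order + 17) + 34) + 17) s := by
  have hword := hW.word
  have hdW : d < W := by omega
  refine Cmd.wp_for d (d * (typesCost d G.order + 17) + 17) (fun a s' =>
      Ready s' (splits (((List.finRange d).take a).flatMap fun a => (List.finRange d).flatMap fun b =>
        (List.range (G.order + 2)).map (pairTypeSet d G a b)) σ) ∧
      Frame 4 [aCls, aEl, aPos, aSize, aList, aOld, aHit, aMov, aTree] s s')
    (by norm_num) (by simp) (by omega) ?_ ?_ ?_ ?_ ?_
  · exact ⟨hr.setVar _ (by norm_num) (by norm_num), Frame.refl.setVar _ le_rfl⟩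
  · intro b s' _ _
    exact ⟨hdW, rfl⟩
  · rw [show Cmd.forCost (.lit d) = 17 from rfl]
  · rintro a s' ha ⟨hr', hf⟩ h4
    refine Cmd.wp_mono _ ?_ (wp_splitTypes₂ hW (hs.frame hf (by norm_num) (by simp)) hr'
      (a := ⟨a, ha⟩) h4)
    rintro r s2 ⟨hs2, hf2⟩
    refine ⟨?_, ?_, ?_⟩
    · rw [hf2.1 _ (by norm_num), h4]
    · rw [List.take_succ_eq_append_getElem (by simpa using ha), List.flatMap_append, splits_append]
      simp only [List.flatMap_cons, List.flatMap_nil, List.append_nil, List.getElem_finRange]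
      exact hs2.setVar _ (by norm_num) (by norm_num)
    · exact (hf.trans (hf2.mono (by norm_num) (by simp))).setVar _ le_rfl
  · rintro r s' ⟨hr', hf⟩ - -
    rw [List.take_of_length_le (by simp)] at hr'
    exact ⟨hr', hf⟩

/-- Find an unmarked vertex in the first class and assign it to variable `5`. -/
def chooseVertex : Cmd :=
  .seq (.asg 4 (.v vM)) (.seq (.asg 5 (.lit 0)) (.for' 6 (.v vN)
    (.ite (.lt (.get aMark (.v 6)) (.lit 1))
      (.ite (.lt (.get aCls (.v 6 * .v 2)) (.v 4))
        (.seq (.asg 4 (.get aCls (.v 6 * .v 2))) (.asg 5 (.v 6)))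
        .skip)
      .skip)))

theorem wp_chooseVertex (hW : Params W G.order d) (hs : Tables d s G) (hr : Ready s σ)
    {vs : List (Fin G.order)} (hmark : ∀ v : Fin G.order, s.arr aMark v = if v ∈ vs then 1 else 0)
    (hvs : ∃ v, v ∉ vs) :
    chooseVertex.wp W (fun _ s' => (∃ v : Fin G.order, s'.var 5 = v ∧ v ∉ vs ∧
      ∀ w ∉ vs, σ.c (diag d v) ≤ σ.c (diag d w)) ∧ s'.var vLen = 0 ∧ Frame 4 [] s s')
      (100 * (G.order + 1)) s := by
  have hword := hW.word
  have hMle : G.order ^ d ≤ (d + 4) * G.order ^ d := Nat.le_mul_of_pos_left _ (by omega)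
  have hnM : G.order ≤ G.order ^ d := Nat.le_self_pow (by have := hW.dim; omega) _
  simp only [chooseVertex, Cmd.wp_seq, Cmd.wp_asg]
  simp [hr.env.tuples]
  refine ⟨by omega, by omega, by omega, ?_⟩
  refine Cmd.wp_for G.order 60 (fun j s' => ((s'.var 4 = G.order ^ d ∧ ∀ w : Fin G.order, (w : ℕ) < j → w ∈ vs) ∨
      ∃ v : Fin G.order, s'.var 5 = v ∧ s'.var 4 = σ.c (diag d v) ∧ v ∉ vs ∧
        ∀ w : Fin G.order, (w : ℕ) < j → w ∉ vs → σ.c (diag d v) ≤ σ.c (diag d w)) ∧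
      s'.var vLen = 0 ∧ Frame 4 [] s s')
    (by norm_num) (by simp) (by omega) ?_ ?_ ?_ ?_ ?_
  · refine ⟨Or.inl ⟨by simp, by simp⟩, by simpa using hr.len, ?_⟩
    exact ((Frame.refl.setVar _ (by norm_num)).setVar _ (by norm_num)).setVar _ (by norm_num)
  · rintro j s' ⟨-, -, hf⟩ -
    exact ⟨trivial, (hf.1 _ (by norm_num)).trans hr.env.order⟩
  · have h17 : Cmd.forCost (.v vN) = 17 := rfl
    rw [h17]
    omega
  · rintro j s' hj ⟨hI, hv, hf⟩ h6
    have hD : s'.var 2 = diagFactor G.order d := (hf.1 _ (by norm_num)).trans hs.diag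
    have hmk : s'.arr aMark j = if (⟨j, hj⟩ : Fin G.order) ∈ vs then 1 else 0 := by
      rw [hf.2 _ (by simp)]
      exact hmark ⟨j, hj⟩
    have hcode := code_diag (d := d) (⟨j, hj⟩ : Fin G.order)
    have hlt := code_lt (diag d (⟨j, hj⟩ : Fin G.order))
    have hcls : s'.arr aCls (code (diag d (⟨j, hj⟩ : Fin G.order))) = σ.c (diag d ⟨j, hj⟩) := by
      rw [hf.2 _ (by simp)]
      exact hr.rep.part.cls _
    have hcM : ∀ u, σ.c u < G.order ^ d := fun u => by
      have := hr.rep.inv.ranked.lt_card u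
      rwa [card_tuples] at this
    rw [hcode] at hlt hcls
    simp only at hlt hcls
    have hlast : ∀ w : Fin G.order, (w : ℕ) < j + 1 → (w : ℕ) < j ∨ w = ⟨j, hj⟩ := fun w hw => by
      rw [Fin.ext_iff]; dsimp only; omega
    simp [h6, hD, hmk, hcls, hv]
    refine ⟨by omega, fun hm => ⟨by omega, fun hc => ⟨by omega, ?_, ?_⟩, fun hc => ⟨?_, ?_⟩⟩, fun hm => ⟨?_, ?_⟩⟩
    · right
      refine ⟨⟨j, hj⟩, rfl, rfl, hm, fun w hw hw' => ?_⟩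
      rcases hlast w (by omega) with h | rfl
      · rcases hI with ⟨h4, hI⟩ | ⟨v, -, h4, -, hI⟩
        · exact absurd (hI w h) hw'
        · rw [h4] at hc
          exact hc.le.trans (hI w h hw')
      · exact le_rfl
    · exact ((hf.setVar _ (by norm_num)).setVar _ (by norm_num)).setVar _ (by norm_num)
    · rcases hI with ⟨h4, hI⟩ | ⟨v, h5, h4, h4', hI⟩
      · rw [h4] at hc
        exact absurd (hcM (diag d ⟨j, hj⟩)) (by omega)
      · refine Or.inr ⟨v, h5, h4, h4', fun w hw hw' => ?_⟩
        rcases hlast w (by omega) with h | rfl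
        · exact hI w h hw'
        · rwa [h4] at hc
    · exact hf.setVar _ (by norm_num)
    · rcases hI with ⟨h4, hI⟩ | ⟨v, h5, h4, h4', hI⟩
      · refine Or.inl ⟨h4, fun w hw => ?_⟩
        rcases hlast w (by omega) with h | rfl
        · exact hI w h
        · exact hm
      · refine Or.inr ⟨v, h5, h4, h4', fun w hw hw' => ?_⟩
        rcases hlast w (by omega) with h | rfl
        · exact hI w h hw'
        · exact absurd hm hw'
    · exact hf.setVar _ (by norm_num)
  · rintro r s' ⟨hI, hv, hf⟩ - -
    refine ⟨?_, hv, hf⟩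
    rcases hI with ⟨-, hI⟩ | ⟨v, h5, -, h4, hI⟩
    · obtain ⟨v, hv⟩ := hvs
      exact absurd (hI v v.2) hv
    · exact ⟨v, h5, h4, fun w hw => hI w w.2 hw⟩

end

section
variable {W d : ℕ} {G : ColouredGraph} {s : Store}

/-- The potential of the stored partition when no class is pending. -/
noncomputable def storePot (d n : ℕ) (s : Store) : ℕ :=
  pot (⟨fun u => s.arr aCls (code u), fun _ => False⟩ : St (Fin d → Fin n))

theorem Ready.storePot_eq {n : ℕ} {σ : St (Fin d → Fin n)} (h : Ready s σ) (hp : ¬ ∃ u, σ.p u) :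
    storePot d n s = pot σ := by
  obtain ⟨c, p⟩ := σ
  rw [storePot]
  congr 2
  · exact funext h.rep.part.cls
  · exact funext fun u => propext ⟨False.elim, fun h => hp ⟨u, h⟩⟩

/-- Choose a vertex, write it to the array of chosen vertices, and refine. -/
def individualise (d : ℕ) : Cmd :=
  .seq chooseVertex (.seq (.wr aMark (.v 5) (.lit 1)) (.seq (.wr aOrd (.v vN - .lit 1 - .v 3) (.v 5))
    (.seq (.wr aList (.lit 0) (.v 5 * .v 2)) (.seq (.asg vLen (.lit 1))
      (.seq (splitClasses d) (refineAll d))))))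

/-- The arrays that record the vertices chosen so far. -/
structure Chosen (s : Store) (vs : List (Fin G.order)) : Prop where
  mark : ∀ v : Fin G.order, s.arr aMark v = if v ∈ vs then 1 else 0
  order : ∀ i (hi : i < vs.length), s.arr aOrd (G.order - vs.length + i) = vs[i]

theorem Chosen.congr {vs : List (Fin G.order)} {s' : Store} (h : Chosen s vs)
    (hm : s'.arr aMark = s.arr aMark) (ho : s'.arr aOrd = s.arr aOrd) : Chosen s' vs :=
  ⟨by rw [hm]; exact h.mark, by rw [ho]; exact h.order⟩

theorem Chosen.cons {vs : List (Fin G.order)} {v : Fin G.order} {s' : Store} (h : Chosen s vs)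
    (hlen : vs.length < G.order)
    (hm : ∀ i, s'.arr aMark i = if i = v then 1 else s.arr aMark i)
    (ho : ∀ i, s'.arr aOrd i = if i = G.order - 1 - vs.length then (v : ℕ) else s.arr aOrd i) :
    Chosen s' (v :: vs) := by
  refine ⟨fun w => ?_, fun i hi => ?_⟩
  · rw [hm, h.mark]
    simp only [List.mem_cons, Fin.ext_iff]
    split_ifs <;> simp_all
  · rw [ho]
    rcases i with _ | i
    · rw [if_pos (by simp; omega)]
      rfl
    · simp only [List.length_cons, List.getElem_cons_succ] at hi ⊢
      rw [if_neg (by omega), ← h.order i (by omega)]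
      congr 1
      omega

/-- The time for choosing a vertex, except for the amortised time of the refinement. -/
def individualiseCost (d n : ℕ) : ℕ := 100 * (n + 1) + 2 * splitCost d + 200

theorem wp_individualise (hW : Params W G.order d) {vs : List (Fin G.order)} (hs : Tables d s G)
    (hr : Ready s (state d G vs)) (hc : Chosen s vs) (hsel : Selected d G vs)
    (hlen : vs.length < G.order) (h3 : s.var 3 = vs.length) :
    (individualise d).wp W (fun r s' => ∃ v, Selected d G (v :: vs) ∧ Ready s' (state d G (v :: vs)) ∧
      Chosen s' (v :: vs) ∧ Frame 4 [aCls, aEl, aPos, aSize, aList, aOld, aHit, aMov, aTree, aSpl, aCnt,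
        aMark, aOrd] s s' ∧ roundCost d * (G.order * pot (state d G (v :: vs))) ≤ r)
      (individualiseCost d G.order + roundCost d * (G.order * pot (state d G vs))) s := by
  have hword := hW.word
  have hMle : G.order ^ d ≤ (d + 4) * G.order ^ d := Nat.le_mul_of_pos_left _ (by omega)
  have hnM : G.order ≤ G.order ^ d := Nat.le_self_pow (by have := hW.dim; omega) _
  have hcost : individualiseCost d G.order = 100 * (G.order + 1) + 2 * splitCost d + 200 := rfl
  have hvs : ∃ v, v ∉ vs := by
    by_contra! h
    have h1 := (List.toFinset_card_le vs).trans_lt hlen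
    rw [show vs.toFinset = univ from eq_univ_iff_forall.2 fun v => List.mem_toFinset.2 (h v)] at h1
    simp at h1
  simp only [individualise, Cmd.wp_seq]
  refine Cmd.wp_call _ (wp_chooseVertex hW hs hr hc.mark hvs) (by omega) ?_
  rintro r1 r1' s1 hr1 ⟨⟨v, h5, hv, hmin⟩, hlen1, hf1⟩
  have hD : s1.var 2 = diagFactor G.order d := (hf1.1 _ (by norm_num)).trans hs.diag
  have k3 : s1.var 3 = vs.length := (hf1.1 _ (by norm_num)).trans h3
  have kN : s1.var vN = G.order := (hf1.1 _ (by norm_num)).trans hr.env.order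
  have hcode := code_diag (d := d) v
  have hlt := code_lt (diag d v)
  simp [h5, hD, k3, kN, ← hcode]
  refine ⟨by omega, by omega, by omega, by omega, by omega, by omega, by omega, by omega, ?_⟩
  set s2 := ((((s1.setArr aMark v 1).setArr aOrd (G.order - 1 - vs.length) v).setArr aList 0
    (code (diag d v))).setVar vLen 1) with hs2
  have hfs : Frame 4 [aMark, aOrd, aList] s s2 :=
    ((((hf1.mono le_rfl (by simp)).setArr _ _ (by simp)).setArr _ _ (by simp)).setArr _ _
      (by simp)).setVar _ (by norm_num)
  have hl : ListOf s2 ({diag d v} : Set (Fin d → Fin G.order)) := by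
    refine ⟨fun _ => diag d v, ⟨rfl, fun i hi => ?_, fun i hi j hj _ => ?_⟩, ?_⟩
    · have : i = 0 := by simpa [hs2] using hi
      simp [hs2, this]
    · simp [hs2] at hi hj
      omega
    · ext u
      simp [listSet, hs2, eq_comm]
  have hv1 : s2.var vLen = 1 := by simp [hs2]
  refine Cmd.wp_call _ (wp_splitReady hW hr (hfs.mono (by norm_num) (List.Subset.refl _)) (by simp) hl)
    (by rw [hv1]; omega) ?_
  rintro r3 r3' s3 hr3 ⟨hR3, hf3⟩
  rw [hv1] at hr3
  have hpot := Nat.mul_le_mul_left (roundCost d) (Nat.mul_le_mul_left G.order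
    ((inv_state vs).pot_split_le {diag d v}))
  refine Cmd.wp_call _ (wp_refineAll hW hR3) (by omega) ?_
  rintro r4 r4' s4 hr4 ⟨hR4, hp4, hf4⟩
  refine ⟨v, .cons v vs hsel hv hmin, hR4, ?_, ?_, le_trans hp4 (by omega)⟩
  · refine hc.cons hlen (fun i => ?_) fun i => ?_
    · rw [hf4.2 _ (by simp), hf3.2 _ (by simp), ← hf1.2 aMark (by simp)]
      simp [hs2]
    · rw [hf4.2 _ (by simp), hf3.2 _ (by simp), ← hf1.2 aOrd (by simp)]
      simp [hs2]
  · exact ((hfs.mono le_rfl (by simp)).trans (hf3.mono (by norm_num) (by simp))).trans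
      (hf4.mono (by norm_num) (by simp))

/-- Put the vertices in a canonical order. -/
def orderVertices (d : ℕ) : Cmd := .for' 3 (.v vN) (individualise d)

theorem wp_orderVertices (hW : Params W G.order d) (hs : Tables d s G) (hr : Ready s (state d G []))
    (hz : ∀ v, s.arr aMark v = 0) :
    (orderVertices d).wp W (fun _ s' => ∃ vs, Selected d G vs ∧ vs.length = G.order ∧ Chosen s' vs ∧
      Frame 3 [aCls, aEl, aPos, aSize, aList, aOld, aHit, aMov, aTree, aSpl, aCnt, aMark, aOrd] s s')
      (G.order * (individualiseCost d G.order + 17) + 17 +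
        roundCost d * (G.order * pot (state d G []))) s := by
  have hword := hW.word
  refine Cmd.wp_for' G.order (individualiseCost d G.order) (fun r s' => ∃ vs, Selected d G vs ∧
      vs.length = r ∧ Ready s' (state d G vs) ∧ Chosen s' vs ∧
      Frame 3 [aCls, aEl, aPos, aSize, aList, aOld, aHit, aMov, aTree, aSpl, aCnt, aMark, aOrd] s s')
    (fun _ s' => roundCost d * (G.order * storePot d G.order s'))
    (by norm_num) (by simp) (by omega) ?_ ?_ ?_ ?_ ?_
  · exact ⟨[], .nil, rfl, hr.setVar _ (by norm_num) (by norm_num), ⟨fun v => by simpa using hz v, by simp⟩,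
      Frame.refl.setVar _ le_rfl⟩
  · rintro j s' ⟨vs, -, -, hr', -⟩ -
    exact ⟨trivial, hr'.env.order⟩
  · have h17 : Cmd.forCost (.v vN) = 17 := rfl
    rw [h17, (hr.setVar 0 (show 2 ≤ 3 by norm_num) (by norm_num)).storePot_eq (not_pending_state _)]
  · rintro j s' hj ⟨vs, hsel, rfl, hr', hc, hf⟩ h3
    rw [hr'.storePot_eq (not_pending_state _)]
    refine Cmd.wp_mono _ ?_ (wp_individualise hW (hs.frame hf le_rfl (by simp)) hr' hc hsel hj h3)
    rintro r s2 ⟨v, hsel2, hr2, hc2, hf2, hp⟩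
    have hr2' := hr2.setVar (vs.length + 1) (show 2 ≤ 3 by norm_num) (by norm_num)
    refine ⟨by rw [hf2.1 _ (by norm_num), h3], ?_, v :: vs, hsel2, rfl, hr2', hc2.congr rfl rfl, ?_⟩
    · rw [hr2'.storePot_eq (not_pending_state _)]
      exact hp
    · exact (hf.trans (hf2.mono (by norm_num) (by simp))).setVar _ le_rfl
  · rintro r s' ⟨vs, hsel, hlen, -, hc, hf⟩ - -
    exact ⟨vs, hsel, hlen, hc, hf⟩

end

section
variable {W d : ℕ} {G : ColouredGraph} {s : Store}

/-- Relabel the graph according to the order of the vertices. -/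
def relabelGraph : Cmd :=
  .seq (.for' 4 (.v vN) (.wr aColNew (.v 4) (.get 0 (.get aOrd (.v 4)))))
    (.seq (.for' 4 (.v vN * .v vN) (.wr aAdjNew (.v 4)
      (.get 1 (.v vN * .get aOrd (.v 4 / .v vN) + .get aOrd (.v 4 % .v vN)))))
    (.seq (.for' 4 (.v vN) (.wr 0 (.v 4) (.get aColNew (.v 4))))
      (.for' 4 (.v vN * .v vN) (.wr 1 (.v 4) (.get aAdjNew (.v 4))))))

theorem wp_relabelGraph (hW : Params W G.order d) (hs : HasGraph s G) {vs : List (Fin G.order)}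
    (hc : Chosen s vs) (hlen : vs.length = G.order) :
    relabelGraph.wp W (fun _ s' => Outputs s' (relabel G vs hlen)) (300 * (G.order * G.order + 1)) s := by
  have hword := hW.word
  have hn := hW.pos
  have hMle : G.order ^ d ≤ (d + 4) * G.order ^ d := Nat.le_mul_of_pos_left _ (by omega)
  have hnM : G.order * G.order ≤ G.order ^ d := by
    rw [← pow_two]
    exact Nat.pow_le_pow_right hn hW.dim
  have hnn : G.order ≤ G.order * G.order := Nat.le_mul_of_pos_left _ hn
  have hord : ∀ i (hi : i < G.order), s.arr aOrd i = vs[i]'(hi.trans_eq hlen.symm) := fun i hi => by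
    rw [← hc.order i (hi.trans_eq hlen.symm), hlen, Nat.sub_self, Nat.zero_add]
  have hdivmod : ∀ u v : Fin G.order,
      (G.order * (u : ℕ) + v) / G.order = u ∧ (G.order * (u : ℕ) + v) % G.order = v := fun u v =>
    ⟨by rw [Nat.mul_add_div hn, Nat.div_eq_of_lt v.2, add_zero], by
      rw [Nat.mul_add_mod, Nat.mod_eq_of_lt v.2]⟩
  have h17 : Cmd.forCost (.v vN) = 17 := rfl
  have h20 : Cmd.forCost (.v vN * .v vN) = 20 := rfl
  simp only [relabelGraph, Cmd.wp_seq]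
  refine wp_fill G.order (fun i => s.arr 0 (s.arr aOrd i)) (by norm_num) (by simp) (by simp) (by omega)
    (fun s' hv _ => ⟨trivial, (hv _ (by norm_num)).trans hs.order⟩)
    (fun i _ s' h4 _ ha => ⟨by simp, by simp [h4, ha]⟩) (by rw [h17]; simp; omega) ?_
  intro r1 s1 hcol hv1 ha1 hr1
  rw [h17] at hr1
  simp at hr1
  have o1 : s1.var vN = G.order := (hv1 _ (by norm_num)).trans hs.order
  refine wp_fill (G.order * G.order) (fun i => s.arr 1 (G.order * s.arr aOrd (i / G.order) +
      s.arr aOrd (i % G.order))) (by norm_num) (by simp) (by simp) (by omega)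
    (fun s' hv _ => ?_) (fun i hi s' h4 hv ha => ?_) (by rw [h20]; simp; omega) ?_
  · have : s'.var vN = G.order := (hv _ (by norm_num)).trans o1
    simp [this]
    omega
  · have hN : s'.var vN = G.order := (hv _ (by norm_num)).trans o1
    have hO : s'.arr aOrd = s.arr aOrd := (ha _ (by norm_num)).trans (ha1 _ (by norm_num))
    have hA : s'.arr 1 = s.arr 1 := (ha _ (by norm_num)).trans (ha1 _ (by norm_num))
    have hdiv : i / G.order < G.order := (Nat.div_lt_iff_lt_mul hn).2 hi
    have hmod := Nat.mod_lt i hn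
    have hlt := mul_add_lt (vs[i / G.order]'(by omega)) (vs[i % G.order]'(by omega))
    simp [h4, hN, hO, hA, hord _ hdiv, hord _ hmod]
    omega
  intro r2 s2 hadj hv2 ha2 hr2
  rw [h20] at hr2
  simp at hr2
  have o2 : s2.var vN = G.order := (hv2 _ (by norm_num)).trans o1
  refine wp_fill G.order (fun i => s.arr 0 (s.arr aOrd i)) (by norm_num) (by simp) (by simp) (by omega)
    (fun s' hv _ => ⟨trivial, (hv _ (by norm_num)).trans o2⟩)
    (fun i hi s' h4 _ ha => ⟨by simp, ?_⟩) (by rw [h17]; simp; omega) ?_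
  · simp only [Ex.eval_get, Ex.eval_v, h4]
    rw [ha _ (by norm_num), ha2 _ (by norm_num)]
    exact hcol i hi
  intro r3 s3 hcol3 hv3 ha3 hr3
  rw [h17] at hr3
  simp at hr3
  have o3 : s3.var vN = G.order := (hv3 _ (by norm_num)).trans o2
  refine wp_fill (G.order * G.order) (fun i => s.arr 1 (G.order * s.arr aOrd (i / G.order) +
      s.arr aOrd (i % G.order))) (by norm_num) (by simp) (by simp) (by omega)
    (fun s' hv _ => ?_) (fun i hi s' h4 _ ha => ⟨by simp, ?_⟩) (by rw [h20]; simp; omega) ?_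
  · have : s'.var vN = G.order := (hv _ (by norm_num)).trans o3
    simp [this]
    omega
  · simp only [Ex.eval_get, Ex.eval_v, h4]
    rw [ha _ (by norm_num), ha3 _ (by norm_num)]
    exact hadj i hi
  intro r4 s4 hadj4 hv4 ha4 _
  refine ⟨(hv4 _ (by norm_num)).trans o3, fun v => ?_, fun u v => ?_⟩
  · rw [ha4 _ (by norm_num)]
    refine (hcol3 v v.2).trans ?_
    rw [hord v v.2, hs.colour]
    rfl
  · have hu := u.2
    have hv := v.2
    refine (hadj4 _ (mul_add_lt u v)).trans ?_
    obtain ⟨e1, e2⟩ := hdivmod u v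
    change s.arr 1 (G.order * s.arr aOrd ((G.order * (u : ℕ) + v) / G.order) +
      s.arr aOrd ((G.order * (u : ℕ) + v) % G.order)) = _
    rw [e1, e2, hord u hu, hord v hv, hs.adj]
    rfl

/-- The canonisation algorithm. -/
def canonise (d : ℕ) : Cmd :=
  .ite (.lt (.lit 0) (.v vN))
    (.seq (computePowers d) (.seq computeTypes (.seq (initPartition d) (.seq (splitTypes d)
      (.seq (refineAll d) (.seq (orderVertices d) relabelGraph))))))
    .skip

/-- The running time of the canonisation algorithm. -/
def canoniseCost (d n : ℕ) : ℕ :=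
  100 * (d + 1) + 600 * (n * n + 1) + (splitCost d + 100 * n ^ d) +
    (d * (d * (typesCost d n + 17) + 34) + 17) + (n * (individualiseCost d n + 17) + 17) +
    roundCost d * (n * (n ^ d * (Nat.log 2 (n ^ d) + 1))) + 40

theorem wp_canonise (hd : 2 ≤ d) (hW : (d + 4) * G.order ^ d + G.order + d + 4 < W) :
    (canonise d).wp W (fun _ s' => ∃ (vs : List (Fin G.order)) (h : vs.length = G.order),
      Selected d G vs ∧ Outputs s' (relabel G vs h)) (canoniseCost d G.order) (input G) := by
  have hG := hasGraph_input G
  have hN : (input G).var vN = G.order := hG.order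
  rw [canonise, Cmd.wp_ite]
  simp [hN]
  refine ⟨by omega, by rw [canoniseCost]; omega, fun hn => ?_, fun h0 => ?_⟩
  swap
  · refine ⟨by rw [canoniseCost]; omega, [], .nil, h0.symm, hN, fun v => ?_, fun u => ?_⟩
    · exact absurd (v.2.trans_eq h0) (Nat.not_lt_zero _)
    · exact absurd (u.2.trans_eq h0) (Nat.not_lt_zero _)
  have hP : Params W G.order d := ⟨hn, hd, hW⟩
  have hcost : canoniseCost d G.order = 100 * (d + 1) + 600 * (G.order * G.order + 1) +
    (splitCost d + 100 * G.order ^ d) + (d * (d * (typesCost d G.order + 17) + 34) + 17) +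
    (G.order * (individualiseCost d G.order + 17) + 17) +
    roundCost d * (G.order * (G.order ^ d * (Nat.log 2 (G.order ^ d) + 1))) + 40 := rfl
  have hz0 : ∀ a, 2 ≤ a → ∀ j, (input G).arr a j = 0 := fun a ha j => by
    simp [input, show a ≠ 0 by omega, show a ≠ 1 by omega]
  refine Cmd.wp_call _ (wp_computePowers hP hN) (by omega) ?_
  rintro r1 r1' s1 hr1 ⟨hM1, hD1, hp1, hf1⟩
  rw [Cmd.wp_seq]
  refine Cmd.wp_call _ (wp_computeTypes hP (hG.frame hf1 le_rfl (by simp) (by simp))) (by omega) ?_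
  rintro r2 r2' s2 hr2 ⟨ht2, hf2⟩
  have hf02 : Frame 1 [aPow, aType] (input G) s2 :=
    (hf1.mono le_rfl (by simp)).trans (hf2.mono (by norm_num) (by simp))
  have hE2 : Env G.order d s2 :=
    ⟨(hf02.1 _ (by norm_num)).trans hN, (hf2.1 _ (by norm_num)).trans hM1⟩
  have hT2 : Tables d s2 G :=
    ⟨hG.frame hf02 le_rfl (by simp) (by simp), (hf2.1 _ (by norm_num)).trans hD1, ht2⟩
  have hp2 : ∀ j < d, s2.arr aPow j = G.order ^ j := by rw [hf2.2 _ (by simp)]; exact hp1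
  rw [Cmd.wp_seq]
  refine Cmd.wp_call _ (wp_initPartition hP hE2 hp2 fun a ha j => ?_) (by omega) ?_
  · rw [hf02.2 a (by rintro h; simp at ha h; omega)]
    exact hz0 a (by simp at ha; omega) j
  rintro r3 r3' s3 hr3 ⟨hR3, hf3⟩
  have hT3 := hT2.frame hf3 (by norm_num) (by simp)
  rw [Cmd.wp_seq]
  refine Cmd.wp_call _ (wp_splitTypes hP hT3 hR3) (by omega) ?_
  rintro r4 r4' s4 hr4 ⟨hR4, hf4⟩
  have hT4 := hT3.frame hf4 (by norm_num) (by simp)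
  have hpot : pot (splits (initialSets d G) (trivialSt (Fin d → Fin G.order))) ≤
      G.order ^ d * (Nat.log 2 (G.order ^ d) + 1) := by
    refine (inv_trivialSt.pot_splits_le _).trans (pot_trivialSt_le.trans ?_)
    rw [card_tuples]
  have hpot' := Nat.mul_le_mul_left (roundCost d) (Nat.mul_le_mul_left G.order hpot)
  rw [Cmd.wp_seq]
  refine Cmd.wp_call _ (wp_refineAll hP hR4) (by omega) ?_
  rintro r5 r5' s5 hr5 ⟨hR5, hp5, hf5⟩
  have hT5 := hT4.frame hf5 (by norm_num) (by simp)
  change Ready s5 (state d G []) at hR5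
  change roundCost d * (G.order * pot (state d G [])) ≤ r5 at hp5
  rw [Cmd.wp_seq]
  refine Cmd.wp_call _ (wp_orderVertices hP hT5 hR5 fun v => ?_) (by omega) ?_
  · rw [hf5.2 _ (by simp), hf4.2 _ (by simp), hf3.2 _ (by simp), hf02.2 _ (by simp)]
    exact hz0 _ (by norm_num) v
  rintro r6 r6' s6 hr6 ⟨vs, hsel, hlen, hc, hf6⟩
  have hT6 := hT5.frame hf6 le_rfl (by simp)
  refine Cmd.wp_call _ (wp_relabelGraph hP hT6.graph hc hlen) (by omega) ?_
  rintro r7 r7' s7 - ho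
  exact ⟨vs, hsel, hlen, ho⟩

end

end RAM

namespace RAM

open Refinement Asymptotics Filter

theorem canoniseCost_le (d : ℕ) (hd : 2 ≤ d) :
    ∃ K, ∀ n, 2 ≤ n → canoniseCost d n ≤ K * (n ^ (d + 1) * Nat.log 2 n) := by
  refine ⟨100 * (d + 1) + 1200 + (splitCost d + 100) + (d * (d * (4 * splitCost d + 660 + 17) + 34) + 17) +
    (2 * splitCost d + 417 + 17) + roundCost d * (2 * d) + 40, fun n hn => ?_⟩
  set S := splitCost d
  set R := roundCost d
  set X := n ^ (d + 1) * Nat.log 2 n with hX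
  have hlog : 1 ≤ Nat.log 2 n := Nat.log_pos (by norm_num) hn
  have hNX : n ^ (d + 1) ≤ X := Nat.le_mul_of_pos_right _ hlog
  have hnP : n * n ^ d = n ^ (d + 1) := (pow_succ' n d).symm
  have hP1 : 1 ≤ n ^ d := Nat.one_le_pow _ _ (by omega)
  have hPX : n ^ d ≤ X := (Nat.pow_le_pow_right (by omega) (by omega)).trans hNX
  have hX1 : 1 ≤ X := hP1.trans hPX
  have hnnX : n * n ≤ X := by
    rw [← pow_two]
    exact (Nat.pow_le_pow_right (by omega) (by omega)).trans hNX
  have htypes : typesCost d n ≤ (4 * S + 660) * X := by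
    calc typesCost d n = (n + 2) * ((150 + S) * (n ^ d + 1) + 20) + 20 := rfl
      _ ≤ (2 * n) * ((150 + S) * (2 * n ^ d) + 20 * n ^ d) + 20 * X := by
        gcongr <;> omega
      _ = (4 * S + 640) * (n * n ^ d) + 20 * X := by ring
      _ ≤ (4 * S + 640) * X + 20 * X := by
        rw [hnP]
        gcongr
      _ = (4 * S + 660) * X := by ring
  have hind : n * (individualiseCost d n + 17) ≤ (2 * S + 417) * X := by
    calc n * (individualiseCost d n + 17) = n * (100 * (n + 1) + 2 * S + 200 + 17) := rfl
      _ ≤ n * (100 * (n + n) + 2 * S * n + 200 * n + 17 * n) := by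
        have : 2 * S * 1 ≤ 2 * S * n := Nat.mul_le_mul_left _ (by omega)
        exact Nat.mul_le_mul_left _ (by omega)
      _ = (2 * S + 417) * (n * n) := by ring
      _ ≤ (2 * S + 417) * X := Nat.mul_le_mul_left _ hnnX
  have hround : n * (n ^ d * (Nat.log 2 (n ^ d) + 1)) ≤ 2 * d * X := by
    have h1 : Nat.log 2 (n ^ d) < d * (Nat.log 2 n + 1) := by
      refine Nat.log_lt_of_lt_pow (by omega) ?_
      rw [mul_comm, pow_mul]
      exact Nat.pow_lt_pow_left (Nat.lt_pow_succ_log_self (by norm_num) n) (by omega)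
    have h2 : d * (Nat.log 2 n + 1) ≤ d * (2 * Nat.log 2 n) := Nat.mul_le_mul_left _ (by omega)
    calc n * (n ^ d * (Nat.log 2 (n ^ d) + 1)) = n ^ (d + 1) * (Nat.log 2 (n ^ d) + 1) := by ring
      _ ≤ n ^ (d + 1) * (d * (2 * Nat.log 2 n)) := Nat.mul_le_mul_left _ (by omega)
      _ = 2 * d * X := by rw [hX]; ring
  calc canoniseCost d n = 100 * (d + 1) * 1 + 600 * (n * n + 1) + (S * 1 + 100 * n ^ d) +
        (d * (d * (typesCost d n + 17 * 1) + 34 * 1) + 17 * 1) + (n * (individualiseCost d n + 17) + 17 * 1) +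
        R * (n * (n ^ d * (Nat.log 2 (n ^ d) + 1))) + 40 * 1 := by simp only [mul_one]; rfl
    _ ≤ 100 * (d + 1) * X + 600 * (X + X) + (S * X + 100 * X) +
        (d * (d * ((4 * S + 660) * X + 17 * X) + 34 * X) + 17 * X) + ((2 * S + 417) * X + 17 * X) +
        R * (2 * d * X) + 40 * X := by gcongr
    _ = _ := by ring

theorem isBigO_canoniseCost (d : ℕ) (hd : 2 ≤ d) :
    (fun n => (canoniseCost d n : ℝ)) =O[atTop] fun n => (n : ℝ) ^ (d + 1) * Real.log n := by
  obtain ⟨K, hK⟩ := canoniseCost_le d hd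
  refine IsBigO.of_bound (K / Real.log 2) ?_
  filter_upwards [eventually_ge_atTop 2] with n hn
  have hl2 : 0 < Real.log 2 := Real.log_pos (by norm_num)
  have hlog : (Nat.log 2 n : ℝ) ≤ Real.log n / Real.log 2 := by
    have := Real.natLog_le_logb n 2
    rwa [Real.logb] at this
  have hln : 0 ≤ Real.log n := Real.log_natCast_nonneg n
  rw [Real.norm_of_nonneg (by positivity), Real.norm_of_nonneg (by positivity)]
  calc (canoniseCost d n : ℝ) ≤ K * ((n : ℝ) ^ (d + 1) * Nat.log 2 n) := by exact_mod_cast hK n hn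
    _ ≤ K * ((n : ℝ) ^ (d + 1) * (Real.log n / Real.log 2)) := by gcongr
    _ = K / Real.log 2 * ((n : ℝ) ^ (d + 1) * Real.log n) := by ring

theorem params_word (d n m : ℕ) :
    (d + 4) * n ^ d + n + d + 4 < m + (4 * d + 20) * (n + 1) ^ (4 * d + 20) := by
  have h1 : n ^ d ≤ (n + 1) ^ (4 * d + 20) :=
    (Nat.pow_le_pow_left (Nat.le_succ n) d).trans (Nat.pow_le_pow_right (Nat.succ_pos n) (by omega))
  have h2 : n + 1 ≤ (n + 1) ^ (4 * d + 20) := Nat.le_self_pow (by omega) _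
  nlinarith [Nat.zero_le d, Nat.mul_le_mul_left d h1, Nat.mul_le_mul_left d h2]

theorem good_input (G : ColouredGraph) {c : ℕ} (hc : 2 ≤ c) :
    Good (G.maxColour + c * (G.order + 1) ^ c) (input G) := by
  have h2 : G.order + 1 ≤ (G.order + 1) ^ c := Nat.le_self_pow (by omega) _
  have h3 : 2 * (G.order + 1) ^ c ≤ c * (G.order + 1) ^ c := Nat.mul_le_mul_right _ hc
  refine ⟨⟨fun x => ?_, fun a j => ?_⟩, fun x hx => ?_⟩
  · simp only [input]
    split_ifs <;> omega
  · simp only [input]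
    split_ifs with h1 h4
    · have := Finset.le_sup (f := G.colour) (Finset.mem_univ ⟨j, h4⟩)
      rw [← ColouredGraph.maxColour] at this
      omega
    all_goals omega
  · simp [input, show x ≠ 0 by omega]

theorem exists_exec (d : ℕ) (hd : 2 ≤ d) (G : ColouredGraph) :
    ∃ (vs : List (Fin G.order)) (h : vs.length = G.order), Selected d G vs ∧
      ∃ t s', t ≤ canoniseCost d G.order ∧
        Exec (G.maxColour + (4 * d + 20) * (G.order + 1) ^ (4 * d + 20)) (canonise d).compile
          (input G) t s' ∧ Outputs s' (relabel G vs h) := by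
  obtain ⟨t, r, s', ht, hex, -, vs, h, hsel, ho⟩ := Cmd.wp_sound _ (good_input G (by omega))
    (wp_canonise hd (params_word d G.order G.maxColour))
  exact ⟨vs, h, hsel, t, s', by omega, hex, ho⟩

end RAM

theorem mainTheorem7 (k : ℕ) (hk : 1 ≤ k) (C : GraphClass)
    (hC : ∀ G ∈ C.coloured, ColouredGraph.WLIdentifies k G) :
    ∃ κ : C.coloured → C.coloured, IsCanonisation κ ∧
      RAM.ComputableInTime κ (fun n => (n : ℝ) ^ (k + 3) * Real.log n) := by
  choose vs hlen hsel hexec using RAM.exists_exec (k + 2) (by omega)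
  have hiso : ∀ G, (Refinement.relabel G (vs G) (hlen G)).Iso G := fun G => Refinement.relabel_iso _ (hsel G).nodup
  refine ⟨fun G => ⟨Refinement.relabel G.1 (vs G.1) (hlen G.1), ?_⟩, ⟨fun G => hiso G.1, fun G H hGH => ?_⟩,
    (RAM.canonise (k + 2)).compile, 4 * (k + 2) + 20, RAM.canoniseCost (k + 2),
    RAM.isBigO_canoniseCost (k + 2) (by omega), fun G => ?_⟩
  · obtain ⟨e, -⟩ := hiso G.1
    exact C.iso_closed _ _ _ G.2 ⟨e.symm⟩
  · refine Subtype.ext ?_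
    have hl : (vs G.1).length = (vs H.1).length := by
      obtain ⟨e, -⟩ := hGH
      rw [hlen, hlen]
      simpa using Fintype.card_congr e.toEquiv
    obtain ⟨e, he, h⟩ := (hsel G.1).exists_iso (k := k) (fun χ => hC _ H.2) (hsel H.1) hl hGH
    exact Refinement.relabel_eq_of_iso (hlen _) (hlen _) e he h
  · exact hexec G.1
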